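/- Rings are associative and unital, not necessarily commutative; a ring $k$ is von Neumann regular if for every $x\in k$ there is $y\in k$ with $xyx=x$. Let $k$ be a von Neumann regular ring, $V$ a $k$-$k$-bimodule, $N\ge 2$ an integer and $R\subseteq V^{\otimes_k N}$ a sub-$k$-$k$-bimodule. Let $T_k(V)=\bigoplus_{n\ge 0}V^{\otimes_k n}$ be the tensor ring, $I(R)$ the two-sided ideal generated by $R$, and $A=T_k(V)/I(R)$, graded by the images $A_n$ of $V^{\otimes_k n}$; one says that $A$ has $N$-homogeneous relations. The augmentation $A\to A_0=k$ makes $k$ a right module $k_A$ and a left module ${}_Ak$, concentrated in degree $0$, so that $\mathrm{Tor}^A_n(k_A,{}_Ak)$ is graded. With $\zeta(2q)=qN$ and $\zeta(2q+1)=qN+1$, the algebra $A$ is called Koszul if for every $n\ge 3$ the graded module $\mathrm{Tor}^A_n(k_A,{}_Ak)$ is concentrated in degree $\zeta(n)$. Let $f:k\to k'$ be a ring morphism with $k'$ von Neumann regular. Assume that $V$ is also a $k'$-$k$-bimodule with the same right $k$-action, whose left $k'$-action extends the left $k$-action (i.e. $f(a)v=av$ for $a\in k$, $v\in V$), and that $R$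 is a left sub-$k'$-module of $V^{\otimes_k N}$, where $k'$ acts on the first factor. Let $V'=V\otimes_k k'$, a $k'$-$k'$-bimodule, let $R'\subseteq T_{k'}(V')$ be the image of $R\otimes_k k'$ under $(v_1\otimes\cdots\otimes v_N)\otimes c\mapsto (v_1\otimes 1)\cdots(v_N\otimes 1)\,c$, and let $A'=T_{k'}(V')/I(R')$. If $A$ is Koszul, then $R'$ is a sub-$k'$-$k'$-bimodule of $V'^{\otimes_{k'} N}$, so that $A'$ has $N$-homogeneous relations, and $A'$ is Koszul. Moreover, the canonical map $A\otimes_k k'\to A'$, $a\otimes c\mapsto \bar\jmath(a)\,c$, where $\bar\jmath:A\to A'$ is the ring morphism induced by $f$ and $v\mapsto v\otimes 1$, is bijective, maps $A_n\otimes_k k'$ onto $A'_n$ for every $n\ge 0$, and is left $k'$-linear on $A_n\otimes_k k'$ for $n\ge 1$. -/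

import Mathlib

open scoped TensorProduct DirectSum Polynomial

noncomputable section

namespace NKoszul

universe u v w x y

/-- A ring is von Neumann regular if every `a` has a quasi-inverse `b`, i.e. `a * b * a = a`. -/
def IsVonNeumannRegular (k : Type u) [Ring k] : Prop := ∀ a : k, ∃ b : k, a * b * a = a

/-! ### Tensor products over a noncommutative ring -/

section Tensor

variable (S : Type u) [Ring S]

/-- The subgroup of `M ⊗[ℤ] N` generated by the elements `m s ⊗ n - m ⊗ s n`. -/
def balRel (M : Type v) (N : Type w) [AddCommGroup M] [Module Sᵐᵒᵖ M] [AddCommGroup N]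
    [Module S N] : AddSubgroup (M ⊗[ℤ] N) :=
  AddSubgroup.closure {z | ∃ (m : M) (s : S) (n : N),
    z = (MulOpposite.op s • m) ⊗ₜ[ℤ] n - m ⊗ₜ[ℤ] (s • n)}

/-- The tensor product `M ⊗_S N` of a right `S`-module `M` and a left `S`-module `N`, for a ring
`S` which need not be commutative; it is an abelian group. -/
def BalTensor (M : Type v) (N : Type w) [AddCommGroup M] [Module Sᵐᵒᵖ M] [AddCommGroup N]
    [Module S N] : Type (max v w) :=
  (M ⊗[ℤ] N) ⧸ balRel S M N

namespace BalTensor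

variable {S}
variable {M : Type v} {N : Type w} [AddCommGroup M] [Module Sᵐᵒᵖ M] [AddCommGroup N] [Module S N]

instance : AddCommGroup (BalTensor S M N) :=
  inferInstanceAs (AddCommGroup ((M ⊗[ℤ] N) ⧸ balRel S M N))

variable (S) in
/-- The pure tensor `m ⊗ n` in `M ⊗_S N`. -/
def tmul (m : M) (n : N) : BalTensor S M N := QuotientAddGroup.mk' (balRel S M N) (m ⊗ₜ[ℤ] n)

lemma add_tmul (m m' : M) (n : N) : tmul S (m + m') n = tmul S m n + tmul S m' n := by
  simp only [tmul, TensorProduct.add_tmul, map_add]; rfl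

lemma tmul_add (m : M) (n n' : N) : tmul S m (n + n') = tmul S m n + tmul S m n' := by
  simp only [tmul, TensorProduct.tmul_add, map_add]; rfl

lemma smul_tmul (m : M) (s : S) (n : N) :
    tmul S (MulOpposite.op s • m) n = tmul S m (s • n) := by
  apply (QuotientAddGroup.eq_iff_sub_mem).2
  exact AddSubgroup.subset_closure ⟨m, s, n, rfl⟩

/-- The additive map `M ⊗_S N → G` defined by a biadditive `S`-balanced map. -/
def lift {G : Type x} [AddCommGroup G] (f : M →+ N →+ G)
    (hf : ∀ m (s : S) n, f (MulOpposite.op s • m) n = f m (s • n)) : BalTensor S M N →+ G :=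
  QuotientAddGroup.lift (balRel S M N)
    (TensorProduct.liftAddHom f (fun r m n => by simp)) (by
      rw [balRel, AddSubgroup.closure_le]
      rintro _ ⟨m, s, n, rfl⟩
      simp [hf])

@[simp]
lemma lift_tmul {G : Type x} [AddCommGroup G] (f : M →+ N →+ G)
    (hf : ∀ m (s : S) n, f (MulOpposite.op s • m) n = f m (s • n)) (m : M) (n : N) :
    lift f hf (tmul S m n) = f m n := rfl

@[elab_as_elim]
lemma induction_on {p : BalTensor S M N → Prop} (z : BalTensor S M N) (zero : p 0)
    (tmul : ∀ m n, p (tmul S m n)) (add : ∀ a b, p a → p b → p (a + b)) : p z := by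
  obtain ⟨z, rfl⟩ := QuotientAddGroup.mk'_surjective _ z
  induction z with
  | zero => exact zero
  | tmul m n => exact tmul m n
  | add a b ha hb => rw [map_add]; exact add _ _ ha hb

lemma hom_ext {G : Type x} [AddCommGroup G] {f g : BalTensor S M N →+ G}
    (h : ∀ m n, f (tmul S m n) = g (tmul S m n)) : f = g := by
  ext z
  induction z using induction_on with
  | zero => simp
  | tmul m n => exact h m n
  | add a b ha hb => simp [ha, hb]

/-- The map `m ⊗ n ↦ f m ⊗ g n` for a right `S`-linear map `f` and a left `S`-linear map `g`. -/
def map {M' : Type x} {N' : Type y} [AddCommGroup M'] [Module Sᵐᵒᵖ M'] [AddCommGroup N']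
    [Module S N'] (f : M →ₗ[Sᵐᵒᵖ] M') (g : N →ₗ[S] N') : BalTensor S M N →+ BalTensor S M' N' :=
  lift (AddMonoidHom.mk' (fun m => AddMonoidHom.mk' (fun n => tmul S (f m) (g n))
      (fun a b => by simp [tmul_add])) (fun a b => by ext; simp [add_tmul]))
    (fun m s n => by simp [smul_tmul])

@[simp]
lemma map_tmul {M' : Type x} {N' : Type y} [AddCommGroup M'] [Module Sᵐᵒᵖ M'] [AddCommGroup N']
    [Module S N'] (f : M →ₗ[Sᵐᵒᵖ] M') (g : N →ₗ[S] N') (m : M) (n : N) :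
    map f g (tmul S m n) = tmul S (f m) (g n) := rfl

end BalTensor

end Tensor

/-- For a ring morphism `f : R → S`, the ring `S` regarded as an `R`-`R`-bimodule through `f`. -/
def Pull {R : Type u} {S : Type v} [Ring R] [Ring S] (_f : R →+* S) : Type v := S

namespace Pull

variable {R : Type u} {S : Type v} [Ring R] [Ring S] (f : R →+* S)

instance : AddCommGroup (Pull f) := inferInstanceAs (AddCommGroup S)

/-- The identity `S → Pull f`. -/
def of : S ≃+ Pull f := AddEquiv.refl S

instance : Module R (Pull f) := Module.compHom S f

instance : Module Rᵐᵒᵖ (Pull f) := Module.compHom S f.op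

lemma smul_of (r : R) (s : S) : r • of f s = of f (f r * s) := rfl

lemma op_smul_of (r : R) (s : S) : MulOpposite.op r • of f s = of f (s * f r) := rfl

end Pull

/-! ### The bimodule `V ⊗_k k'` -/

section BaseChange

variable {k : Type u} {k' : Type v} [Ring k] [Ring k'] (f : k →+* k')
  (V : Type w) [AddCommGroup V] [Module kᵐᵒᵖ V]

/-- `V ⊗_k k'`, where `k'` is a left `k`-module through `f : k → k'`. -/
def BaseChange : Type (max w v) := BalTensor k V (Pull f)

namespace BaseChange

instance : AddCommGroup (BaseChange f V) := inferInstanceAs (AddCommGroup (BalTensor k V (Pull f)))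

variable {V} in
/-- The element `v ⊗ c` of `V ⊗_k k'`. -/
def tmul (v : V) (c : k') : BaseChange f V := BalTensor.tmul k v (Pull.of f c)

variable {f V} in
@[elab_as_elim]
lemma induction_on {p : BaseChange f V → Prop} (z : BaseChange f V) (zero : p 0)
    (tmul : ∀ v c, p (tmul f v c)) (add : ∀ a b, p a → p b → p (a + b)) : p z :=
  BalTensor.induction_on z zero tmul add

lemma add_tmul (v v' : V) (c : k') : tmul f (v + v') c = tmul f v c + tmul f v' c :=
  BalTensor.add_tmul _ _ _

lemma tmul_add (v : V) (c c' : k') : tmul f v (c + c') = tmul f v c + tmul f v c' :=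
  BalTensor.tmul_add _ _ _

lemma smul_tmul (v : V) (a : k) (c : k') :
    tmul f (MulOpposite.op a • v) c = tmul f v (f a * c) :=
  BalTensor.smul_tmul _ _ _

/-- Right multiplication by `c` on the factor `k'`. -/
def rmul (c : k') : BaseChange f V →+ BaseChange f V :=
  BalTensor.map (S := k) (N := Pull f) (N' := Pull f) LinearMap.id
    { toFun := fun d => Pull.of f ((Pull.of f).symm d * c)
      map_add' := fun a b => by simp [add_mul]
      map_smul' := fun r a => by
        simp only [RingHom.id_apply, Pull.smul_of, ← mul_assoc]; rfl }

lemma rmul_tmul (c : k') (v : V) (d : k') : rmul f V c (tmul f v d) = tmul f v (d * c) := rfl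

/-- Left multiplication by `c` on the factor `V`. -/
def lmul [Module k' V] [SMulCommClass k' kᵐᵒᵖ V] (c : k') : BaseChange f V →+ BaseChange f V :=
  BalTensor.map (S := k) (N := Pull f) (N' := Pull f)
    { toFun := fun v => c • v
      map_add' := smul_add c
      map_smul' := fun r v => smul_comm c r v } LinearMap.id

lemma lmul_tmul [Module k' V] [SMulCommClass k' kᵐᵒᵖ V] (c : k') (v : V) (d : k') :
    lmul f V c (tmul f v d) = tmul f (c • v) d := rfl

instance : Module k'ᵐᵒᵖ (BaseChange f V) where
  smul c := rmul f V c.unop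
  one_smul z := by
    change rmul f V 1 z = z
    induction z using induction_on with
    | zero => exact map_zero _
    | tmul v d => rw [rmul_tmul, mul_one]
    | add a b ha hb => rw [map_add, ha, hb]
  mul_smul c d z := by
    change rmul f V (d.unop * c.unop) z = rmul f V c.unop (rmul f V d.unop z)
    induction z using induction_on with
    | zero => simp
    | tmul v e => simp only [rmul_tmul, mul_assoc]
    | add a b ha hb => simp only [map_add, ha, hb]
  smul_zero c := map_zero _
  smul_add c := map_add _
  add_smul c d z := by
    change rmul f V (c.unop + d.unop) z = rmul f V c.unop z + rmul f V d.unop z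
    induction z using induction_on with
    | zero => simp
    | tmul v e => simp only [rmul_tmul, mul_add, tmul_add]
    | add a b ha hb => simp only [map_add, ha, hb]; abel
  zero_smul z := by
    change rmul f V 0 z = 0
    induction z using induction_on with
    | zero => exact map_zero _
    | tmul v d =>
      have h := tmul_add f V v 0 0
      rw [add_zero, left_eq_add] at h
      rw [rmul_tmul, mul_zero, h]
    | add a b ha hb => rw [map_add, ha, hb, add_zero]

instance [Module k' V] [SMulCommClass k' kᵐᵒᵖ V] : Module k' (BaseChange f V) where
  smul c := lmul f V c
  one_smul z := by
    change lmul f V 1 z = z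
    induction z using induction_on with
    | zero => exact map_zero _
    | tmul v d => rw [lmul_tmul, one_smul]
    | add a b ha hb => rw [map_add, ha, hb]
  mul_smul c d z := by
    change lmul f V (c * d) z = lmul f V c (lmul f V d z)
    induction z using induction_on with
    | zero => simp
    | tmul v e => simp only [lmul_tmul, mul_smul]
    | add a b ha hb => simp only [map_add, ha, hb]
  smul_zero c := map_zero _
  smul_add c := map_add _
  add_smul c d z := by
    change lmul f V (c + d) z = lmul f V c z + lmul f V d z
    induction z using induction_on with
    | zero => simp
    | tmul v e => simp only [lmul_tmul, add_smul, add_tmul]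
    | add a b ha hb => simp only [map_add, ha, hb]; abel
  zero_smul z := by
    change lmul f V 0 z = 0
    induction z using induction_on with
    | zero => exact map_zero _
    | tmul v d =>
      have h := add_tmul f V 0 0 d
      rw [add_zero, left_eq_add] at h
      rw [lmul_tmul, zero_smul, h]
    | add a b ha hb => rw [map_add, ha, hb, add_zero]

lemma op_smul_tmul (c : k') (v : V) (d : k') :
    MulOpposite.op c • tmul f v d = tmul f v (d * c) := rfl

lemma smul_tmul' [Module k' V] [SMulCommClass k' kᵐᵒᵖ V] (c : k') (v : V) (d : k') :
    c • tmul f v d = tmul f (c • v) d := rfl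

instance [Module k' V] [SMulCommClass k' kᵐᵒᵖ V] : SMulCommClass k' k'ᵐᵒᵖ (BaseChange f V) where
  smul_comm c d z := by
    induction z using induction_on with
    | zero => simp
    | tmul v e =>
      induction d using MulOpposite.rec'
      simp only [smul_tmul', op_smul_tmul]
    | add a b ha hb => simp only [smul_add, ha, hb]

end BaseChange

end BaseChange

/-! ### The tensor ring of a bimodule -/

section TensorRing

variable (k : Type u) [Ring k] (V : Type w) [AddCommGroup V] [Module k V] [Module kᵐᵒᵖ V]

/-- The relations presenting the tensor ring `T_k(V)` on the generators `k ⊔ V`. -/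
inductive TensorRel : FreeAlgebra ℤ (k ⊕ V) → FreeAlgebra ℤ (k ⊕ V) → Prop
  | one : TensorRel (FreeAlgebra.ι ℤ (Sum.inl 1)) 1
  | add (a b : k) : TensorRel (FreeAlgebra.ι ℤ (Sum.inl (a + b)))
      (FreeAlgebra.ι ℤ (Sum.inl a) + FreeAlgebra.ι ℤ (Sum.inl b))
  | mul (a b : k) : TensorRel (FreeAlgebra.ι ℤ (Sum.inl (a * b)))
      (FreeAlgebra.ι ℤ (Sum.inl a) * FreeAlgebra.ι ℤ (Sum.inl b))
  | addV (v w : V) : TensorRel (FreeAlgebra.ι ℤ (Sum.inr (v + w)))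
      (FreeAlgebra.ι ℤ (Sum.inr v) + FreeAlgebra.ι ℤ (Sum.inr w))
  | left (a : k) (v : V) : TensorRel (FreeAlgebra.ι ℤ (Sum.inr (a • v)))
      (FreeAlgebra.ι ℤ (Sum.inl a) * FreeAlgebra.ι ℤ (Sum.inr v))
  | right (a : k) (v : V) : TensorRel (FreeAlgebra.ι ℤ (Sum.inr (MulOpposite.op a • v)))
      (FreeAlgebra.ι ℤ (Sum.inr v) * FreeAlgebra.ι ℤ (Sum.inl a))

/-- The tensor ring `T_k(V)` of a `k`-`k`-bimodule `V`: the universal ring with a ring morphism from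
`k` and a morphism of `k`-`k`-bimodules from `V`. -/
def TensorRing : Type (max u w) := RingQuot (TensorRel k V)

namespace TensorRing

instance : Ring (TensorRing k V) := inferInstanceAs (Ring (RingQuot (TensorRel k V)))

/-- The ring morphism `k → T_k(V)`. -/
def scalar : k →+* TensorRing k V where
  toFun a := RingQuot.mkRingHom (TensorRel k V) (FreeAlgebra.ι ℤ (Sum.inl a))
  map_one' := (RingQuot.mkRingHom_rel TensorRel.one).trans (map_one _)
  map_mul' a b := (RingQuot.mkRingHom_rel (TensorRel.mul a b)).trans (map_mul _ _ _)
  map_zero' := by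
    have h := (RingQuot.mkRingHom_rel (TensorRel.add (k := k) (V := V) 0 0)).trans (map_add _ _ _)
    rw [add_zero, left_eq_add] at h
    exact h
  map_add' a b := (RingQuot.mkRingHom_rel (TensorRel.add a b)).trans (map_add _ _ _)

/-- The inclusion `V → T_k(V)`. -/
def ι : V →+ TensorRing k V :=
  AddMonoidHom.mk' (fun v => RingQuot.mkRingHom (TensorRel k V) (FreeAlgebra.ι ℤ (Sum.inr v)))
    (fun a b => (RingQuot.mkRingHom_rel (TensorRel.addV a b)).trans (map_add _ _ _))

variable {V}

lemma ι_smul (a : k) (v : V) : ι k V (a • v) = scalar k V a * ι k V v :=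
  (RingQuot.mkRingHom_rel (TensorRel.left a v)).trans (map_mul _ _ _)

lemma ι_op_smul (a : k) (v : V) : ι k V (MulOpposite.op a • v) = ι k V v * scalar k V a :=
  (RingQuot.mkRingHom_rel (TensorRel.right a v)).trans (map_mul _ _ _)

variable {k}

/-- The universal property of the tensor ring. -/
def lift {B : Type x} [Ring B] (g : k →+* B) (h : V →+ B) (hl : ∀ a v, h (a • v) = g a * h v)
    (hr : ∀ a v, h (MulOpposite.op a • v) = h v * g a) : TensorRing k V →+* B :=
  RingQuot.lift ⟨(FreeAlgebra.lift ℤ (Sum.elim g h) : FreeAlgebra ℤ (k ⊕ V) →ₐ[ℤ] B).toRingHom, by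
    intro a b hab
    induction hab <;> simp [hl, hr]⟩

@[simp]
lemma lift_scalar {B : Type x} [Ring B] (g : k →+* B) (h : V →+ B) (hl hr) (a : k) :
    lift g h hl hr (scalar k V a) = g a :=
  (RingQuot.lift_mkRingHom_apply _ _ _).trans (by simp)

@[simp]
lemma lift_ι {B : Type x} [Ring B] (g : k →+* B) (h : V →+ B) (hl hr) (v : V) :
    lift g h hl hr (ι k V v) = h v :=
  (RingQuot.lift_mkRingHom_apply _ _ _).trans (by simp)

@[elab_as_elim]
lemma induction {p : TensorRing k V → Prop} (t : TensorRing k V) (scalar : ∀ a, p (scalar k V a))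
    (ι : ∀ v, p (ι k V v)) (add : ∀ a b, p a → p b → p (a + b))
    (mul : ∀ a b, p a → p b → p (a * b)) : p t := by
  obtain ⟨t, rfl⟩ := RingQuot.mkRingHom_surjective _ t
  induction t with
  | grade0 r =>
    have h := scalar (r : k)
    have e : (RingQuot.mkRingHom (TensorRel k V)) ((algebraMap ℤ (FreeAlgebra ℤ (k ⊕ V))) r)
        = TensorRing.scalar k V r := by simp; rfl
    rw [e]; exact h
  | grade1 x => cases x with
    | inl a => exact scalar a
    | inr v => exact ι v
  | mul a b ha hb => rw [map_mul]; exact mul _ _ ha hb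
  | add a b ha hb => rw [map_add]; exact add _ _ ha hb

variable (k V)

/-- The component `V^{⊗ n}` of degree `n` of `T_k(V)`: the image of `k` for `n = 0`, and
the sums of products `v * t` with `v ∈ V`, `t ∈ V^{⊗ n}` for `n + 1`. -/
def tpow : ℕ → AddSubgroup (TensorRing k V)
  | 0 => (scalar k V).toAddMonoidHom.range
  | n + 1 => AddSubgroup.closure {z | ∃ (v : V) (t : TensorRing k V), t ∈ tpow n ∧ z = ι k V v * t}

end TensorRing

end TensorRing

/-! ### Gradings -/

section Grading

/-- Recognizing an internal direct sum by projections. -/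
lemma isInternal_of_proj {M : Type v} [AddCommGroup M] (ℳ : ℕ → AddSubgroup M) (π : ℕ → M →+ M)
    (h1 : ∀ i, ∀ z ∈ ℳ i, π i z = z) (h2 : ∀ i j, j ≠ i → ∀ z ∈ ℳ j, π i z = 0)
    (h3 : ⨆ i, ℳ i = ⊤) : DirectSum.IsInternal ℳ := by
  have key : ∀ (i : ℕ) (z : ⨁ i, ℳ i), π i (DirectSum.coeAddMonoidHom ℳ z) = z i := by
    intro i z
    induction z using DirectSum.induction_on with
    | zero => simp
    | of j z =>
      rw [DirectSum.coeAddMonoidHom_of]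
      by_cases h : j = i
      · subst h; rw [DirectSum.of_eq_same, h1 _ _ z.2]
      · rw [h2 i j h _ z.2, DirectSum.of_eq_of_ne _ _ _ (Ne.symm h)]; rfl
    | add a b ha hb => simp [ha, hb]
  constructor
  · rw [injective_iff_map_eq_zero]
    intro z hz
    ext i
    rw [← key, hz]; simp
  · rw [← AddMonoidHom.range_eq_top, eq_top_iff, ← h3, iSup_le_iff]
    intro i z hz
    exact ⟨DirectSum.of (fun i => ℳ i) i ⟨z, hz⟩, by simp⟩

/-- The grading concentrated in degree `0`. -/
def conc (M : Type v) [AddCommGroup M] : ℕ → AddSubgroup M := fun i => if i = 0 then ⊤ else ⊥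

end Grading

/-! ### Algebras with homogeneous relations -/

section HomogAlg

variable {k : Type u} [Ring k] {V : Type w} [AddCommGroup V] [Module k V] [Module kᵐᵒᵖ V]

open TensorRing

lemma TensorRing.scalar_mul_mem (n : ℕ) (a : k) (t : TensorRing k V) (ht : t ∈ tpow k V n) :
    scalar k V a * t ∈ tpow k V n := by
  cases n with
  | zero =>
    obtain ⟨b, rfl⟩ := ht
    exact ⟨a * b, map_mul (scalar k V) _ _⟩
  | succ n =>
    induction ht using AddSubgroup.closure_induction with
    | mem z hz =>
      obtain ⟨v, s, hs, rfl⟩ := hz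
      exact AddSubgroup.subset_closure ⟨a • v, s, hs, by rw [ι_smul, mul_assoc]⟩
    | zero => rw [mul_zero]; exact zero_mem _
    | add x y _ _ hx hy => rw [mul_add]; exact add_mem hx hy
    | neg x _ hx => rw [mul_neg]; exact neg_mem hx

lemma TensorRing.tpow_mul_mem (m n : ℕ) (s t : TensorRing k V) (hs : s ∈ tpow k V m)
    (ht : t ∈ tpow k V n) : s * t ∈ tpow k V (m + n) := by
  induction m generalizing s with
  | zero =>
    obtain ⟨a, rfl⟩ := hs
    rw [zero_add]
    exact scalar_mul_mem n a t ht
  | succ m ih =>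
    rw [Nat.add_right_comm]
    induction hs using AddSubgroup.closure_induction with
    | mem z hz =>
      obtain ⟨v, s, hs, rfl⟩ := hz
      exact AddSubgroup.subset_closure ⟨v, s * t, ih s hs, by rw [mul_assoc]⟩
    | zero => rw [zero_mul]; exact zero_mem _
    | add x y _ _ hx hy => rw [add_mul]; exact add_mem hx hy
    | neg x _ hx => rw [neg_mul]; exact neg_mem hx

lemma TensorRing.ι_mem (v : V) : ι k V v ∈ tpow k V 1 :=
  AddSubgroup.subset_closure ⟨v, 1, ⟨1, map_one (scalar k V)⟩, (mul_one _).symm⟩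

lemma TensorRing.iSup_tpow : ⨆ n, tpow k V n = ⊤ := by
  rw [AddSubgroup.eq_top_iff']
  intro t
  induction t using TensorRing.induction with
  | scalar a => exact AddSubgroup.mem_iSup_of_mem 0 ⟨a, rfl⟩
  | ι v => exact AddSubgroup.mem_iSup_of_mem 1 (ι_mem v)
  | add a b ha hb => exact add_mem ha hb
  | mul a b ha hb =>
    induction ha using AddSubgroup.iSup_induction' with
    | hp i x hx =>
      induction hb using AddSubgroup.iSup_induction' with
      | hp j y hy => exact AddSubgroup.mem_iSup_of_mem (i + j) (tpow_mul_mem i j x y hx hy)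
      | h1 => rw [mul_zero]; exact zero_mem _
      | hadd y z _ _ hy hz => rw [mul_add]; exact add_mem hy hz
    | h1 => rw [zero_mul]; exact zero_mem _
    | hadd y z _ _ hy hz => rw [add_mul]; exact add_mem hy hz

variable (N : ℕ) (R : AddSubgroup (TensorRing k V))

/-- `R` is a sub-`k`-`k`-bimodule of `V^{⊗ N}`, where `N ≥ 2`. -/
structure IsHomogRel : Prop where
  two_le : 2 ≤ N
  le_tpow : R ≤ tpow k V N
  left_mem : ∀ (a : k), ∀ r ∈ R, scalar k V a * r ∈ R
  right_mem : ∀ (a : k), ∀ r ∈ R, r * scalar k V a ∈ R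

/-- The algebra `A = T_k(V) / I(R)`, with `I(R)` the two-sided ideal generated by `R`. -/
def HomogAlg : Type (max u w) := (TwoSidedIdeal.span (R : Set (TensorRing k V))).ringCon.Quotient

namespace HomogAlg

instance : Ring (HomogAlg R) :=
  inferInstanceAs (Ring (TwoSidedIdeal.span (R : Set (TensorRing k V))).ringCon.Quotient)

/-- The projection `T_k(V) → A`. -/
def mk : TensorRing k V →+* HomogAlg R :=
  (TwoSidedIdeal.span (R : Set (TensorRing k V))).ringCon.mk'

lemma mk_surjective : Function.Surjective (mk R) := RingCon.mk'_surjective _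

lemma mk_eq_zero_iff (t : TensorRing k V) :
    mk R t = 0 ↔ t ∈ TwoSidedIdeal.span (R : Set (TensorRing k V)) := by
  rw [TwoSidedIdeal.mem_iff]
  exact RingCon.eq _

/-- The ring morphism `A → B` induced by a ring morphism `T_k(V) → B` vanishing on `R`. -/
def lift {B : Type x} [Ring B] (g : TensorRing k V →+* B) (hg : ∀ r ∈ R, g r = 0) :
    HomogAlg R →+* B :=
  RingCon.lift _ g (by
    intro a b hab
    have hab := (TwoSidedIdeal.rel_iff _ a b).1 hab
    have h : TwoSidedIdeal.span (R : Set (TensorRing k V)) ≤ TwoSidedIdeal.ker g :=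
      TwoSidedIdeal.span_le.2 (fun r hr => (TwoSidedIdeal.mem_ker g).2 (hg r hr))
    have := (TwoSidedIdeal.mem_ker g).1 (h hab)
    rw [map_sub, sub_eq_zero] at this
    exact this)

@[simp]
lemma lift_mk {B : Type x} [Ring B] (g : TensorRing k V →+* B) (hg : ∀ r ∈ R, g r = 0)
    (t : TensorRing k V) : lift R g hg (mk R t) = g t := rfl

/-- The component `A_n` of degree `n` of `A`: the image of `V^{⊗ n}`. -/
def grading (n : ℕ) : AddSubgroup (HomogAlg R) := (tpow k V n).map (mk R).toAddMonoidHom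

instance : SetLike.GradedMonoid (grading R) where
  one_mem := ⟨1, ⟨1, map_one (scalar k V)⟩, map_one (mk R)⟩
  mul_mem := by
    rintro i j _ _ ⟨s, hs, rfl⟩ ⟨t, ht, rfl⟩
    exact ⟨s * t, tpow_mul_mem i j s t hs ht, map_mul (mk R) _ _⟩

/-- The ring morphism `T_k(V) → A[X]` sending `t ∈ V^{⊗ n}` to `t X ^ n`. -/
def degHom : TensorRing k V →+* (HomogAlg R)[X] :=
  TensorRing.lift ((Polynomial.C).comp ((mk R).comp (scalar k V)))
    ((Polynomial.monomial 1).toAddMonoidHom.comp ((mk R).toAddMonoidHom.comp (ι k V)))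
    (by intro a v; simp [ι_smul, Polynomial.C_mul_monomial])
    (by intro a v; simp [ι_op_smul, Polynomial.monomial_mul_C])

lemma degHom_of_mem (n : ℕ) (t : TensorRing k V) (ht : t ∈ tpow k V n) :
    degHom R t = Polynomial.monomial n (mk R t) := by
  induction n generalizing t with
  | zero =>
    obtain ⟨a, rfl⟩ := ht
    simp [degHom]
  | succ n ih =>
    induction ht using AddSubgroup.closure_induction with
    | mem z hz =>
      obtain ⟨v, s, hs, rfl⟩ := hz
      rw [map_mul, ih s hs, map_mul, add_comm, ← Polynomial.monomial_mul_monomial]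
      congr 1
      simp [degHom]
    | zero => simp
    | add x y _ _ hx hy => simp [hx, hy]
    | neg x _ hx => simp [hx]

variable {N R}

/-- The ring morphism `A → A[X]` sending `a ∈ A_n` to `a X ^ n`. -/
def degHom' (h : IsHomogRel N R) : HomogAlg R →+* (HomogAlg R)[X] :=
  lift R (degHom R) (by
    intro r hr
    rw [degHom_of_mem R N r (h.le_tpow hr),
      (mk_eq_zero_iff R r).2 (TwoSidedIdeal.subset_span hr), map_zero])

lemma isInternal (h : IsHomogRel N R) : DirectSum.IsInternal (grading R) := by
  have key : ∀ i, ∀ z ∈ grading R i, degHom' h z = Polynomial.monomial i z := by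
    rintro i _ ⟨t, ht, rfl⟩
    exact degHom_of_mem R i t ht
  refine isInternal_of_proj _
    (fun i => (Polynomial.lcoeff (HomogAlg R) i).toAddMonoidHom.comp (degHom' h).toAddMonoidHom)
    ?_ ?_ ?_
  · intro i z hz
    simp [key i z hz]
  · intro i j hij z hz
    simp [key j z hz, Polynomial.coeff_monomial, hij]
  · have := congrArg (AddSubgroup.map (mk R).toAddMonoidHom) (iSup_tpow (k := k) (V := V))
    rw [AddSubgroup.map_iSup] at this
    rw [eq_top_iff]
    intro z _
    obtain ⟨t, rfl⟩ := mk_surjective R z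
    exact this ▸ ⟨t, trivial, rfl⟩

/-- `A = ⨁ A_n` is an `ℕ`-graded ring. -/
abbrev gradedRing (h : IsHomogRel N R) : GradedRing (grading R) :=
  { (isInternal h).chooseDecomposition, (inferInstance : SetLike.GradedMonoid (grading R)) with }

/-- The augmentation `ε : A → A_0 = k`. -/
def aug (h : IsHomogRel N R) : HomogAlg R →+* k :=
  lift R (TensorRing.lift (RingHom.id k) 0 (by simp) (by simp)) (by
    intro r hr
    replace hr := h.le_tpow hr
    obtain ⟨n, rfl⟩ : ∃ n, N = n + 1 := ⟨N - 1, by have := h.two_le; omega⟩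
    clear h
    induction hr using AddSubgroup.closure_induction with
    | mem z hz =>
      obtain ⟨v, s, hs, rfl⟩ := hz
      simp
    | zero => simp
    | add x y _ _ hx hy => simp [hx, hy]
    | neg x _ hx => simp [hx])

end HomogAlg

end HomogAlg

/-! ### Graded free resolutions and graded `Tor` -/

section Resolution

variable {A : Type u} [Ring A] (𝒜 : ℕ → AddSubgroup A)

/-- The component of degree `n` of the graded-free left module with basis `X`, where `x : X` has
degree `deg x`: the coefficient at `x` of an element of degree `n` lies in `A_{n - deg x}`, and it
vanishes if `n < deg x`. -/
def freeHomog {X : Type v} (deg : X → ℕ) (n : ℕ) : AddSubgroup (X →₀ A) :=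
  ⨅ x : X, (if deg x ≤ n then 𝒜 (n - deg x) else ⊥).comap (Finsupp.applyAddHom x)

variable {𝒜} in
lemma mem_freeHomog {X : Type v} {deg : X → ℕ} {n : ℕ} {z : X →₀ A} :
    z ∈ freeHomog 𝒜 deg n ↔ ∀ x, z x ∈ (if deg x ≤ n then 𝒜 (n - deg x) else ⊥) := by
  simp only [freeHomog, AddSubgroup.mem_iInf, AddSubgroup.mem_comap, Finsupp.applyAddHom_apply]

/-- A resolution of the graded left `A`-module `M` by graded-free left `A`-modules, with all arrows
`A`-linear and homogeneous of degree `0`. -/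
structure GradedFreeResolution (M : Type w) [AddCommGroup M] [Module A M]
    (ℳ : ℕ → AddSubgroup M) where
  /-- The basis of the module in homological degree `n`. -/
  gen : ℕ → Type (max u w)
  /-- The degrees of the basis elements. -/
  deg : ∀ n, gen n → ℕ
  /-- The differentials. -/
  d : ∀ n, (gen (n + 1) →₀ A) →ₗ[A] (gen n →₀ A)
  /-- The augmentation. -/
  aug : (gen 0 →₀ A) →ₗ[A] M
  d_homog : ∀ n i, ∀ z ∈ freeHomog 𝒜 (deg (n + 1)) i, d n z ∈ freeHomog 𝒜 (deg n) i
  aug_homog : ∀ i, ∀ z ∈ freeHomog 𝒜 (deg 0) i, aug z ∈ ℳ i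
  aug_surjective : Function.Surjective aug
  exact_zero : Function.Exact (d 0) aug
  exact_succ : ∀ n, Function.Exact (d (n + 1)) (d n)

section Standard

lemma decompose_map {M : Type v} {M' : Type w} [AddCommGroup M] [AddCommGroup M']
    (ℳ : ℕ → AddSubgroup M) (ℳ' : ℕ → AddSubgroup M') [DirectSum.Decomposition ℳ]
    [DirectSum.Decomposition ℳ'] (φ : M →+ M') (hφ : ∀ i, ∀ z ∈ ℳ i, φ z ∈ ℳ' i) (z : M) (i : ℕ) :
    φ (DirectSum.decompose ℳ z i) = DirectSum.decompose ℳ' (φ z) i := by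
  induction z using DirectSum.Decomposition.inductionOn ℳ with
  | zero => simp
  | @homogeneous j z =>
    have hz := hφ j z z.2
    by_cases h : j = i
    · subst h
      rw [DirectSum.decompose_of_mem_same ℳ z.2, DirectSum.decompose_of_mem_same ℳ' hz]
    · rw [DirectSum.decompose_of_mem_ne ℳ z.2 h, DirectSum.decompose_of_mem_ne ℳ' hz h, map_zero]
  | add a b ha hb => simp [ha, hb]

lemma linearCombination_mem {X : Type v} (deg : X → ℕ) {M : Type w} [AddCommGroup M] [Module A M]
    (ℳ : ℕ → AddSubgroup M) [SetLike.GradedSMul 𝒜 ℳ] (b : X → M) (hb : ∀ x, b x ∈ ℳ (deg x))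
    (n : ℕ) (z : X →₀ A) (hz : z ∈ freeHomog 𝒜 deg n) : Finsupp.linearCombination A b z ∈ ℳ n := by
  rw [Finsupp.linearCombination_apply]
  refine sum_mem fun x _ => ?_
  have hx := mem_freeHomog.1 hz x
  by_cases h : deg x ≤ n
  · rw [if_pos h] at hx
    have := SetLike.GradedSMul.smul_mem hx (hb x)
    rwa [vadd_eq_add, Nat.sub_add_cancel h] at this
  · rw [if_neg h] at hx
    change z x • b x ∈ ℳ n
    rw [(AddSubgroup.mem_bot).1 hx, zero_smul]
    exact zero_mem _

variable [GradedRing 𝒜]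

lemma free_isInternal {X : Type v} (deg : X → ℕ) : DirectSum.IsInternal (freeHomog 𝒜 deg) := by
  classical
  let p : ℕ → ℕ → A →+ A := fun n e => if e ≤ n then GradedRing.proj 𝒜 (n - e) else 0
  let π : ℕ → (X →₀ A) →+ (X →₀ A) := fun n =>
    Finsupp.liftAddHom (fun x => (Finsupp.singleAddHom x).comp (p n (deg x)))
  have hπ : ∀ n z x, π n z x = p n (deg x) (z x) := by
    intro n z x
    induction z using Finsupp.induction_linear with
    | zero => simp
    | add a b ha hb => simp [ha, hb]
    | single y a =>
      by_cases h : y = x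
      · subst h; simp [π]
      · simp [π, Finsupp.single_eq_of_ne' h]
  refine isInternal_of_proj _ π ?_ ?_ ?_
  · intro n z hz
    ext x
    have hx := mem_freeHomog.1 hz x
    rw [hπ]
    by_cases h : deg x ≤ n
    · rw [if_pos h] at hx
      simp only [p, if_pos h, GradedRing.proj_apply]
      exact DirectSum.decompose_of_mem_same 𝒜 hx
    · rw [if_neg h] at hx
      rw [(AddSubgroup.mem_bot).1 hx, map_zero]
  · intro n j hj z hz
    ext x
    have hx := mem_freeHomog.1 hz x
    rw [hπ]
    by_cases h : deg x ≤ j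
    · rw [if_pos h] at hx
      by_cases h' : deg x ≤ n
      · simp only [p, if_pos h', GradedRing.proj_apply]
        exact DirectSum.decompose_of_mem_ne 𝒜 hx (by omega)
      · simp [p, if_neg h']
    · rw [if_neg h] at hx
      rw [(AddSubgroup.mem_bot).1 hx, map_zero]; rfl
  · rw [AddSubgroup.eq_top_iff']
    intro z
    induction z using Finsupp.induction_linear with
    | zero => exact zero_mem _
    | add a b ha hb => exact add_mem ha hb
    | single y a =>
      induction a using DirectSum.Decomposition.inductionOn 𝒜 with
      | zero => simp
      | @homogeneous i a =>
        refine AddSubgroup.mem_iSup_of_mem (i + deg y) (mem_freeHomog.2 fun x => ?_)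
        by_cases h : y = x
        · subst h; simp
        · rw [Finsupp.single_eq_of_ne' h]; exact zero_mem _
      | add a b ha hb => rw [Finsupp.single_add]; exact add_mem ha hb

lemma smul_mem_freeHomog {X : Type v} (deg : X → ℕ) (i j : ℕ) (a : A) (ha : a ∈ 𝒜 i) (z : X →₀ A)
    (hz : z ∈ freeHomog 𝒜 deg j) : a • z ∈ freeHomog 𝒜 deg (i + j) := by
  refine mem_freeHomog.2 fun x => ?_
  have hx := mem_freeHomog.1 hz x
  rw [Finsupp.smul_apply, smul_eq_mul]
  by_cases h : deg x ≤ j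
  · rw [if_pos h] at hx
    rw [if_pos (by omega), Nat.add_sub_assoc h]
    exact SetLike.mul_mem_graded ha hx
  · rw [if_neg h] at hx
    rw [(AddSubgroup.mem_bot).1 hx, mul_zero]
    exact zero_mem _

instance {X : Type v} (deg : X → ℕ) : SetLike.GradedSMul 𝒜 (freeHomog 𝒜 deg) where
  smul_mem := fun {i j a z} ha hz => smul_mem_freeHomog 𝒜 deg i j a ha z hz

/-- A step in the construction of the standard resolution: a graded-free module and a submodule of
it, which is to be covered next. -/
structure Stage (A : Type u) [Ring A] where
  /-- The basis of the free module. -/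
  gen : Type (max u w)
  /-- The degrees of the basis elements. -/
  deg : gen → ℕ
  /-- The submodule to be covered. -/
  syz : Submodule A (gen →₀ A)

/-- The homogeneous elements of the submodule `s.syz`. -/
def Stage.Next (s : Stage.{u, w} A) : Type (max u w) :=
  Σ i : ℕ, {z : s.gen →₀ A // z ∈ s.syz ∧ z ∈ freeHomog 𝒜 s.deg i}

/-- The free module on the homogeneous elements of `s.syz`, mapped onto `s.syz`. -/
def Stage.map (s : Stage.{u, w} A) : (s.Next 𝒜 →₀ A) →ₗ[A] (s.gen →₀ A) :=
  Finsupp.linearCombination A (fun z => z.2.1)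

/-- The next step: the free module on the homogeneous elements of `s.syz`, and the kernel of
its map to `s.syz`. -/
def Stage.next (s : Stage.{u, w} A) : Stage.{u, w} A where
  gen := s.Next 𝒜
  deg z := z.1
  syz := LinearMap.ker (s.map 𝒜)

lemma Stage.exact (s : Stage.{u, w} A) {M : Type x} [AddCommGroup M] [Module A M]
    (ℳ : ℕ → AddSubgroup M) [DirectSum.Decomposition ℳ] (φ : (s.gen →₀ A) →ₗ[A] M)
    (hφ : ∀ i, ∀ z ∈ freeHomog 𝒜 s.deg i, φ z ∈ ℳ i) (hs : s.syz = LinearMap.ker φ) :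
    Function.Exact (s.map 𝒜) φ := by
  classical
  let _ := (free_isInternal 𝒜 s.deg).chooseDecomposition
  rw [LinearMap.exact_iff, ← hs]
  apply le_antisymm
  · intro z hz
    rw [← DirectSum.sum_support_decompose (freeHomog 𝒜 s.deg) z]
    refine sum_mem fun i _ => ?_
    have h1 : ((DirectSum.decompose (freeHomog 𝒜 s.deg) z i : s.gen →₀ A)) ∈ s.syz := by
      rw [hs, LinearMap.mem_ker] at hz ⊢
      have := decompose_map (freeHomog 𝒜 s.deg) ℳ φ.toAddMonoidHom hφ z i
      simp only [LinearMap.toAddMonoidHom_coe, hz] at this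
      simpa using this
    refine ⟨Finsupp.single (⟨i, _, h1, SetLike.coe_mem _⟩ : s.Next 𝒜) 1, ?_⟩
    exact (Finsupp.linearCombination_single _ _ _).trans (one_smul _ _)
  · rintro _ ⟨z, rfl⟩
    rw [Stage.map, Finsupp.linearCombination_apply]
    exact sum_mem fun x _ => Submodule.smul_mem _ _ x.2.2.1

variable {M : Type w} [AddCommGroup M] [Module A M] (ℳ : ℕ → AddSubgroup M)

/-- The map to `M` from the graded-free module on the homogeneous elements of `M`. -/
def coverMap : (ULift.{u} (Σ i : ℕ, ℳ i) →₀ A) →ₗ[A] M :=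
  Finsupp.linearCombination A (fun z => (z.down.2 : M))

/-- The steps of the construction of the standard resolution. -/
def stage : ℕ → Stage.{u, w} A
  | 0 => ⟨ULift.{u} (Σ i : ℕ, ℳ i), fun z => z.down.1, LinearMap.ker (coverMap ℳ)⟩
  | n + 1 => (stage n).next 𝒜

/-- The standard graded-free resolution of a graded left `A`-module `M`: the module in homological
degree `0` is free on the homogeneous elements of `M`, and each following one is free on the
homogeneous elements of the kernel of the previous arrow. -/
def standardResolution [DirectSum.Decomposition ℳ] [SetLike.GradedSMul 𝒜 ℳ] :
    GradedFreeResolution 𝒜 M ℳ where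
  gen n := (stage 𝒜 ℳ n).gen
  deg n := (stage 𝒜 ℳ n).deg
  d n := (stage 𝒜 ℳ n).map 𝒜
  aug := coverMap ℳ
  d_homog n i z hz := linearCombination_mem 𝒜 (stage 𝒜 ℳ (n + 1)).deg
    (freeHomog 𝒜 (stage 𝒜 ℳ n).deg) (fun z => z.2.1) (fun z => z.2.2.2) i z hz
  aug_homog i z hz := linearCombination_mem 𝒜 (stage 𝒜 ℳ 0).deg ℳ _ (fun z => z.down.2.2) i z hz
  aug_surjective m := by
    classical
    change m ∈ LinearMap.range (coverMap ℳ)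
    rw [← DirectSum.sum_support_decompose ℳ m]
    refine sum_mem fun i _ => ⟨Finsupp.single ⟨⟨i, DirectSum.decompose ℳ m i⟩⟩ 1, ?_⟩
    exact (Finsupp.linearCombination_single _ _ _).trans (one_smul _ _)
  exact_zero := (stage 𝒜 ℳ 0).exact 𝒜 ℳ (coverMap ℳ)
    (fun i z hz => linearCombination_mem 𝒜 (stage 𝒜 ℳ 0).deg ℳ _ (fun z => z.down.2.2) i z hz) rfl
  exact_succ n := by
    let _ := (free_isInternal 𝒜 (stage 𝒜 ℳ n).deg).chooseDecomposition
    exact (stage 𝒜 ℳ (n + 1)).exact 𝒜 (freeHomog 𝒜 (stage 𝒜 ℳ n).deg) ((stage 𝒜 ℳ n).map 𝒜)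
      (fun i z hz => linearCombination_mem 𝒜 (stage 𝒜 ℳ (n + 1)).deg
        (freeHomog 𝒜 (stage 𝒜 ℳ n).deg) (fun z => z.2.1) (fun z => z.2.2.2) i z hz) rfl

end Standard

namespace GradedFreeResolution

variable {𝒜} {M : Type w} [AddCommGroup M] [Module A M] {ℳ : ℕ → AddSubgroup M}
  (P : GradedFreeResolution 𝒜 M ℳ) (L : Type x) [AddCommGroup L] [Module Aᵐᵒᵖ L]
  (ℒ : ℕ → AddSubgroup L)

/-- The module `L ⊗_A P_n`. -/
abbrev Chain (n : ℕ) : Type (max x u w) := BalTensor A L (P.gen n →₀ A)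

/-- The differential `L ⊗_A P_{n+1} → L ⊗_A P_n`. -/
def diff (n : ℕ) : P.Chain L (n + 1) →+ P.Chain L n := BalTensor.map LinearMap.id (P.d n)

/-- The cycles of the complex `L ⊗_A P`. -/
def cycles : ∀ n, AddSubgroup (P.Chain L n)
  | 0 => ⊤
  | n + 1 => (P.diff L n).ker

/-- `Tor_n^A(L, M)`, computed as the homology in degree `n` of the complex `L ⊗_A P`. -/
abbrev Tor (n : ℕ) : Type (max x u w) :=
  P.cycles L n ⧸ (P.diff L n).range.addSubgroupOf (P.cycles L n)

variable {L}

/-- The component of degree `i` of the graded module `L ⊗_A P_n`. -/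
def chainGrading (n i : ℕ) : AddSubgroup (P.Chain L n) :=
  AddSubgroup.closure {z | ∃ a b : ℕ, a + b = i ∧ ∃ l ∈ ℒ a, ∃ p ∈ freeHomog 𝒜 (P.deg n) b,
    z = BalTensor.tmul A l p}

/-- The component of degree `i` of the graded module `Tor_n^A(L, M)`: the classes of the homogeneous
cycles of degree `i`. -/
def torGrading (n i : ℕ) : AddSubgroup (P.Tor L n) :=
  ((P.chainGrading ℒ n i).addSubgroupOf (P.cycles L n)).map (QuotientAddGroup.mk' _)

end GradedFreeResolution

end Resolution

/-! ### Koszul algebras -/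

section Koszul

lemma conc_isInternal (M : Type v) [AddCommGroup M] : DirectSum.IsInternal (conc M) := by
  refine isInternal_of_proj _ (fun i => if i = 0 then AddMonoidHom.id M else 0) ?_ ?_ ?_
  · intro i z hz
    by_cases h : i = 0
    · simp [h]
    · simp only [conc, if_neg h, AddSubgroup.mem_bot] at hz
      simp [hz]
  · intro i j hij z hz
    by_cases h : j = 0
    · have : i ≠ 0 := fun h' => hij (h.trans h'.symm)
      simp [this]
    · simp only [conc, if_neg h, AddSubgroup.mem_bot] at hz
      simp [hz]
  · rw [eq_top_iff]
    exact le_iSup_of_le 0 (by simp [conc])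

variable {k : Type u} [Ring k] {V : Type w} [AddCommGroup V] [Module k V] [Module kᵐᵒᵖ V]
  {N : ℕ} {R : AddSubgroup (TensorRing k V)}

lemma HomogAlg.aug_of_mem (h : IsHomogRel N R) (i : ℕ) (hi : i ≠ 0) (a : HomogAlg R)
    (ha : a ∈ HomogAlg.grading R i) : HomogAlg.aug h a = 0 := by
  obtain ⟨t, ht, rfl⟩ := ha
  obtain ⟨n, rfl⟩ : ∃ n, i = n + 1 := ⟨i - 1, by omega⟩
  change HomogAlg.aug h (HomogAlg.mk R t) = 0
  induction ht using AddSubgroup.closure_induction with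
  | mem z hz =>
    obtain ⟨v, s, hs, rfl⟩ := hz
    simp [HomogAlg.aug]
  | zero => simp
  | add x y _ _ hx hy => simp [hx, hy]
  | neg x _ hx => simp [hx]

/-- The standard graded-free resolution of `_A k`, which is `k` with `A` acting through the
augmentation, concentrated in degree `0`. -/
def augResolution (h : IsHomogRel N R) :
    GradedFreeResolution (HomogAlg.grading R) (Pull (HomogAlg.aug h)) (conc _) :=
  letI := HomogAlg.gradedRing h
  letI := (conc_isInternal (Pull (HomogAlg.aug h))).chooseDecomposition
  haveI : SetLike.GradedSMul (HomogAlg.grading R) (conc (Pull (HomogAlg.aug h))) :=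
    ⟨by
      intro i j a m ha hm
      by_cases hj : j = 0
      · by_cases hi : i = 0
        · simp [conc, hi, hj]
        · obtain ⟨m, rfl⟩ := (Pull.of (HomogAlg.aug h)).surjective m
          rw [Pull.smul_of, HomogAlg.aug_of_mem h i hi a ha, zero_mul, map_zero]
          exact zero_mem _
      · simp only [conc, if_neg hj, AddSubgroup.mem_bot] at hm
        rw [hm, smul_zero]
        exact zero_mem _⟩
  standardResolution (HomogAlg.grading R) (conc _)

/-- The jump map: `ζ(2q) = q N` and `ζ(2q + 1) = q N + 1`. -/
def jump (N n : ℕ) : ℕ := n / 2 * N + n % 2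

/-- The algebra `A = T_k(V) / I(R)` is Koszul: for every `n ≥ 3`, the graded module
`Tor_n^A(k_A, _A k)` is concentrated in degree `ζ(n)`. -/
def IsKoszul (h : IsHomogRel N R) : Prop :=
  ∀ n, 3 ≤ n → ∀ i, i ≠ jump N n →
    (augResolution h).torGrading (conc (Pull (HomogAlg.aug h))) n i = ⊥

end Koszul

/-! ### Change of rings -/

section ChangeOfRings

variable {k : Type u} {k' : Type v} [Ring k] [Ring k'] (f : k →+* k')
  {V : Type w} [AddCommGroup V] [Module k V] [Module kᵐᵒᵖ V]
/-- The operator by which a scalar acts in `leftActAux`. -/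
def leftActScalar (a : k) : AddMonoid.End (TensorRing k V × (k' →+ TensorRing k V)) :=
  AddMonoidHom.mk'
    (fun p : TensorRing k V × (k' →+ TensorRing k V) =>
      (TensorRing.scalar k V a * p.1, p.2.comp (AddMonoidHom.mulRight (f a))))
    (fun p q => by ext <;> simp [mul_add])

variable [Module k' V]

/-- The operator by which an element of `V` acts in `leftActAux`. -/
def leftActVec (v : V) : AddMonoid.End (TensorRing k V × (k' →+ TensorRing k V)) :=
  AddMonoidHom.mk'
    (fun p : TensorRing k V × (k' →+ TensorRing k V) =>
      (TensorRing.ι k V v * p.1, AddMonoidHom.mk'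
        (fun c : k' => TensorRing.ι k V (c • v) * p.1)
        (fun c d => by rw [add_smul, map_add, add_mul])))
    (fun p q => by ext <;> simp [mul_add])

lemma leftActVec_snd (v : V) (p : TensorRing k V × (k' →+ TensorRing k V)) (c : k') :
    (leftActVec v p).2 c = TensorRing.ι k V (c • v) * p.1 := rfl

variable [SMulCommClass k' kᵐᵒᵖ V]

/-- The action of `T_k(V)` on `T_k(V) × Hom(k', T_k(V))` used to define `leftAct`. -/
def leftActAux (hext : ∀ (a : k) (v : V), f a • v = a • v) :
    TensorRing k V →+* AddMonoid.End (TensorRing k V × (k' →+ TensorRing k V)) :=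
  TensorRing.lift
    { toFun := leftActScalar f
      map_one' := by
        refine AddMonoidHom.ext fun p => Prod.ext ?_ (AddMonoidHom.ext fun c => ?_)
        · change TensorRing.scalar k V 1 * p.1 = p.1
          rw [map_one, one_mul]
        · change p.2 (c * f 1) = p.2 c
          rw [map_one, mul_one]
      map_mul' := fun a b => by
        refine AddMonoidHom.ext fun p => Prod.ext ?_ (AddMonoidHom.ext fun c => ?_)
        · change TensorRing.scalar k V (a * b) * p.1
            = TensorRing.scalar k V a * (TensorRing.scalar k V b * p.1)
          rw [map_mul, mul_assoc]
        · change p.2 (c * f (a * b)) = p.2 (c * f a * f b)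
          rw [f.map_mul, mul_assoc]
      map_zero' := by
        refine AddMonoidHom.ext fun p => Prod.ext ?_ (AddMonoidHom.ext fun c => ?_)
        · change TensorRing.scalar k V 0 * p.1 = 0
          rw [map_zero, zero_mul]
        · change p.2 (c * f 0) = 0
          rw [map_zero, mul_zero, map_zero]
      map_add' := fun a b => by
        refine AddMonoidHom.ext fun p => Prod.ext ?_ (AddMonoidHom.ext fun c => ?_)
        · change TensorRing.scalar k V (a + b) * p.1
            = TensorRing.scalar k V a * p.1 + TensorRing.scalar k V b * p.1
          rw [map_add, add_mul]
        · change p.2 (c * f (a + b)) = p.2 (c * f a) + p.2 (c * f b)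
          rw [map_add, mul_add, map_add] }
    (AddMonoidHom.mk' leftActVec (fun v w => by
      refine AddMonoidHom.ext fun p => Prod.ext ?_ (AddMonoidHom.ext fun c => ?_)
      · change TensorRing.ι k V (v + w) * p.1 = TensorRing.ι k V v * p.1 + TensorRing.ι k V w * p.1
        rw [map_add, add_mul]
      · change TensorRing.ι k V (c • (v + w)) * p.1
          = TensorRing.ι k V (c • v) * p.1 + TensorRing.ι k V (c • w) * p.1
        rw [smul_add, map_add, add_mul]))
    (fun a v => by
      refine AddMonoidHom.ext fun p => Prod.ext ?_ (AddMonoidHom.ext fun c => ?_)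
      · change TensorRing.ι k V (a • v) * p.1
          = TensorRing.scalar k V a * (TensorRing.ι k V v * p.1)
        rw [TensorRing.ι_smul, mul_assoc]
      · change TensorRing.ι k V (c • a • v) * p.1 = TensorRing.ι k V ((c * f a) • v) * p.1
        rw [mul_smul, hext])
    (fun a v => by
      refine AddMonoidHom.ext fun p => Prod.ext ?_ (AddMonoidHom.ext fun c => ?_)
      · change TensorRing.ι k V (MulOpposite.op a • v) * p.1
          = TensorRing.ι k V v * (TensorRing.scalar k V a * p.1)
        rw [TensorRing.ι_op_smul, mul_assoc]
      · change TensorRing.ι k V (c • MulOpposite.op a • v) * p.1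
          = TensorRing.ι k V (c • v) * (TensorRing.scalar k V a * p.1)
        rw [smul_comm c, TensorRing.ι_op_smul, mul_assoc])

/-- The left action of `c ∈ k'` on `V^{⊗ n}`, `n ≥ 1`, induced by the left action of `k'` on the
first factor: `c • (v₁ ⊗ ⋯ ⊗ vₙ) = (c v₁) ⊗ ⋯ ⊗ vₙ`. It is extended by `0` to the component of
degree `0` of `T_k(V)`, where there is no such action. -/
def leftAct (hext : ∀ (a : k) (v : V), f a • v = a • v) (c : k') :
    TensorRing k V →+ TensorRing k V :=
  AddMonoidHom.mk' (fun t => (leftActAux f hext t (1, 0)).2 c)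
    (fun s t => by rw [map_add]; rfl)

lemma leftAct_ι_mul (hext : ∀ (a : k) (v : V), f a • v = a • v) (c : k') (v : V)
    (t : TensorRing k V) :
    leftAct f hext c (TensorRing.ι k V v * t) = TensorRing.ι k V (c • v) * t := by
  have hs : ∀ a, leftActAux f hext (TensorRing.scalar k V a) = leftActScalar f a :=
    fun a => TensorRing.lift_scalar _ _ _ _ a
  have hv : ∀ v, leftActAux f hext (TensorRing.ι k V v) = leftActVec v :=
    fun v => TensorRing.lift_ι _ _ _ _ v
  have h1 : ∀ (t : TensorRing k V) p, (leftActAux f hext t p).1 = t * p.1 := by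
    intro t
    induction t using TensorRing.induction with
    | scalar a => intro p; rw [hs]; rfl
    | ι v => intro p; rw [hv]; rfl
    | add a b ha hb =>
      intro p
      rw [map_add, add_mul, ← ha, ← hb]
      rfl
    | mul a b ha hb =>
      intro p
      rw [map_mul, mul_assoc, ← hb, ← ha]
      rfl
  change (leftActAux f hext (TensorRing.ι k V v * t) (1, 0)).2 c = _
  rw [map_mul, hv]
  change (leftActVec v (leftActAux f hext t (1, 0))).2 c = _
  rw [leftActVec_snd, h1, mul_one]

/-- The ring morphism `T_k(V) → T_{k'}(V ⊗_k k')`, `v ↦ v ⊗ 1`, extending `f : k → k'`. -/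
def tensorBaseChange (hext : ∀ (a : k) (v : V), f a • v = a • v) :
    TensorRing k V →+* TensorRing k' (BaseChange f V) :=
  TensorRing.lift ((TensorRing.scalar k' (BaseChange f V)).comp f)
    ((TensorRing.ι k' (BaseChange f V)).comp
      (AddMonoidHom.mk' (fun v => BaseChange.tmul f v 1) (fun v w => BaseChange.add_tmul f V v w 1)))
    (fun a v => by
      have h := TensorRing.ι_smul k' (f a) (BaseChange.tmul f v 1)
      rw [BaseChange.smul_tmul', hext] at h
      exact h)
    (fun a v => by
      have h := TensorRing.ι_op_smul k' (f a) (BaseChange.tmul f v 1)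
      rw [BaseChange.op_smul_tmul, one_mul, ← mul_one (f a), ← BaseChange.smul_tmul, mul_one] at h
      exact h)

lemma tensorBaseChange_scalar (hext : ∀ (a : k) (v : V), f a • v = a • v) (a : k) :
    tensorBaseChange f hext (TensorRing.scalar k V a) = TensorRing.scalar k' _ (f a) :=
  TensorRing.lift_scalar _ _ _ _ a

lemma tensorBaseChange_ι (hext : ∀ (a : k) (v : V), f a • v = a • v) (v : V) :
    tensorBaseChange f hext (TensorRing.ι k V v) = TensorRing.ι k' _ (BaseChange.tmul f v 1) :=
  TensorRing.lift_ι _ _ _ _ v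

/-- The subgroup `R'` of `T_{k'}(V ⊗_k k')`: the image of `R ⊗_k k'` under
`(v₁ ⊗ ⋯ ⊗ v_N) ⊗ c ↦ (v₁ ⊗ 1) ⋯ (v_N ⊗ 1) c`. -/
def relBaseChange (hext : ∀ (a : k) (v : V), f a • v = a • v) (R : AddSubgroup (TensorRing k V)) :
    AddSubgroup (TensorRing k' (BaseChange f V)) :=
  AddSubgroup.closure {z | ∃ r ∈ R, ∃ c : k',
    z = tensorBaseChange f hext r * TensorRing.scalar k' (BaseChange f V) c}

/-- The ring morphism `A → A' = T_{k'}(V ⊗_k k') / I(R')` induced by `tensorBaseChange`. -/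
def algMap (hext : ∀ (a : k) (v : V), f a • v = a • v) (R : AddSubgroup (TensorRing k V)) :
    HomogAlg R →+* HomogAlg (relBaseChange f hext R) :=
  HomogAlg.lift R ((HomogAlg.mk _).comp (tensorBaseChange f hext)) (by
    intro r hr
    refine (HomogAlg.mk_eq_zero_iff _ _).2 (TwoSidedIdeal.subset_span ?_)
    exact AddSubgroup.subset_closure ⟨r, hr, 1, by rw [map_one, mul_one]⟩)

lemma algMap_scalar (hext : ∀ (a : k) (v : V), f a • v = a • v) (R : AddSubgroup (TensorRing k V))
    (a : k) : algMap f hext R (HomogAlg.mk R (TensorRing.scalar k V a))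
      = HomogAlg.mk _ (TensorRing.scalar k' _ (f a)) := by
  change HomogAlg.mk _ (tensorBaseChange f hext (TensorRing.scalar k V a)) = _
  rw [tensorBaseChange_scalar]

/-- The abelian group `A ⊗_k k'`, where `A` is a right `k`-module through `k → A`. -/
abbrev AlgTensor (R : AddSubgroup (TensorRing k V)) : Type (max (max u w) v) :=
  BalTensor k (Pull ((HomogAlg.mk R).comp (TensorRing.scalar k V))) (Pull f)

/-- The element `a ⊗ c` of `A ⊗_k k'`. -/
def AlgTensor.mk {R : AddSubgroup (TensorRing k V)} (a : HomogAlg R) (c : k') : AlgTensor f R :=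
  BalTensor.tmul k (Pull.of _ a) (Pull.of f c)

/-- The canonical map `A ⊗_k k' → A'`, sending `a ⊗ c` to the product of the image of `a` by `c`. -/
def algComparison (hext : ∀ (a : k) (v : V), f a • v = a • v) (R : AddSubgroup (TensorRing k V)) :
    AlgTensor f R →+ HomogAlg (relBaseChange f hext R) :=
  BalTensor.lift (M := Pull ((HomogAlg.mk R).comp (TensorRing.scalar k V))) (N := Pull f)
    (((AddMonoidHom.mul (R := HomogAlg (relBaseChange f hext R))).compl₂
        ((HomogAlg.mk (relBaseChange f hext R)).comp
          (TensorRing.scalar k' (BaseChange f V))).toAddMonoidHom).comp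
      (algMap f hext R).toAddMonoidHom)
    (fun (a : HomogAlg R) s (c : k') => by
      change algMap f hext R (a * HomogAlg.mk R (TensorRing.scalar k V s)) *
          HomogAlg.mk _ (TensorRing.scalar k' _ c)
        = algMap f hext R a * HomogAlg.mk _ (TensorRing.scalar k' _ (f s * c))
      rw [map_mul, algMap_scalar, map_mul, map_mul, mul_assoc])

lemma algComparison_mk (hext : ∀ (a : k) (v : V), f a • v = a • v)
    (R : AddSubgroup (TensorRing k V)) (a : HomogAlg R) (c : k') :
    algComparison f hext R (AlgTensor.mk f a c)
      = algMap f hext R a * HomogAlg.mk _ (TensorRing.scalar k' _ c) := rfl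

/-- The component `A_n ⊗_k k'` of degree `n` of `A ⊗_k k'`, as the subgroup generated by the
elements `a ⊗ c` with `a ∈ A_n`. -/
def AlgTensor.grading (R : AddSubgroup (TensorRing k V)) (n : ℕ) : AddSubgroup (AlgTensor f R) :=
  AddSubgroup.closure {z | ∃ a ∈ HomogAlg.grading R n, ∃ c : k', z = AlgTensor.mk f a c}

end ChangeOfRings

end NKoszul

end

noncomputable section

namespace NKoszul

universe u v w x y

/-! The left action of k' on V lets scalars travel to the right: V' ⊗_{k'} V' = V ⊗_k k' ⊗_{k'} V
⊗_k k' = V ⊗_k V ⊗_k k', and so on, whence V'^{⊗n} = V^{⊗n} ⊗_k k'. Concretely, if t ∈ T_k(V) has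
degree 0 component t₀ and image j(t), then c j(t) = j(c·t) + c f(t₀), where c·t is the action on the
first factor, set to 0 in degree 0 (`scalar_mul_tensorBaseChange`). As R is stable under k', this
rule shows that R' is a bimodule and that A ⊗_k k' → A' is onto. For injectivity, A' is made to act
on A ⊗_k k' (`algAction`), and evaluating this action at 1 ⊗ 1 gives a left inverse
(`algComparison_injective`).

For Koszulity, let Q be a graded-free resolution of the right module k_A. Since A' = A ⊗_k k', one
has Q ⊗_A A' = Q ⊗_k k'. Modules over the von Neumann regular ring k are flat, so this is a
graded-free resolution of k ⊗_k k' = k' over A' (`FreeResolution.baseChange`). Moreover (Q ⊗_A A')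
⊗_{A'} k' = (Q ⊗_A k) ⊗_k k', and flatness, used a second time, carries the vanishing of a graded
component of Tor from A to A' (`isKoszul_relBaseChange`).

Two ingredients support this. First, Tor is defined by resolving the left module, whereas the
argument resolves the right one; `torGrading_eq_bot_iff_right` balances the two, degree by degree,
in the double complex of both resolutions. Second, flatness enters through the equational property
`HasSplitRelations` and its consequence `HasSplitRelations.exact`. There an endomorphism ρ of the
middle term is carried along: ρ = id gives exactness, while ρ = projection onto the basis elements
of degree i expresses the vanishing of the degree i component of homology. Right modules over A are
treated throughout as left modules over the opposite ring. -/

lemma endMul_apply {G : Type*} [AddCommGroup G] (φ ψ : AddMonoid.End G) (z : G) :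
    (φ * ψ) z = φ (ψ z) := rfl

lemma endAdd_apply {G : Type*} [AddCommGroup G] (φ ψ : AddMonoid.End G) (z : G) :
    (φ + ψ) z = φ z + ψ z := rfl

/-! ### The comparison map `A ⊗_k k' → A'` -/

section Comparison

variable {k : Type u} {k' : Type v} [Ring k] [Ring k'] (f : k →+* k')
  {V : Type w} [AddCommGroup V] [Module k V] [Module kᵐᵒᵖ V]

/-- The projection of `T_k(V)` onto its component of degree `0`. -/
def TensorRing.degZero : TensorRing k V →+* k :=
  TensorRing.lift (RingHom.id k) 0 (by simp) (by simp)

@[simp]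
lemma TensorRing.degZero_scalar (a : k) :
    TensorRing.degZero (TensorRing.scalar k V a) = a := by simp [TensorRing.degZero]

@[simp]
lemma TensorRing.degZero_ι (v : V) : TensorRing.degZero (TensorRing.ι k V v) = 0 := by
  simp [TensorRing.degZero]

lemma TensorRing.degZero_of_mem (n : ℕ) (t : TensorRing k V) (ht : t ∈ TensorRing.tpow k V (n + 1)) :
    TensorRing.degZero t = 0 := by
  induction ht using AddSubgroup.closure_induction with
  | mem z hz =>
    obtain ⟨v, s, hs, rfl⟩ := hz
    simp
  | zero => simp
  | add x y _ _ hx hy => simp [hx, hy]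
  | neg x _ hx => simp [hx]

lemma HomogAlg.aug_mk {N : ℕ} {R : AddSubgroup (TensorRing k V)} (hR : IsHomogRel N R)
    (t : TensorRing k V) : HomogAlg.aug hR (HomogAlg.mk R t) = TensorRing.degZero t := rfl

/-- The additive map `V ⊗_k k' → G` defined by a biadditive `k`-balanced map. -/
def BaseChange.lift {f : k →+* k'} {G : Type x} [AddCommGroup G] (φ : V →+ k' →+ G)
    (hφ : ∀ v (s : k) c, φ (MulOpposite.op s • v) c = φ v (f s * c)) : BaseChange f V →+ G :=
  BalTensor.lift (M := V) (N := Pull f) φ hφ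

/-! ### Maps out of A ⊗_k k' and left multiplication by A. -/

namespace AlgTensor

variable {f} {R : AddSubgroup (TensorRing k V)}

@[elab_as_elim]
lemma induction_on {p : AlgTensor f R → Prop} (z : AlgTensor f R) (zero : p 0)
    (mk : ∀ a c, p (mk f a c)) (add : ∀ a b, p a → p b → p (a + b)) : p z :=
  BalTensor.induction_on z zero mk add

lemma mk_add (a : HomogAlg R) (c d : k') : mk f a (c + d) = mk f a c + mk f a d :=
  BalTensor.tmul_add _ _ _

lemma add_mk (a b : HomogAlg R) (c : k') : mk f (a + b) c = mk f a c + mk f b c :=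
  BalTensor.add_tmul _ _ _

lemma mk_mul_left (a : HomogAlg R) (s : k) (c : k') :
    mk f (a * HomogAlg.mk R (TensorRing.scalar k V s)) c = mk f a (f s * c) :=
  BalTensor.smul_tmul (S := k) (M := Pull ((HomogAlg.mk R).comp (TensorRing.scalar k V)))
    (N := Pull f) a s c

/-- The additive map `A ⊗_k k' → G` defined by a biadditive `k`-balanced map. -/
def lift {G : Type x} [AddCommGroup G] (φ : HomogAlg R →+ k' →+ G)
    (hφ : ∀ a s c, φ (a * HomogAlg.mk R (TensorRing.scalar k V s)) c = φ a (f s * c)) :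
    AlgTensor f R →+ G :=
  BalTensor.lift (M := Pull ((HomogAlg.mk R).comp (TensorRing.scalar k V))) (N := Pull f) φ hφ

lemma lift_mk {G : Type x} [AddCommGroup G] (φ : HomogAlg R →+ k' →+ G)
    (hφ : ∀ a s c, φ (a * HomogAlg.mk R (TensorRing.scalar k V s)) c = φ a (f s * c))
    (a : HomogAlg R) (c : k') : lift φ hφ (mk f a c) = φ a c := rfl

lemma hom_ext {G : Type x} [AddCommGroup G] {φ ψ : AlgTensor f R →+ G}
    (h : ∀ t c, φ (mk f (HomogAlg.mk R t) c) = ψ (mk f (HomogAlg.mk R t) c)) : φ = ψ := by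
  refine BalTensor.hom_ext fun a c => ?_
  obtain ⟨t, rfl⟩ := HomogAlg.mk_surjective R a
  exact h t c

lemma end_ext {φ ψ : AddMonoid.End (AlgTensor f R)}
    (h : ∀ t c, φ (mk f (HomogAlg.mk R t) c) = ψ (mk f (HomogAlg.mk R t) c)) : φ = ψ := hom_ext h

@[simp]
lemma zero_mk (c : k') : mk f (0 : HomogAlg R) c = 0 := by
  have h := add_mk (f := f) (0 : HomogAlg R) 0 c
  rwa [add_zero, left_eq_add] at h

@[simp]
lemma mk_zero (a : HomogAlg R) : mk f a 0 = 0 := by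
  have h := mk_add (f := f) a 0 0
  rwa [add_zero, left_eq_add] at h

/-- Left multiplication by elements of `A` on `A ⊗_k k'`. -/
def mulLeft : HomogAlg R →+* AddMonoid.End (AlgTensor f R) where
  toFun b := lift (AddMonoidHom.mk' (fun a => AddMonoidHom.mk' (fun c => mk f (b * a) c)
      (fun c d => mk_add _ _ _)) (fun a a' => AddMonoidHom.ext fun c => by
        simp only [AddMonoidHom.mk'_apply, AddMonoidHom.add_apply, mul_add, add_mk]))
    (fun a s c => by simp only [AddMonoidHom.mk'_apply, ← mul_assoc, mk_mul_left])
  map_one' := hom_ext fun t c => by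
    rw [lift_mk]; simp only [AddMonoidHom.mk'_apply, one_mul]; rfl
  map_mul' a b := hom_ext fun t c => by
    rw [lift_mk]; simp only [AddMonoidHom.mk'_apply, mul_assoc]; rfl
  map_zero' := hom_ext fun t c => by
    rw [lift_mk]; simp only [AddMonoidHom.mk'_apply, zero_mul, zero_mk]
    rfl
  map_add' a b := hom_ext fun t c => by
    rw [lift_mk]; simp only [AddMonoidHom.mk'_apply, add_mul, add_mk]; rfl

lemma mulLeft_mk (b a : HomogAlg R) (c : k') : mulLeft b (mk f a c) = mk f (b * a) c := rfl

end AlgTensor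

variable [Module k' V] [SMulCommClass k' kᵐᵒᵖ V] (hext : ∀ (a : k) (v : V), f a • v = a • v)

/-! ### The action of k' on the first tensor factor. -/

lemma leftAct_scalar_mul (c : k') (a : k) (t : TensorRing k V) :
    leftAct f hext c (TensorRing.scalar k V a * t) = leftAct f hext (c * f a) t := by
  change (leftActAux f hext (TensorRing.scalar k V a * t) (1, 0)).2 c = _
  rw [map_mul]
  have hs : leftActAux f hext (TensorRing.scalar k V a) = leftActScalar f a :=
    TensorRing.lift_scalar _ _ _ _ a
  rw [hs]
  rfl

@[simp]
lemma leftAct_scalar (c : k') (a : k) : leftAct f hext c (TensorRing.scalar k V a) = 0 := by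
  change (leftActAux f hext (TensorRing.scalar k V a) (1, 0)).2 c = _
  have hs : leftActAux f hext (TensorRing.scalar k V a) = leftActScalar f a :=
    TensorRing.lift_scalar _ _ _ _ a
  rw [hs]
  rfl

@[simp]
lemma leftAct_ι (c : k') (v : V) :
    leftAct f hext c (TensorRing.ι k V v) = TensorRing.ι k V (c • v) := by
  have := leftAct_ι_mul f hext c v 1
  rwa [mul_one, mul_one] at this

/-- Write s as its degree 0 part plus a part of positive degree. On the latter, c acts on the first
factor of s; the former is a scalar, which c absorbs before acting on t. This rule drives the
inductions over the generators of the tensor ring that follow. -/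
lemma leftAct_mul (c : k') (s t : TensorRing k V) :
    leftAct f hext c (s * t)
      = leftAct f hext c s * t + leftAct f hext (c * f (TensorRing.degZero s)) t := by
  induction s using TensorRing.induction generalizing c t with
  | scalar a => simp [leftAct_scalar_mul]
  | ι v =>
    rw [leftAct_ι_mul, leftAct_ι, TensorRing.degZero_ι, map_zero, mul_zero]
    have : leftAct f hext 0 t = 0 := map_zero (leftActAux f hext t (1, 0)).2
    rw [this, add_zero]
  | add a b ha hb =>
    have : ∀ c d : k', leftAct f hext (c + d) t = leftAct f hext c t + leftAct f hext d t :=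
      fun c d => map_add (leftActAux f hext t (1, 0)).2 c d
    rw [add_mul, map_add, ha, hb, map_add, map_add, map_add, mul_add, this, add_mul]
    abel
  | mul a b ha hb =>
    rw [mul_assoc, ha, hb, ha, map_mul, map_mul, add_mul, mul_assoc, mul_assoc, add_assoc]

lemma leftAct_add_left (c d : k') (t : TensorRing k V) :
    leftAct f hext (c + d) t = leftAct f hext c t + leftAct f hext d t :=
  map_add (leftActAux f hext t (1, 0)).2 c d

@[simp]
lemma leftAct_zero_left (t : TensorRing k V) : leftAct f hext 0 t = 0 :=
  map_zero (leftActAux f hext t (1, 0)).2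

@[simp]
lemma degZero_leftAct (c : k') (t : TensorRing k V) :
    TensorRing.degZero (leftAct f hext c t) = 0 := by
  induction t using TensorRing.induction generalizing c with
  | scalar a => simp
  | ι v => simp
  | add a b ha hb => rw [map_add, map_add, ha, hb, add_zero]
  | mul a b ha hb => rw [leftAct_mul, map_add, map_mul, ha, hb, zero_mul, add_zero]

lemma leftAct_leftAct (c d : k') (t : TensorRing k V) :
    leftAct f hext c (leftAct f hext d t) = leftAct f hext (c * d) t := by
  induction t using TensorRing.induction generalizing c d with
  | scalar a => simp
  | ι v => simp [mul_smul]
  | add a b ha hb => simp only [map_add, ha, hb]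
  | mul a b ha hb =>
    rw [leftAct_mul, map_add, leftAct_mul, leftAct_mul, ha, hb, degZero_leftAct, map_zero, mul_zero,
      leftAct_zero_left, add_zero, mul_assoc]

/-- The action of k' extends that of k only in positive degree; the second summand restores the
degree 0 part, which `leftAct` kills. -/
lemma leftAct_map (a : k) (t : TensorRing k V) :
    leftAct f hext (f a) t + TensorRing.scalar k V (a * TensorRing.degZero t)
      = TensorRing.scalar k V a * t := by
  induction t using TensorRing.induction generalizing a with
  | scalar b => simp
  | ι v => simp [hext, TensorRing.ι_smul]
  | add s t hs ht => rw [map_add, map_add, mul_add, mul_add, map_add, ← hs, ← ht]; abel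
  | mul s t hs ht =>
    rw [leftAct_mul, ← mul_assoc, ← hs, add_mul, ← ht, map_mul f, map_mul TensorRing.degZero, mul_assoc,
      add_assoc]

lemma leftAct_mem (c : k') (n : ℕ) (t : TensorRing k V) (ht : t ∈ TensorRing.tpow k V n) :
    leftAct f hext c t ∈ TensorRing.tpow k V n := by
  cases n with
  | zero =>
    obtain ⟨a, rfl⟩ := ht
    have : leftAct f hext c (TensorRing.scalar k V a) = 0 := leftAct_scalar f hext c a
    exact this ▸ zero_mem _
  | succ n =>
    induction ht using AddSubgroup.closure_induction with
    | mem z hz =>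
      obtain ⟨v, s, hs, rfl⟩ := hz
      rw [leftAct_ι_mul]
      exact AddSubgroup.subset_closure ⟨c • v, s, hs, rfl⟩
    | zero => rw [map_zero]; exact zero_mem _
    | add x y _ _ hx hy => rw [map_add]; exact add_mem hx hy
    | neg x _ hx => rw [map_neg]; exact neg_mem hx

/-- The commutation rule that moves scalars of k' from the left to the right of elements coming from
T_k(V). It holds for the generators, and `leftAct_mul` propagates it to products. -/
lemma scalar_mul_tensorBaseChange (c : k') (t : TensorRing k V) :
    TensorRing.scalar k' _ c * tensorBaseChange f hext t
      = tensorBaseChange f hext (leftAct f hext c t)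
        + TensorRing.scalar k' _ (c * f (TensorRing.degZero t)) := by
  induction t using TensorRing.induction generalizing c with
  | scalar a => simp [tensorBaseChange_scalar]
  | ι v =>
    rw [tensorBaseChange_ι, leftAct_ι, tensorBaseChange_ι, ← TensorRing.ι_smul,
      BaseChange.smul_tmul', TensorRing.degZero_ι]
    simp
  | add s t hs ht => simp only [map_add, mul_add, hs, ht]; abel
  | mul s t hs ht =>
    rw [map_mul, ← mul_assoc, hs, add_mul, ht, leftAct_mul, map_add, map_mul,
      map_mul TensorRing.degZero,
      map_mul f, map_mul (tensorBaseChange f hext), ← mul_assoc c, map_mul _ (c * _), add_assoc]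

lemma tensorBaseChange_mem (n : ℕ) (t : TensorRing k V) (ht : t ∈ TensorRing.tpow k V n) :
    tensorBaseChange f hext t ∈ TensorRing.tpow k' (BaseChange f V) n := by
  induction n generalizing t with
  | zero =>
    obtain ⟨a, rfl⟩ := ht
    exact ⟨f a, (tensorBaseChange_scalar f hext a).symm⟩
  | succ n ih =>
    induction ht using AddSubgroup.closure_induction with
    | mem z hz =>
      obtain ⟨v, s, hs, rfl⟩ := hz
      rw [map_mul, tensorBaseChange_ι]
      exact AddSubgroup.subset_closure ⟨_, _, ih s hs, rfl⟩
    | zero => rw [map_zero]; exact zero_mem _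
    | add x y _ _ hx hy => rw [map_add]; exact add_mem hx hy
    | neg x _ hx => rw [map_neg]; exact neg_mem hx

lemma TensorRing.mul_scalar_mem (n : ℕ) (a : k) (t : TensorRing k V) (ht : t ∈ tpow k V n) :
    t * scalar k V a ∈ tpow k V n :=
  tpow_mul_mem n 0 t _ ht ⟨a, rfl⟩

variable {N : ℕ} (R : AddSubgroup (TensorRing k V))

variable {R} in
-- Since N is positive, relations have no degree 0 part, so the commutation rule reduces to c j(r) =
-- j(c·r), and c·r lies in R again.
lemma isHomogRel_relBaseChange (hR : IsHomogRel N R)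
    (hRleft : ∀ (c : k'), ∀ r ∈ R, leftAct f hext c r ∈ R) :
    IsHomogRel N (relBaseChange f hext R) where
  two_le := hR.two_le
  le_tpow := by
    rw [relBaseChange, AddSubgroup.closure_le]
    rintro _ ⟨r, hr, c, rfl⟩
    exact TensorRing.mul_scalar_mem _ _ _ (tensorBaseChange_mem f hext N r (hR.le_tpow hr))
  left_mem c r hr := by
    induction hr using AddSubgroup.closure_induction with
    | mem z hz =>
      obtain ⟨r, hr, d, rfl⟩ := hz
      obtain ⟨n, hn⟩ : ∃ n, N = n + 1 := ⟨N - 1, by have := hR.two_le; omega⟩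
      rw [← mul_assoc, scalar_mul_tensorBaseChange,
        TensorRing.degZero_of_mem n r (hn ▸ hR.le_tpow hr), map_zero, mul_zero, map_zero, add_zero]
      exact AddSubgroup.subset_closure ⟨_, hRleft c r hr, d, rfl⟩
    | zero => rw [mul_zero]; exact zero_mem _
    | add x y _ _ hx hy => rw [mul_add]; exact add_mem hx hy
    | neg x _ hx => rw [mul_neg]; exact neg_mem hx
  right_mem c r hr := by
    induction hr using AddSubgroup.closure_induction with
    | mem z hz =>
      obtain ⟨r, hr, d, rfl⟩ := hz
      rw [mul_assoc, ← map_mul]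
      exact AddSubgroup.subset_closure ⟨r, hr, _, rfl⟩
    | zero => rw [zero_mul]; exact zero_mem _
    | add x y _ _ hx hy => rw [add_mul]; exact add_mem hx hy
    | neg x _ hx => rw [neg_mul]; exact neg_mem hx

/-- The image in `A'` of the scalar `c ∈ k'`. -/
abbrev algScalar : k' →+* HomogAlg (relBaseChange f hext R) :=
  (HomogAlg.mk _).comp (TensorRing.scalar k' (BaseChange f V))

/-! ### Surjectivity of the comparison map, and its behaviour on degrees. -/

lemma algMap_mk (t : TensorRing k V) :
    algMap f hext R (HomogAlg.mk R t) = HomogAlg.mk _ (tensorBaseChange f hext t) := rfl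

/-- The range contains 1 and is stable under left multiplication by the generators of T_{k'}(V'): by
c ∈ k' because of the commutation rule, and by v ⊗ c = (v ⊗ 1) c because v multiplies A from the
left. -/
lemma algComparison_surjective : Function.Surjective (algComparison f hext R) := by
  rw [← AddMonoidHom.range_eq_top, AddSubgroup.eq_top_iff']
  have hk : ∀ (a : HomogAlg R) (c d : k'),
      algScalar f hext R c * algComparison f hext R (AlgTensor.mk f a d)
        ∈ (algComparison f hext R).range := by
    intro a c d
    obtain ⟨t, rfl⟩ := HomogAlg.mk_surjective R a
    -- The two summands of the commutation rule; the degree 0 part of t merges with the scalar d on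
    -- the right.
    refine ⟨AlgTensor.mk f (HomogAlg.mk R (leftAct f hext c t)) d
      + AlgTensor.mk f 1 (c * f (TensorRing.degZero t) * d), ?_⟩
    rw [map_add, algComparison_mk, algComparison_mk, algComparison_mk, ← mul_assoc, algMap_mk,
      algMap_mk]
    change _ = HomogAlg.mk _ (TensorRing.scalar k' _ c) * _ * _
    rw [← map_mul (HomogAlg.mk _) (TensorRing.scalar k' _ c), scalar_mul_tensorBaseChange, map_add,
      add_mul, ← map_mul, ← map_mul, ← map_mul, map_one, one_mul, map_mul (TensorRing.scalar k' _)]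
  have key : ∀ (t' : TensorRing k' (BaseChange f V)),
      ∀ z ∈ (algComparison f hext R).range, HomogAlg.mk _ t' * z ∈ (algComparison f hext R).range := by
    intro t'
    induction t' using TensorRing.induction with
    | scalar c =>
      rintro _ ⟨z, rfl⟩
      induction z using AlgTensor.induction_on with
      | zero => rw [map_zero, mul_zero]; exact zero_mem _
      | mk a d => exact hk a c d
      | add x y hx hy => rw [map_add, mul_add]; exact add_mem hx hy
    | ι z =>
      induction z using BaseChange.induction_on with
      | zero => intro z _; rw [map_zero, map_zero, zero_mul]; exact zero_mem _
      | tmul v c =>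
        have e : TensorRing.ι k' _ (BaseChange.tmul f v c)
            = tensorBaseChange f hext (TensorRing.ι k V v) * TensorRing.scalar k' _ c := by
          rw [tensorBaseChange_ι, ← TensorRing.ι_op_smul, BaseChange.op_smul_tmul, one_mul]
        have hv : ∀ z ∈ (algComparison f hext R).range,
            HomogAlg.mk _ (tensorBaseChange f hext (TensorRing.ι k V v)) * z
              ∈ (algComparison f hext R).range := by
          rintro _ ⟨z, rfl⟩
          induction z using AlgTensor.induction_on with
          | zero => rw [map_zero, mul_zero]; exact zero_mem _
          | mk a d =>
            refine ⟨AlgTensor.mk f (HomogAlg.mk R (TensorRing.ι k V v) * a) d, ?_⟩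
            rw [algComparison_mk, algComparison_mk, map_mul, mul_assoc]
            rfl
          | add x y hx hy => rw [map_add, mul_add]; exact add_mem hx hy
        rintro _ ⟨z, rfl⟩
        rw [e, map_mul, mul_assoc]
        apply hv
        induction z using AlgTensor.induction_on with
        | zero => rw [map_zero, mul_zero]; exact zero_mem _
        | mk a d => exact hk a c d
        | add x y hx hy => rw [map_add, mul_add]; exact add_mem hx hy
      | add a b ha hb =>
        intro z hz
        rw [map_add, map_add, add_mul]
        exact add_mem (ha z hz) (hb z hz)
    | add a b ha hb =>
      intro z hz
      rw [map_add, add_mul]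
      exact add_mem (ha z hz) (hb z hz)
    | mul a b ha hb =>
      intro z hz
      rw [map_mul, mul_assoc]
      exact ha _ (hb z hz)
  intro a'
  obtain ⟨t', rfl⟩ := HomogAlg.mk_surjective _ a'
  have := key t' 1 ⟨AlgTensor.mk f 1 1, by rw [algComparison_mk]; simp⟩
  rwa [mul_one] at this

lemma algComparison_leftAct (n : ℕ) (t : TensorRing k V) (ht : t ∈ TensorRing.tpow k V (n + 1))
    (c d : k') :
    algComparison f hext R (AlgTensor.mk f (HomogAlg.mk R (leftAct f hext c t)) d)
      = HomogAlg.mk _ (TensorRing.scalar k' _ c)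
        * algComparison f hext R (AlgTensor.mk f (HomogAlg.mk R t) d) := by
  rw [algComparison_mk, algComparison_mk, algMap_mk, algMap_mk, ← mul_assoc,
    ← map_mul (HomogAlg.mk _) (TensorRing.scalar k' _ c), scalar_mul_tensorBaseChange,
    TensorRing.degZero_of_mem n t ht, map_zero, mul_zero, map_zero, add_zero]

/-- The degreewise form of the commutation rule: all scalars of a product (v₁ ⊗ c₁) ⋯ (vₙ ⊗ cₙ) can
be gathered at the right end. -/
lemma tpow_baseChange_le (n : ℕ) : TensorRing.tpow k' (BaseChange f V) n
    ≤ AddSubgroup.closure {z | ∃ t ∈ TensorRing.tpow k V n, ∃ c : k',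
      z = tensorBaseChange f hext t * TensorRing.scalar k' _ c} := by
  induction n with
  | zero =>
    rintro _ ⟨c, rfl⟩
    exact AddSubgroup.subset_closure ⟨1, ⟨1, map_one (TensorRing.scalar k V)⟩, c,
      by rw [map_one, one_mul]; rfl⟩
  | succ n ih =>
    rw [TensorRing.tpow, AddSubgroup.closure_le]
    rintro _ ⟨z, t', ht', rfl⟩
    replace ht' := ih ht'
    induction z using BaseChange.induction_on with
    | zero => rw [map_zero, zero_mul]; exact zero_mem _
    | add a b ha hb => rw [map_add, add_mul]; exact add_mem ha hb
    | tmul v c =>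
    induction ht' using AddSubgroup.closure_induction with
    | zero => rw [mul_zero]; exact zero_mem _
    | add x y _ _ hx hy => rw [mul_add]; exact add_mem hx hy
    | neg x _ hx => rw [mul_neg]; exact neg_mem hx
    | mem z hz =>
      obtain ⟨t, ht, d, rfl⟩ := hz
      have e : TensorRing.ι k' _ (BaseChange.tmul f v c)
          = tensorBaseChange f hext (TensorRing.ι k V v) * TensorRing.scalar k' _ c := by
        rw [tensorBaseChange_ι, ← TensorRing.ι_op_smul, BaseChange.op_smul_tmul, one_mul]
      rw [e, ← mul_assoc, mul_assoc (tensorBaseChange f hext _), scalar_mul_tensorBaseChange,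
        mul_add, add_mul, ← map_mul, mul_assoc, ← map_mul]
      refine add_mem (AddSubgroup.subset_closure ⟨_, ?_, d, rfl⟩) ?_
      · exact AddSubgroup.subset_closure ⟨v, _, leftAct_mem f hext c n t ht, rfl⟩
      -- This is the correction coming from the degree 0 part of t. If t has degree 0, it is a
      -- scalar to the right of v; otherwise it vanishes.
      · cases n with
        | zero =>
          exact AddSubgroup.subset_closure ⟨_, TensorRing.ι_mem v, _, rfl⟩
        | succ n =>
          rw [TensorRing.degZero_of_mem n t ht, map_zero, mul_zero, zero_mul, map_zero, mul_zero]
          exact zero_mem _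

lemma map_grading_algComparison (n : ℕ) :
    (AlgTensor.grading f R n).map (algComparison f hext R)
      = HomogAlg.grading (relBaseChange f hext R) n := by
  apply le_antisymm
  · rw [AddSubgroup.map_le_iff_le_comap, AlgTensor.grading, AddSubgroup.closure_le]
    rintro _ ⟨_, ⟨t, ht, rfl⟩, c, rfl⟩
    exact ⟨_, TensorRing.mul_scalar_mem n c _ (tensorBaseChange_mem f hext n t ht),
      map_mul (HomogAlg.mk _) _ _⟩
  · refine AddSubgroup.map_le_iff_le_comap.2 ((tpow_baseChange_le f hext n).trans ?_)
    rw [AddSubgroup.closure_le]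
    rintro _ ⟨t, ht, d, rfl⟩
    exact ⟨_, AddSubgroup.subset_closure ⟨HomogAlg.mk R t, ⟨t, ht, rfl⟩, d, rfl⟩,
      (map_mul (HomogAlg.mk (relBaseChange f hext R)) _ _).symm⟩

variable {R} in
-- This lets k' act on A. The elements of I(R) whose translates under all c ∈ k' stay in I(R), and
-- whose degree 0 part vanishes, form a two-sided ideal J containing R. By `leftAct_mul`, stability
-- under left multiplication needs all c at once, and stability under right multiplication needs the
-- vanishing degree 0 part.
lemma leftAct_mem_span (hR : IsHomogRel N R)
    (hRleft : ∀ (c : k'), ∀ r ∈ R, leftAct f hext c r ∈ R) (c : k') (t : TensorRing k V)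
    (ht : t ∈ TwoSidedIdeal.span (R : Set (TensorRing k V))) :
    leftAct f hext c t ∈ TwoSidedIdeal.span (R : Set (TensorRing k V)) := by
  let J : TwoSidedIdeal (TensorRing k V) := TwoSidedIdeal.mk'
    {t | t ∈ TwoSidedIdeal.span (R : Set (TensorRing k V)) ∧ TensorRing.degZero t = 0 ∧
      ∀ c, leftAct f hext c t ∈ TwoSidedIdeal.span (R : Set (TensorRing k V))}
    ⟨zero_mem _, map_zero _, fun c => by rw [map_zero]; exact zero_mem _⟩
    (fun {x y} hx hy => ⟨add_mem hx.1 hy.1, by rw [map_add, hx.2.1, hy.2.1, add_zero],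
      fun c => by rw [map_add]; exact add_mem (hx.2.2 c) (hy.2.2 c)⟩)
    (fun {x} hx => ⟨neg_mem hx.1, by rw [map_neg, hx.2.1, neg_zero],
      fun c => by rw [map_neg]; exact neg_mem (hx.2.2 c)⟩)
    (fun {x y} hy => ⟨TwoSidedIdeal.mul_mem_left _ _ _ hy.1, by rw [map_mul, hy.2.1, mul_zero],
      fun c => by
        rw [leftAct_mul]
        exact add_mem (TwoSidedIdeal.mul_mem_left _ _ _ hy.1) (hy.2.2 _)⟩)
    (fun {x y} hx => ⟨TwoSidedIdeal.mul_mem_right _ _ _ hx.1, by rw [map_mul, hx.2.1, zero_mul],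
      fun c => by
        rw [leftAct_mul, hx.2.1, map_zero, mul_zero, leftAct_zero_left, add_zero]
        exact TwoSidedIdeal.mul_mem_right _ _ _ (hx.2.2 c)⟩)
  have h : TwoSidedIdeal.span (R : Set (TensorRing k V)) ≤ J := by
    refine TwoSidedIdeal.span_le.2 fun r hr => ?_
    obtain ⟨n, hn⟩ : ∃ n, N = n + 1 := ⟨N - 1, by have := hR.two_le; omega⟩
    refine (TwoSidedIdeal.mem_mk' _ _ _ _ _ _ _).2 ⟨TwoSidedIdeal.subset_span hr,
      TensorRing.degZero_of_mem n r (hn ▸ hR.le_tpow hr),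
      fun c => TwoSidedIdeal.subset_span (hRleft c r hr)⟩
  exact ((TwoSidedIdeal.mem_mk' _ _ _ _ _ _ _).1 (h ht)).2.2 c

/-! ### The action of A' on A ⊗_k k', and injectivity of the comparison map. -/

section Action

variable {R} (hR : IsHomogRel N R) (hRleft : ∀ (c : k'), ∀ r ∈ R, leftAct f hext c r ∈ R)

/-- The additive map `A → A` induced by `leftAct`. -/
def algLeftAct (c : k') : HomogAlg R →+ HomogAlg R :=
  AddMonoidHom.liftOfSurjective (HomogAlg.mk R).toAddMonoidHom (HomogAlg.mk_surjective R)
    ⟨(HomogAlg.mk R).toAddMonoidHom.comp (leftAct f hext c), fun t ht =>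
      (HomogAlg.mk_eq_zero_iff R _).2 (leftAct_mem_span f hext hR hRleft c t
        ((HomogAlg.mk_eq_zero_iff R t).1 ht))⟩

lemma algLeftAct_mk (c : k') (t : TensorRing k V) :
    algLeftAct f hext hR hRleft c (HomogAlg.mk R t) = HomogAlg.mk R (leftAct f hext c t) :=
  AddMonoidHom.liftOfRightInverse_comp_apply _ _ _ _ _

/-- The action of `c ∈ k'` on `A ⊗_k k'`. -/
def scalarActionAux (c : k') : AddMonoid.End (AlgTensor f R) :=
  AlgTensor.lift
    -- Modelled on the commutation rule: the part of a of positive degree is acted on through its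
    -- first factor, while a degree 0 part a₀ gives a₀ ⊗ d = 1 ⊗ f(a₀) d, which is sent to 1 ⊗ c
    -- f(a₀) d.
    (AddMonoidHom.mk' (fun a => AddMonoidHom.mk' (fun d =>
        AlgTensor.mk f (algLeftAct f hext hR hRleft c a) d
          + AlgTensor.mk f 1 (c * f (HomogAlg.aug hR a) * d))
      (fun d e => by rw [mul_add, AlgTensor.mk_add, AlgTensor.mk_add]; abel))
      (fun a b => AddMonoidHom.ext fun d => by
        simp only [add_mul, mul_add, map_add, AlgTensor.mk_add, AlgTensor.add_mk,
          AddMonoidHom.mk'_apply, AddMonoidHom.add_apply]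
        abel))
    (fun a s d => by
      obtain ⟨t, rfl⟩ := HomogAlg.mk_surjective R a
      simp only [AddMonoidHom.mk'_apply]
      rw [← map_mul, algLeftAct_mk, algLeftAct_mk, HomogAlg.aug_mk, HomogAlg.aug_mk, leftAct_mul,
        leftAct_scalar, add_zero, map_mul, map_mul, map_mul, TensorRing.degZero_scalar,
        AlgTensor.mk_mul_left]
      simp only [mul_assoc])

lemma scalarActionAux_mk (c : k') (t : TensorRing k V) (d : k') :
    scalarActionAux f hext hR hRleft c (AlgTensor.mk f (HomogAlg.mk R t) d)
      = AlgTensor.mk f (HomogAlg.mk R (leftAct f hext c t)) d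
        + AlgTensor.mk f 1 (c * f (TensorRing.degZero t) * d) := by
  rw [← algLeftAct_mk f hext hR hRleft]
  rfl

lemma scalarActionAux_one (c d : k') :
    scalarActionAux f hext hR hRleft c (AlgTensor.mk f 1 d) = AlgTensor.mk f 1 (c * d) := by
  have h := scalarActionAux_mk f hext hR hRleft c (TensorRing.scalar k V 1) d
  rw [leftAct_scalar, TensorRing.degZero_scalar, map_one, map_one, map_one, mul_one, map_zero] at h
  rw [h, AlgTensor.zero_mk, zero_add]

/-- The two ways for k to act agree, because of `leftAct_map`. Beyond giving the unit and zero laws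
of `scalarAction`, this is what makes the action of V ⊗_k k' well defined on balanced tensors. -/
lemma scalarActionAux_map (a : k) :
    scalarActionAux f hext hR hRleft (f a)
      = AlgTensor.mulLeft (HomogAlg.mk R (TensorRing.scalar k V a)) := by
  refine AlgTensor.end_ext fun t d => ?_
  rw [scalarActionAux_mk, AlgTensor.mulLeft_mk, ← map_mul, ← map_mul, ← leftAct_map f hext,
    map_add, AlgTensor.add_mk, ← AlgTensor.mk_mul_left, one_mul]

/-- The left action of the ring `k'` on `A ⊗_k k'`. -/
def scalarAction : k' →+* AddMonoid.End (AlgTensor f R) where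
  toFun := scalarActionAux f hext hR hRleft
  map_one' := by
    have h := scalarActionAux_map f hext hR hRleft 1
    rwa [map_one, map_one, map_one, map_one] at h
  map_mul' c d := AlgTensor.end_ext fun t e => by
    rw [endMul_apply, scalarActionAux_mk, scalarActionAux_mk, map_add, scalarActionAux_mk, scalarActionAux_one,
      leftAct_leftAct, degZero_leftAct, map_zero, mul_zero, zero_mul, add_assoc, ← AlgTensor.mk_add,
      zero_add]
    simp only [mul_assoc]
  map_zero' := by
    have h := scalarActionAux_map f hext hR hRleft 0
    rwa [map_zero, map_zero, map_zero, map_zero] at h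
  map_add' c d := AlgTensor.end_ext fun t e => by
    rw [endAdd_apply, scalarActionAux_mk, scalarActionAux_mk, scalarActionAux_mk, leftAct_add_left, map_add,
      AlgTensor.add_mk, add_mul, add_mul, AlgTensor.mk_add]
    abel

lemma scalarAction_apply (c : k') :
    scalarAction f hext hR hRleft c = scalarActionAux f hext hR hRleft c := rfl

/-- A product starting with v has no degree 0 part, so only the action on the first factor remains.
This is the left k'-linearity required of the action of V'. -/
lemma scalarAction_mulLeft_ι (c : k') (v : V) :
    scalarAction f hext hR hRleft c * AlgTensor.mulLeft (HomogAlg.mk R (TensorRing.ι k V v))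
      = AlgTensor.mulLeft (HomogAlg.mk R (TensorRing.ι k V (c • v))) := by
  refine AlgTensor.end_ext fun t d => ?_
  rw [endMul_apply, scalarAction_apply, AlgTensor.mulLeft_mk, AlgTensor.mulLeft_mk, ← map_mul, ← map_mul, scalarActionAux_mk,
    leftAct_ι_mul, map_mul TensorRing.degZero, TensorRing.degZero_ι, zero_mul, map_zero, mul_zero,
    zero_mul, AlgTensor.mk_zero, add_zero]

/-- The action on `A ⊗_k k'` of the elements of `V ⊗_k k'`. -/
def vectorAction : BaseChange f V →+ AddMonoid.End (AlgTensor f R) :=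
  BaseChange.lift
    (AddMonoidHom.mk' (fun v => AddMonoidHom.mk' (fun c =>
        AlgTensor.mulLeft (HomogAlg.mk R (TensorRing.ι k V v)) * scalarAction f hext hR hRleft c)
      (fun c d => by rw [map_add, mul_add]))
      (fun v w => AddMonoidHom.ext fun c => by
        simp only [AddMonoidHom.mk'_apply, AddMonoidHom.add_apply, map_add, add_mul]))
    (fun v s c => by
      have e : scalarAction f hext hR hRleft (f s) = _ := scalarActionAux_map f hext hR hRleft s
      simp only [AddMonoidHom.mk'_apply]
      rw [TensorRing.ι_op_smul, map_mul, map_mul, map_mul, e, mul_assoc])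

lemma vectorAction_tmul (v : V) (c : k') :
    vectorAction f hext hR hRleft (BaseChange.tmul f v c)
      = AlgTensor.mulLeft (HomogAlg.mk R (TensorRing.ι k V v))
        * scalarAction f hext hR hRleft c := rfl

/-- The action of `T_{k'}(V ⊗_k k')` on `A ⊗_k k'`. -/
def tensorAction : TensorRing k' (BaseChange f V) →+* AddMonoid.End (AlgTensor f R) :=
  TensorRing.lift (scalarAction f hext hR hRleft) (vectorAction f hext hR hRleft)
    (fun c z => by
      induction z using BaseChange.induction_on with
      | zero => simp
      | tmul v d =>
        rw [BaseChange.smul_tmul', vectorAction_tmul, vectorAction_tmul, ← mul_assoc,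
          scalarAction_mulLeft_ι]
      | add a b ha hb => rw [smul_add, map_add, map_add, ha, hb, mul_add])
    (fun c z => by
      induction z using BaseChange.induction_on with
      | zero => simp
      | tmul v d =>
        rw [BaseChange.op_smul_tmul, vectorAction_tmul, vectorAction_tmul, map_mul, mul_assoc]
      | add a b ha hb => rw [smul_add, map_add, map_add, ha, hb, add_mul])

/-- Elements of R therefore act by 0, hence so does R', and the action descends to A'. -/
lemma tensorAction_tensorBaseChange (t : TensorRing k V) :
    tensorAction f hext hR hRleft (tensorBaseChange f hext t)
      = AlgTensor.mulLeft (HomogAlg.mk R t) := by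
  induction t using TensorRing.induction with
  | scalar a =>
    rw [tensorBaseChange_scalar, tensorAction, TensorRing.lift_scalar]
    exact scalarActionAux_map f hext hR hRleft a
  | ι v =>
    rw [tensorBaseChange_ι, tensorAction, TensorRing.lift_ι, vectorAction_tmul, map_one, mul_one]
  | add a b ha hb => simp only [map_add, ha, hb]
  | mul a b ha hb => simp only [map_mul, ha, hb]

/-- The action of `A'` on `A ⊗_k k'`. -/
def algAction : HomogAlg (relBaseChange f hext R) →+* AddMonoid.End (AlgTensor f R) :=
  HomogAlg.lift _ (tensorAction f hext hR hRleft) (fun r hr => by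
    induction hr using AddSubgroup.closure_induction with
    | mem z hz =>
      obtain ⟨r, hr, c, rfl⟩ := hz
      rw [map_mul, tensorAction_tensorBaseChange,
        (HomogAlg.mk_eq_zero_iff R r).2 (TwoSidedIdeal.subset_span hr), map_zero, zero_mul]
    | zero => exact map_zero _
    | add x y _ _ hx hy => rw [map_add, hx, hy, add_zero]
    | neg x _ hx => rw [map_neg, hx, neg_zero])

include hR hRleft in
-- The element j(a) c of A' sends 1 ⊗ 1 first to 1 ⊗ c and then to a ⊗ c, so evaluation at 1 ⊗ 1 is
-- a left inverse.
lemma algComparison_injective : Function.Injective (algComparison f hext R) := by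
  have h : ∀ z, algAction f hext hR hRleft (algComparison f hext R z) (AlgTensor.mk f 1 1) = z := by
    intro z
    induction z using AlgTensor.induction_on with
    | zero => simp
    | mk a c =>
      obtain ⟨t, rfl⟩ := HomogAlg.mk_surjective R a
      rw [algComparison_mk, map_mul]
      change tensorAction f hext hR hRleft (tensorBaseChange f hext t)
        (tensorAction f hext hR hRleft (TensorRing.scalar k' _ c) (AlgTensor.mk f 1 1)) = _
      have e : tensorAction f hext hR hRleft (TensorRing.scalar k' _ c)
        = scalarActionAux f hext hR hRleft c := TensorRing.lift_scalar _ _ _ _ c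
      rw [tensorAction_tensorBaseChange, e, scalarActionAux_one, AlgTensor.mulLeft_mk, mul_one,
        mul_one]
    | add a b ha hb => rw [map_add, map_add, endAdd_apply, ha, hb]
  exact Function.LeftInverse.injective (g := fun a => algAction f hext hR hRleft a _) h

end Action

end Comparison

/-! ### Flatness -/

section Flat

/-- The map z ↦ g(z) κ is then a projection onto the submodule generated by κ: cyclic submodules of
free modules are direct summands. The map g is built one coordinate at a time. -/
lemma IsVonNeumannRegular.exists_linearMap {S : Type u} [Ring S] (hS : IsVonNeumannRegular S)
    {ι : Type x} (κ : ι →₀ S) : ∃ g : (ι →₀ S) →ₗ[S] S, g κ • κ = κ := by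
  induction κ using Finsupp.induction with
  | zero => exact ⟨0, smul_zero _⟩
  | single_add a b κ ha hb ih =>
    obtain ⟨g₀, hg₀⟩ := ih
    -- With e = g₀(κ), the map g is designed to take the value e + (1 - e) b y (1 - e) on the new
    -- vector. This scalar fixes κ because (1 - e) κ = 0, and fixes b because y is a quasi-inverse
    -- of (1 - e) b.
    obtain ⟨y, hy⟩ := hS ((1 - g₀ κ) * b)
    set e := g₀ κ with he
    -- Erasing the coordinate a before applying g₀ makes the value on the new vector equal to e.
    let g₁ : (ι →₀ S) →ₗ[S] S :=
      g₀ ∘ₗ (LinearMap.id - Finsupp.lsingle a ∘ₗ Finsupp.lapply a)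
    have hg₁ : g₁ (Finsupp.single a b + κ) = e := by
      have hκ : κ a = 0 := Finsupp.notMem_support_iff.1 ha
      simp [g₁, hκ, he]
    let g : (ι →₀ S) →ₗ[S] S :=
      LinearMap.toSpanSingleton S S (1 - b * y * (1 - e)) ∘ₗ g₁
        + LinearMap.toSpanSingleton S S (y * (1 - e)) ∘ₗ Finsupp.lapply a
    have hg : g (Finsupp.single a b + κ) = e * (1 - b * y * (1 - e)) + b * (y * (1 - e)) := by
      have hκ : κ a = 0 := Finsupp.notMem_support_iff.1 ha
      simp only [g, LinearMap.add_apply, LinearMap.comp_apply, hg₁]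
      simp [hκ]
    refine ⟨g, ?_⟩
    rw [hg, smul_add, Finsupp.smul_single, smul_eq_mul]
    congr 2
    · have : (e * (1 - b * y * (1 - e)) + b * (y * (1 - e))) * b
        = e * b + (1 - e) * b * y * ((1 - e) * b) := by noncomm_ring
      rw [this, hy]
      noncomm_ring
    · have h0 : (1 - e) • κ = 0 := by rw [sub_smul, one_smul, hg₀, sub_self]
      have : e * (1 - b * y * (1 - e)) + b * (y * (1 - e))
        = e + ((1 - e) * (b * y)) * (1 - e) := by noncomm_ring
      rw [this, add_smul, mul_smul, h0, smul_zero, add_zero, hg₀]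

variable (S : Type u) [Ring S]

/-- Every finite set of relations between elements of `W` is killed by an endomorphism of the
canonical free cover of `W` which lies over the identity of `W`. -/
def HasSplitRelations (W : Type w) [AddCommGroup W] [Module S W] : Prop :=
  ∀ s : Finset (W →₀ S), (∀ κ ∈ s, Finsupp.linearCombination S id κ = 0) →
    ∃ E : (W →₀ S) →ₗ[S] (W →₀ S),
      (∀ κ, Finsupp.linearCombination S id (E κ) = Finsupp.linearCombination S (id : W → W) κ) ∧
      ∀ κ ∈ s, E κ = 0

variable {S}

/-- Subtracting from the identity the projection onto the span of a relation κ kills κ, and does not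
change the image in W since κ maps to 0. Relations are treated one after another. -/
lemma IsVonNeumannRegular.hasSplitRelations (hS : IsVonNeumannRegular S) (W : Type w)
    [AddCommGroup W] [Module S W] : HasSplitRelations S W := by
  classical
  intro s
  induction s using Finset.induction with
  | empty => exact fun _ => ⟨LinearMap.id, fun _ => rfl, by simp⟩
  | insert κ s _ ih =>
    intro hs
    obtain ⟨E, hE, hEs⟩ := ih fun κ' h => hs κ' (Finset.mem_insert_of_mem h)
    -- The projection is taken for E κ, not for κ: it is composed after E, so the relations already
    -- killed stay killed.
    obtain ⟨g, hg⟩ := hS.exists_linearMap (E κ)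
    have h0 : Finsupp.linearCombination S (id : W → W) (E κ) = 0 := by
      rw [hE, hs κ (Finset.mem_insert_self _ _)]
    refine ⟨(LinearMap.id - LinearMap.toSpanSingleton S _ (E κ) ∘ₗ g) ∘ₗ E, fun κ' => ?_,
      fun κ' h => ?_⟩
    · simp [h0, hE]
    · rcases Finset.mem_insert.1 h with rfl | h
      · simp [hg]
      · simp [hEs κ' h]

/-- The canonical free cover of a free module has a section; the cover followed by this section
kills all relations at once. -/
lemma hasSplitRelations_finsupp (X : Type x) : HasSplitRelations S (X →₀ S) := by
  intro s hs
  refine ⟨Finsupp.linearCombination S (fun x => Finsupp.single (Finsupp.single x 1) 1) ∘ₗ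
    Finsupp.linearCombination S id, fun κ => ?_, fun κ h => by simp [hs κ h]⟩
  have : (Finsupp.linearCombination S (id : (X →₀ S) → (X →₀ S))) ∘ₗ
      Finsupp.linearCombination S (fun x => Finsupp.single (Finsupp.single x 1) 1)
      = LinearMap.id := by
    ext x : 2
    simp
  exact LinearMap.congr_fun this _

/-! ### Tensors as families, and exactness of tensoring with W. -/

variable {B : Type v} [AddCommGroup B] [Module Sᵐᵒᵖ B]

/-- The map `κ ↦ b κ`, from families of scalars to families of elements of `B`. -/
def scaleFamily (W : Type w) (b : B) : (W →₀ S) →+ (W →₀ B) :=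
  Finsupp.mapRange.addMonoidHom
    (AddMonoidHom.mk' (fun s : S => MulOpposite.op s • b)
      (fun s t => by rw [MulOpposite.op_add, add_smul]))

lemma scaleFamily_single {W : Type w} (b : B) (w : W) (s : S) :
    scaleFamily W b (Finsupp.single w s) = Finsupp.single w (MulOpposite.op s • b) := by
  simp [scaleFamily]

lemma scaleFamily_apply {W : Type w} (b : B) (κ : W →₀ S) (w : W) :
    scaleFamily W b κ w = MulOpposite.op (κ w) • b := rfl

variable {W : Type w} [AddCommGroup W] [Module S W]

variable (S) in
/-- The sum `∑ m_w ⊗ w` in `B ⊗_S W`. -/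
def sumTmul : (W →₀ B) →+ BalTensor S B W :=
  Finsupp.liftAddHom fun w => AddMonoidHom.mk' (fun b => BalTensor.tmul S b w)
    (fun b b' => BalTensor.add_tmul b b' w)

lemma sumTmul_single (w : W) (b : B) :
    sumTmul S (Finsupp.single w b) = BalTensor.tmul S b w :=
  Finsupp.liftAddHom_apply_single _ _ _

lemma BalTensor.zero_tmul (n : W) : BalTensor.tmul S (0 : B) n = 0 := by
  have h := BalTensor.add_tmul (S := S) (0 : B) 0 n
  rwa [add_zero, left_eq_add] at h

lemma BalTensor.tmul_zero (m : B) : BalTensor.tmul S m (0 : W) = 0 := by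
  have h := BalTensor.tmul_add (S := S) m (0 : W) 0
  rwa [add_zero, left_eq_add] at h

lemma sumTmul_scaleFamily (b : B) (κ : W →₀ S) :
    sumTmul S (scaleFamily W b κ) = BalTensor.tmul S b (Finsupp.linearCombination S id κ) := by
  induction κ using Finsupp.induction_linear with
  | zero => simp [BalTensor.tmul_zero]
  | add κ κ' h h' => rw [map_add, map_add, map_add, BalTensor.tmul_add, h, h']
  | single w s => rw [scaleFamily_single, sumTmul_single, BalTensor.smul_tmul]; simp

lemma sumTmul_surjective : Function.Surjective (sumTmul S : (W →₀ B) →+ BalTensor S B W) := by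
  intro z
  induction z using BalTensor.induction_on with
  | zero => exact ⟨0, map_zero _⟩
  | tmul b w => exact ⟨_, sumTmul_single w b⟩
  | add a b ha hb =>
    obtain ⟨m, rfl⟩ := ha
    obtain ⟨m', rfl⟩ := hb
    exact ⟨m + m', map_add _ _ _⟩

variable (S B W) in
/-- The families obtained from relations between elements of `W`. -/
def relFamilies : AddSubgroup (W →₀ B) :=
  AddSubgroup.closure {m | ∃ (b : B) (κ : W →₀ S),
    Finsupp.linearCombination S (id : W → W) κ = 0 ∧ m = scaleFamily W b κ}

/-- Modulo the families obtained from relations, the class of the family with value b at w is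
biadditive and balanced in (b, w). The quotient map thus factors through B ⊗_S W. -/
lemma mem_relFamilies_of_sumTmul_eq_zero (m : W →₀ B) (hm : sumTmul S m = 0) :
    m ∈ relFamilies S B W := by
  let q := QuotientAddGroup.mk' (relFamilies S B W)
  have hq : ∀ (b : B) (κ κ' : W →₀ S), Finsupp.linearCombination S (id : W → W) κ
      = Finsupp.linearCombination S id κ' → q (scaleFamily W b κ) = q (scaleFamily W b κ') := by
    intro b κ κ' h
    rw [← sub_eq_zero, ← map_sub, ← map_sub]
    exact (QuotientAddGroup.eq_zero_iff _).2
      (AddSubgroup.subset_closure ⟨b, κ - κ', by rw [map_sub, h, sub_self], rfl⟩)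
  let θ : BalTensor S B W →+ (W →₀ B) ⧸ relFamilies S B W :=
    BalTensor.lift
      (AddMonoidHom.mk' (fun b => AddMonoidHom.mk' (fun w => q (Finsupp.single w b))
        (fun w w' => by
          have := hq b (Finsupp.single (w + w') 1) (Finsupp.single w 1 + Finsupp.single w' 1)
            (by simp)
          simpa [scaleFamily_single] using this))
        (fun b b' => AddMonoidHom.ext fun w => by simp))
      (fun b s w => by
        have := hq b (Finsupp.single w s) (Finsupp.single (s • w) 1) (by simp)
        simpa [scaleFamily_single] using this)
  have hθ : θ.comp (sumTmul S) = q := by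
    ext w b
    simp only [AddMonoidHom.comp_apply, Finsupp.singleAddHom_apply, sumTmul_single]
    rfl
  have := DFunLike.congr_fun hθ m
  rw [AddMonoidHom.comp_apply, hm, map_zero] at this
  exact (QuotientAddGroup.eq_zero_iff m).1 this.symm

/-- The endomorphism of the families of elements of `B` induced by an endomorphism of the families
of scalars. -/
def inducedFamilies {W : Type w} (B : Type v) [AddCommGroup B] [Module Sᵐᵒᵖ B]
    (E : (W →₀ S) →ₗ[S] (W →₀ S)) : (W →₀ B) →+ (W →₀ B) :=
  Finsupp.liftAddHom fun w => AddMonoidHom.mk' (fun b => scaleFamily W b (E (Finsupp.single w 1)))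
    (fun b b' => by ext; simp [scaleFamily_apply])

lemma inducedFamilies_single {W : Type w} (E : (W →₀ S) →ₗ[S] (W →₀ S)) (w : W) (b : B) :
    inducedFamilies B E (Finsupp.single w b) = scaleFamily W b (E (Finsupp.single w 1)) :=
  Finsupp.liftAddHom_apply_single _ _ _

lemma inducedFamilies_scaleFamily {W : Type w} (E : (W →₀ S) →ₗ[S] (W →₀ S)) (b : B) (κ : W →₀ S) :
    inducedFamilies B E (scaleFamily W b κ) = scaleFamily W b (E κ) := by
  induction κ using Finsupp.induction_linear with
  | zero => simp
  | add κ κ' h h' => simp only [map_add, h, h']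
  | single w s =>
    rw [scaleFamily_single, inducedFamilies_single]
    have : Finsupp.single w s = s • Finsupp.single w (1 : S) := by simp
    rw [this, map_smul]
    ext w'
    simp [scaleFamily_apply, mul_smul]

/-- Only finitely many relations are involved in a given family, which is why `HasSplitRelations`
need only handle finite sets. -/
lemma exists_finset_of_mem_relFamilies (m : W →₀ B) (hm : m ∈ relFamilies S B W) :
    ∃ s : Finset (W →₀ S), (∀ κ ∈ s, Finsupp.linearCombination S (id : W → W) κ = 0) ∧
      ∀ E : (W →₀ S) →ₗ[S] (W →₀ S), (∀ κ ∈ s, E κ = 0) → inducedFamilies B E m = 0 := by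
  classical
  induction hm using AddSubgroup.closure_induction with
  | mem m hm =>
    obtain ⟨b, κ, hκ, rfl⟩ := hm
    refine ⟨{κ}, by simpa using hκ, fun E hE => ?_⟩
    rw [inducedFamilies_scaleFamily, hE κ (by simp), map_zero]
  | zero => exact ⟨∅, by simp, by simp⟩
  | add m m' _ _ h h' =>
    obtain ⟨s, hs, hsE⟩ := h
    obtain ⟨t, ht, htE⟩ := h'
    refine ⟨s ∪ t, fun κ hκ => ?_, fun E hE => ?_⟩
    · exact (Finset.mem_union.1 hκ).elim (hs κ) (ht κ)
    · rw [map_add, hsE E fun κ h => hE κ (Finset.mem_union_left _ h),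
        htE E fun κ h => hE κ (Finset.mem_union_right _ h), add_zero]
  | neg m _ h =>
    obtain ⟨s, hs, hsE⟩ := h
    exact ⟨s, hs, fun E hE => by rw [map_neg, hsE E hE, neg_zero]⟩

/-- If cycles of `B₁ → B₂ → B₃` become boundaries after applying `ρ`, then the same holds after
tensoring with `W`. -/
lemma HasSplitRelations.exact {W : Type w} [AddCommGroup W] [Module S W]
    (hW : HasSplitRelations S W) {B₁ B₂ B₃ : Type*} [AddCommGroup B₁] [Module Sᵐᵒᵖ B₁]
    [AddCommGroup B₂] [Module Sᵐᵒᵖ B₂] [AddCommGroup B₃] [Module Sᵐᵒᵖ B₃]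
    (φ : B₁ →ₗ[Sᵐᵒᵖ] B₂) (ψ : B₂ →ₗ[Sᵐᵒᵖ] B₃) (ρ : B₂ →ₗ[Sᵐᵒᵖ] B₂)
    (h : ∀ b, ψ b = 0 → ρ b ∈ LinearMap.range φ) (z : BalTensor S B₂ W)
    (hz : BalTensor.map ψ (LinearMap.id : W →ₗ[S] W) z = 0) :
    BalTensor.map ρ (LinearMap.id : W →ₗ[S] W) z
      ∈ (BalTensor.map φ (LinearMap.id : W →ₗ[S] W)).range := by
  obtain ⟨m, rfl⟩ := sumTmul_surjective z
  let ψ' : (W →₀ B₂) →+ (W →₀ B₃) := Finsupp.mapRange.addMonoidHom ψ.toAddMonoidHom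
  have hψ₁ : (BalTensor.map ψ (LinearMap.id : W →ₗ[S] W)).comp (sumTmul S)
      = (sumTmul S).comp ψ' := by
    ext w b
    simp [sumTmul_single, ψ']
  -- The family ψ(m) represents 0 in B₃ ⊗ W, so finitely many relations account for it; E is chosen
  -- to kill them.
  obtain ⟨s, hs, hsE⟩ := exists_finset_of_mem_relFamilies (S := S) (ψ' m)
    (mem_relFamilies_of_sumTmul_eq_zero _ (by
      rw [← AddMonoidHom.comp_apply, ← hψ₁, AddMonoidHom.comp_apply, hz]))
  obtain ⟨E, hE, hE'⟩ := hW s hs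
  have h₁ : (sumTmul S).comp (inducedFamilies B₂ E) = sumTmul S := by
    ext w b
    simp [inducedFamilies_single, sumTmul_scaleFamily, hE, sumTmul_single]
  have h₂ : ψ'.comp (inducedFamilies B₂ E) = (inducedFamilies B₃ E).comp ψ' := by
    ext w b : 2
    ext w'
    simp [inducedFamilies_single, ψ', scaleFamily_apply]
  have h₃ : ψ' (inducedFamilies B₂ E m) = 0 := by
    rw [← AddMonoidHom.comp_apply, h₂, AddMonoidHom.comp_apply, hsE E hE']
  -- Lying over the identity of W, E changes the family but not the tensor it represents. Each
  -- member of the new family is killed by ψ, so the hypothesis applies term by term.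
  rw [← h₁, AddMonoidHom.comp_apply]
  generalize inducedFamilies B₂ E m = m at h₃
  have hm : ∀ w, ψ (m w) = 0 := fun w => DFunLike.congr_fun h₃ w
  rw [sumTmul, Finsupp.liftAddHom_apply, Finsupp.sum, map_sum]
  refine sum_mem fun w _ => ?_
  obtain ⟨a, ha⟩ := h _ (hm w)
  exact ⟨BalTensor.tmul S a w, by
    rw [BalTensor.map_tmul, ha]; rfl⟩

end Flat

/-! ### Tensoring with free modules -/

section FreeTensor

variable {S : Type u} [Ring S] (X : Type x)

/-- The canonical map from `(⨁ B) ⊗ W` to `⨁ (B ⊗ W)`. -/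
def finsuppTensorHom (B : Type v) [AddCommGroup B] [Module Sᵐᵒᵖ B] (W : Type w) [AddCommGroup W]
    [Module S W] : BalTensor S (X →₀ B) W →+ (X →₀ BalTensor S B W) :=
  BalTensor.lift
    (Finsupp.liftAddHom fun x => AddMonoidHom.mk' (fun b => AddMonoidHom.mk'
        (fun w => Finsupp.single x (BalTensor.tmul S b w))
        (fun w w' => by rw [BalTensor.tmul_add, Finsupp.single_add]))
      (fun b b' => AddMonoidHom.ext fun w => by simp [BalTensor.add_tmul]))
    (fun z s w => by
      induction z using Finsupp.induction_linear with
      | zero => simp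
      | add a b ha hb => rw [smul_add, map_add, map_add, AddMonoidHom.add_apply, ha, hb]; rfl
      | single x b =>
        rw [Finsupp.smul_single, Finsupp.liftAddHom_apply_single,
          Finsupp.liftAddHom_apply_single]
        simp [BalTensor.smul_tmul])

variable {X} in
lemma finsuppTensorHom_tmul_single {B : Type v} [AddCommGroup B] [Module Sᵐᵒᵖ B] {W : Type w}
    [AddCommGroup W] [Module S W] (x : X) (b : B) (w : W) :
    finsuppTensorHom X B W (BalTensor.tmul S (Finsupp.single x b) w)
      = Finsupp.single x (BalTensor.tmul S b w) := by
  rw [finsuppTensorHom, BalTensor.lift_tmul, Finsupp.liftAddHom_apply_single]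
  rfl

/-- A direct sum of copies of `B`, tensored with `W`, is the direct sum of copies of `B ⊗ W`. -/
def finsuppTensor (B : Type v) [AddCommGroup B] [Module Sᵐᵒᵖ B] (W : Type w) [AddCommGroup W]
    [Module S W] : BalTensor S (X →₀ B) W ≃+ (X →₀ BalTensor S B W) := by
  let θ : BalTensor S (X →₀ B) W →+ (X →₀ BalTensor S B W) := finsuppTensorHom X B W
  let η : (X →₀ BalTensor S B W) →+ BalTensor S (X →₀ B) W :=
    Finsupp.liftAddHom fun x => BalTensor.map (Finsupp.lsingle x) LinearMap.id
  have hη : ∀ x b w, η (Finsupp.single x (BalTensor.tmul S b w))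
      = BalTensor.tmul S (Finsupp.single x b) w := fun x b w =>
    Finsupp.liftAddHom_apply_single _ _ _
  refine AddEquiv.mk' ⟨θ, η, fun z => ?_, fun z => ?_⟩ (map_add θ)
  · have : η.comp θ = AddMonoidHom.id _ := by
      refine BalTensor.hom_ext fun z w => ?_
      induction z using Finsupp.induction_linear with
      | zero => simp [BalTensor.zero_tmul]
      | add a b ha hb => rw [BalTensor.add_tmul, map_add, map_add, ha, hb]
      | single x b => rw [AddMonoidHom.comp_apply, finsuppTensorHom_tmul_single, hη]; rfl
    exact DFunLike.congr_fun this z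
  · have : θ.comp η = AddMonoidHom.id _ := by
      refine Finsupp.addHom_ext' fun x => BalTensor.hom_ext fun b w => ?_
      rw [AddMonoidHom.comp_apply, AddMonoidHom.comp_apply, Finsupp.singleAddHom_apply, hη,
        finsuppTensorHom_tmul_single]
      rfl
    exact DFunLike.congr_fun this z

variable {X} in
lemma finsuppTensor_tmul_single {B : Type v} [AddCommGroup B] [Module Sᵐᵒᵖ B] {W : Type w}
    [AddCommGroup W] [Module S W] (x : X) (b : B) (w : W) :
    finsuppTensor X B W (BalTensor.tmul S (Finsupp.single x b) w)
      = Finsupp.single x (BalTensor.tmul S b w) := finsuppTensorHom_tmul_single x b w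

/-- The isomorphism `S ⊗_S W ≃ W`, for the free right module `S`. -/
def opTensor (W : Type w) [AddCommGroup W] [Module S W] : BalTensor S Sᵐᵒᵖ W ≃+ W := by
  let θ : BalTensor S Sᵐᵒᵖ W →+ W :=
    BalTensor.lift
      (AddMonoidHom.mk' (fun a => AddMonoidHom.mk' (fun w => a.unop • w) (smul_add _))
        (fun a b => AddMonoidHom.ext fun w => by simp [add_smul]))
      (fun a s w => by simp [mul_smul])
  refine AddEquiv.mk' ⟨θ, fun w => BalTensor.tmul S 1 w, fun z => ?_, fun w => one_smul S w⟩
    (map_add θ)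
  dsimp only
  induction z using BalTensor.induction_on with
  | zero => rw [map_zero, BalTensor.tmul_zero]
  | tmul a w =>
    change BalTensor.tmul S 1 (a.unop • w) = _
    rw [← BalTensor.smul_tmul]
    simp
  | add a b ha hb => rw [map_add, BalTensor.tmul_add, ha, hb]

lemma opTensor_tmul {W : Type w} [AddCommGroup W] [Module S W] (a : Sᵐᵒᵖ) (w : W) :
    opTensor W (BalTensor.tmul S a w) = a.unop • w := rfl

/-- A free right module tensored with `W` is a direct sum of copies of `W`. -/
def freeTensor (W : Type w) [AddCommGroup W] [Module S W] :
    BalTensor S (X →₀ Sᵐᵒᵖ) W ≃+ (X →₀ W) :=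
  (finsuppTensor X Sᵐᵒᵖ W).trans (Finsupp.mapRange.addEquiv (opTensor W))

variable {X}

lemma freeTensor_tmul_single {W : Type w} [AddCommGroup W] [Module S W] (x : X) (a : Sᵐᵒᵖ) (w : W) :
    freeTensor X W (BalTensor.tmul S (Finsupp.single x a) w) = Finsupp.single x (a.unop • w) := by
  rw [freeTensor, AddEquiv.trans_apply, finsuppTensor_tmul_single]
  simp [opTensor_tmul]

lemma freeTensor_symm_single {W : Type w} [AddCommGroup W] [Module S W] (x : X) (w : W) :
    (freeTensor X W).symm (Finsupp.single x w) = BalTensor.tmul S (Finsupp.single x 1) w := by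
  rw [AddEquiv.symm_apply_eq, freeTensor_tmul_single]
  simp

lemma freeTensor_map {W : Type w} [AddCommGroup W] [Module S W] {W' : Type y} [AddCommGroup W']
    [Module S W'] (φ : W →ₗ[S] W') (z : BalTensor S (X →₀ Sᵐᵒᵖ) W) :
    freeTensor X W' (BalTensor.map LinearMap.id φ z)
      = Finsupp.mapRange φ (map_zero φ) (freeTensor X W z) := by
  induction z using BalTensor.induction_on with
  | zero => simp
  | add a b ha hb => rw [map_add, map_add, map_add, ha, hb, Finsupp.mapRange_add (map_add φ)]
  | tmul z w =>
    induction z using Finsupp.induction_linear with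
    | zero => simp [BalTensor.zero_tmul]
    | add a b ha hb =>
      rw [BalTensor.add_tmul, map_add, map_add, map_add, ha, hb, Finsupp.mapRange_add (map_add φ)]
    | single x a =>
      rw [BalTensor.map_tmul, LinearMap.id_apply, freeTensor_tmul_single, freeTensor_tmul_single,
        Finsupp.mapRange_single, map_smul]

lemma freeTensor_exact {W₁ W₂ W₃ : Type*} [AddCommGroup W₁] [Module S W₁] [AddCommGroup W₂]
    [Module S W₂] [AddCommGroup W₃] [Module S W₃] (φ : W₁ →ₗ[S] W₂) (ψ : W₂ →ₗ[S] W₃)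
    (h : ∀ w, ψ w = 0 → w ∈ LinearMap.range φ) (z : BalTensor S (X →₀ Sᵐᵒᵖ) W₂)
    (hz : BalTensor.map (LinearMap.id : (X →₀ Sᵐᵒᵖ) →ₗ[Sᵐᵒᵖ] _) ψ z = 0) :
    z ∈ (BalTensor.map (LinearMap.id : (X →₀ Sᵐᵒᵖ) →ₗ[Sᵐᵒᵖ] _) φ).range := by
  obtain ⟨m, rfl⟩ := (freeTensor X W₂).symm.surjective z
  have h0 := freeTensor_map ψ ((freeTensor X W₂).symm m)
  rw [hz, map_zero, AddEquiv.apply_symm_apply] at h0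
  have hm : ∀ x, ψ (m x) = 0 := fun x => (DFunLike.congr_fun h0 x).symm
  rw [← m.sum_single, Finsupp.sum, map_sum]
  refine sum_mem fun x _ => ?_
  obtain ⟨w, hw⟩ := h _ (hm x)
  exact ⟨BalTensor.tmul S (Finsupp.single x 1) w, by
    rw [BalTensor.map_tmul, freeTensor_symm_single, hw]; rfl⟩

lemma BalTensor.map_surjective {L L' W W' : Type*} [AddCommGroup L] [Module Sᵐᵒᵖ L]
    [AddCommGroup L'] [Module Sᵐᵒᵖ L'] [AddCommGroup W] [Module S W] [AddCommGroup W'] [Module S W']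
    (φ : L →ₗ[Sᵐᵒᵖ] L') (ψ : W →ₗ[S] W') (hφ : Function.Surjective φ)
    (hψ : Function.Surjective ψ) : Function.Surjective (BalTensor.map φ ψ) := by
  intro z
  induction z using BalTensor.induction_on with
  | zero => exact ⟨0, map_zero _⟩
  | tmul m n =>
    obtain ⟨m, rfl⟩ := hφ m
    obtain ⟨n, rfl⟩ := hψ n
    exact ⟨_, BalTensor.map_tmul φ ψ m n⟩
  | add a b ha hb =>
    obtain ⟨a, rfl⟩ := ha
    obtain ⟨b, rfl⟩ := hb
    exact ⟨a + b, map_add _ _ _⟩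

end FreeTensor

/-! ### Double complexes -/

/-- In a double complex with exact rows and columns, augmented by a row `X` and a column `Y`, a cycle
of `X` whose component `π` is to be bounded can be moved to a cycle of `Y`. -/
lemma staircase {C : ℕ → ℕ → Type*} [∀ p q, AddCommGroup (C p q)]
    (dh : ∀ p q, C (p + 1) q →+ C p q) (dv : ∀ p q, C p (q + 1) →+ C p q)
    (comm : ∀ p q z, dh p q (dv (p + 1) q z) = dv p q (dh p (q + 1) z))
    {X : ℕ → Type*} [∀ q, AddCommGroup (X q)] (dX : ∀ q, X (q + 1) →+ X q) (eh : ∀ q, C 0 q →+ X q)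
    (eh_dv : ∀ q z, eh q (dv 0 q z) = dX q (eh (q + 1) z))
    {Y : ℕ → Type*} [∀ p, AddCommGroup (Y p)] (dY : ∀ p, Y (p + 1) →+ Y p) (ev : ∀ p, C p 0 →+ Y p)
    (ev_dh : ∀ p z, ev p (dh p 0 z) = dY p (ev (p + 1) z))
    (eh_surj : ∀ q, Function.Surjective (eh q)) (ev_surj : ∀ p, Function.Surjective (ev p))
    (eh_exact : ∀ q, Function.Exact (dh 0 q) (eh q))
    (ev_exact : ∀ p, Function.Exact (dv p 0) (ev p))
    (dh_exact : ∀ p q, Function.Exact (dh (p + 1) q) (dh p q))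
    (dv_exact : ∀ p q, Function.Exact (dv p (q + 1)) (dv p q))
    (π : ∀ p q, C p q →+ C p q) (πX : ∀ q, X q →+ X q) (πY : ∀ p, Y p →+ Y p)
    (π_dh : ∀ p q z, π p q (dh p q z) = dh p q (π (p + 1) q z))
    (π_dv : ∀ p q z, π p q (dv p q z) = dv p q (π p (q + 1) z))
    (π_eh : ∀ q z, πX q (eh q z) = eh q (π 0 q z)) (π_ev : ∀ p z, πY p (ev p z) = ev p (π p 0 z))
    (n : ℕ) (hY : ∀ y : Y (n + 1), dY n y = 0 → πY _ y ∈ (dY (n + 1)).range)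
    (x : X (n + 1)) (hx : dX n x = 0) : πX _ x ∈ (dX (n + 1)).range := by
  -- One stair, climbed upwards: if π c' = dh b₁ + dv b₂, then π c - dh b₂ is a vertical cycle,
  -- hence a vertical boundary.
  have step : ∀ p q (c : C p (q + 1)) (c' : C (p + 1) q), dh p q c' = dv p q c →
      (∃ b₁ b₂, π _ _ c' = dh (p + 1) q b₁ + dv (p + 1) q b₂) →
      ∃ b₁ b₂, π _ _ c = dh p (q + 1) b₁ + dv p (q + 1) b₂ := by
    rintro p q c c' h ⟨b₁, b₂, hb⟩
    have h1 : dv p q (π _ _ c - dh p (q + 1) b₂) = 0 := by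
      rw [map_sub, ← π_dv, ← h, π_dh, ← comm, ← map_sub, hb, add_sub_cancel_right,
        (dh_exact p q).apply_apply_eq_zero]
    obtain ⟨b₃, hb₃⟩ := (dv_exact p q _).1 h1
    exact ⟨b₂, b₃, by rw [hb₃]; abel⟩
  -- Induction on q, descending the stairs with total degree fixed. At q = 0 the element c maps to a
  -- cycle of Y, where `hY` applies; the condition on c₀ is what makes this image a cycle.
  have key : ∀ q p (c : C (p + 1) q) (c₀ : C p (q + 1)), dh p q c = dv p q c₀ → p + q = n →
      ∃ b₁ b₂, π _ _ c = dh (p + 1) q b₁ + dv (p + 1) q b₂ := by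
    intro q
    induction q with
    | zero =>
      rintro p c c₀ h rfl
      have h0 : dY p (ev (p + 1) c) = 0 := by
        rw [← ev_dh, h, (ev_exact p).apply_apply_eq_zero]
      obtain ⟨y, hy⟩ := hY (ev (p + 1) c) h0
      obtain ⟨b, rfl⟩ := ev_surj _ y
      have h1 : ev (p + 1) (π _ _ c - dh (p + 1) 0 b) = 0 := by
        rw [map_sub, ← π_ev, ev_dh]
        exact sub_eq_zero.2 hy.symm
      obtain ⟨b₃, hb₃⟩ := (ev_exact (p + 1) _).1 h1
      exact ⟨b, b₃, by rw [hb₃]; abel⟩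
    | succ q ih =>
      intro p c c₀ h hpq
      obtain ⟨c', hc'⟩ := (dh_exact p q (dv (p + 1) q c)).1 (by
        rw [comm, h, (dv_exact p q).apply_apply_eq_zero])
      exact step _ _ c c' hc' (ih (p + 1) c' c hc' (by omega))
  obtain ⟨c₀, rfl⟩ := eh_surj _ x
  obtain ⟨c, hc⟩ := (eh_exact n (dv 0 n c₀)).1 (by rw [eh_dv, hx])
  obtain ⟨b₁, b₂, hb⟩ := step 0 n c₀ c hc (key n 0 c c₀ hc (zero_add n))
  refine ⟨eh (n + 1 + 1) b₂, ?_⟩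
  rw [π_eh, hb, map_add, (eh_exact (n + 1)).apply_apply_eq_zero, zero_add, eh_dv]

/-! ### Graded tensor products -/

section GradedTensor

/-- The projection onto the component of degree `i`. -/
def gradedProj {M : Type v} [AddCommGroup M] (ℳ : ℕ → AddSubgroup M) [DirectSum.Decomposition ℳ]
    (i : ℕ) : M →+ M :=
  AddMonoidHom.mk' (fun z => (DirectSum.decompose ℳ z i : M)) (fun a b => by simp)

lemma gradedProj_mem {M : Type v} [AddCommGroup M] (ℳ : ℕ → AddSubgroup M)
    [DirectSum.Decomposition ℳ] (i : ℕ) (z : M) : gradedProj ℳ i z ∈ ℳ i := SetLike.coe_mem _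

lemma gradedProj_of_mem {M : Type v} [AddCommGroup M] {ℳ : ℕ → AddSubgroup M}
    [DirectSum.Decomposition ℳ] {i : ℕ} {z : M} (hz : z ∈ ℳ i) (j : ℕ) :
    gradedProj ℳ j z = if i = j then z else 0 := by
  split_ifs with h
  · subst h; exact DirectSum.decompose_of_mem_same ℳ hz
  · exact DirectSum.decompose_of_mem_ne ℳ hz h

lemma map_gradedProj {M : Type v} {M' : Type w} [AddCommGroup M] [AddCommGroup M']
    (ℳ : ℕ → AddSubgroup M) (ℳ' : ℕ → AddSubgroup M') [DirectSum.Decomposition ℳ]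
    [DirectSum.Decomposition ℳ'] (φ : M →+ M') (hφ : ∀ i, ∀ z ∈ ℳ i, φ z ∈ ℳ' i) (i : ℕ) (z : M) :
    φ (gradedProj ℳ i z) = gradedProj ℳ' i (φ z) := decompose_map ℳ ℳ' φ hφ z i

variable {A : Type u} [Ring A] (𝒜 : ℕ → AddSubgroup A)

/-- The opposite of a grading. -/
def opGrading (i : ℕ) : AddSubgroup Aᵐᵒᵖ :=
  (𝒜 i).comap (MulOpposite.opAddEquiv.symm : Aᵐᵒᵖ ≃+ A).toAddMonoidHom

lemma mem_opGrading {i : ℕ} {a : Aᵐᵒᵖ} : a ∈ opGrading 𝒜 i ↔ a.unop ∈ 𝒜 i := Iff.rfl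

instance [SetLike.GradedMonoid 𝒜] : SetLike.GradedMonoid (opGrading 𝒜) where
  one_mem := SetLike.one_mem_graded 𝒜
  mul_mem i j a b ha hb := by
    rw [add_comm]
    exact SetLike.mul_mem_graded (A := 𝒜) hb ha

variable [GradedRing 𝒜]

lemma opGrading_isInternal : DirectSum.IsInternal (opGrading 𝒜) := by
  refine isInternal_of_proj _ (fun i => (MulOpposite.opAddEquiv : A ≃+ Aᵐᵒᵖ).toAddMonoidHom.comp
    ((gradedProj 𝒜 i).comp (MulOpposite.opAddEquiv.symm : Aᵐᵒᵖ ≃+ A).toAddMonoidHom)) ?_ ?_ ?_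
  · intro i z hz
    have := gradedProj_of_mem ((mem_opGrading 𝒜).1 hz) i
    rw [if_pos rfl] at this
    exact congrArg MulOpposite.op this
  · intro i j hij z hz
    have := gradedProj_of_mem ((mem_opGrading 𝒜).1 hz) i
    rw [if_neg hij] at this
    exact congrArg MulOpposite.op this
  · rw [AddSubgroup.eq_top_iff']
    intro a
    induction a using MulOpposite.rec'
    rename_i a
    induction a using DirectSum.Decomposition.inductionOn 𝒜 with
    | zero => exact zero_mem _
    | @homogeneous i a => exact AddSubgroup.mem_iSup_of_mem i a.2
    | add a b ha hb => exact add_mem ha hb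

instance : GradedRing (opGrading 𝒜) :=
  { (opGrading_isInternal 𝒜).chooseDecomposition,
    (inferInstance : SetLike.GradedMonoid (opGrading 𝒜)) with }

instance {X : Type v} (deg : X → ℕ) : DirectSum.Decomposition (freeHomog 𝒜 deg) :=
  (free_isInternal 𝒜 deg).chooseDecomposition

variable {L : Type v} [AddCommGroup L] [Module Aᵐᵒᵖ L] (ℒ : ℕ → AddSubgroup L)
  [DirectSum.Decomposition ℒ] [SetLike.GradedSMul (opGrading 𝒜) ℒ]
  {M : Type w} [AddCommGroup M] [Module A M] (ℳ : ℕ → AddSubgroup M)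
  [DirectSum.Decomposition ℳ] [SetLike.GradedSMul 𝒜 ℳ]

/-- The biadditive map defining `tensorProj`. -/
def tensorProjAux (n : ℕ) : L →+ M →+ BalTensor A L M :=
  AddMonoidHom.mk' (fun l => AddMonoidHom.mk' (fun m => ∑ p ∈ Finset.HasAntidiagonal.antidiagonal n,
      BalTensor.tmul A (gradedProj ℒ p.1 l) (gradedProj ℳ p.2 m))
    (fun m m' => by simp only [map_add, BalTensor.tmul_add, Finset.sum_add_distrib]))
    (fun l l' => AddMonoidHom.ext fun m => by
      simp only [map_add, BalTensor.add_tmul, Finset.sum_add_distrib, AddMonoidHom.mk'_apply,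
        AddMonoidHom.add_apply])

variable {ℒ ℳ} in
lemma tensorProjAux_of_mem (n : ℕ) {i j : ℕ} {l : L} {m : M} (hl : l ∈ ℒ i) (hm : m ∈ ℳ j) :
    tensorProjAux (A := A) ℒ ℳ n l m = if i + j = n then BalTensor.tmul A l m else 0 := by
  simp only [tensorProjAux, AddMonoidHom.mk'_apply]
  split_ifs with h
  · rw [Finset.sum_eq_single (i, j)]
    · rw [gradedProj_of_mem hl, gradedProj_of_mem hm, if_pos rfl, if_pos rfl]
    · rintro ⟨a, b⟩ - hab
      rw [gradedProj_of_mem hl, gradedProj_of_mem hm]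
      by_cases h1 : i = a
      · rw [if_neg (c := j = b) fun h2 => hab (by rw [h1, h2]), BalTensor.tmul_zero]
      · rw [if_neg h1, BalTensor.zero_tmul]
    · intro h'
      exact absurd (Finset.HasAntidiagonal.mem_antidiagonal.2 h) h'
  · refine Finset.sum_eq_zero fun p hp => ?_
    rw [gradedProj_of_mem hl, gradedProj_of_mem hm]
    by_cases h1 : i = p.1
    · rw [if_neg (c := j = p.2) fun h2 => h (by rw [h1, h2]; exact Finset.HasAntidiagonal.mem_antidiagonal.1 hp),
        BalTensor.tmul_zero]
    · rw [if_neg h1, BalTensor.zero_tmul]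

/-- The projection of `L ⊗_A M` onto its component of degree `n`. -/
def tensorProj (n : ℕ) : BalTensor A L M →+ BalTensor A L M :=
  BalTensor.lift (tensorProjAux ℒ ℳ n) (fun l a m => by
    induction a using DirectSum.Decomposition.inductionOn 𝒜 with
    | zero => simp
    | add a b ha hb =>
      rw [MulOpposite.op_add, add_smul, add_smul, map_add, map_add, AddMonoidHom.add_apply, ha, hb]
    | @homogeneous k a =>
    induction l using DirectSum.Decomposition.inductionOn ℒ with
    | zero => simp
    | add l l' h h' => rw [smul_add, map_add, map_add, AddMonoidHom.add_apply, h, h']; rfl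
    | @homogeneous i l =>
    induction m using DirectSum.Decomposition.inductionOn ℳ with
    | zero => simp
    | add m m' h h' => rw [smul_add, map_add, map_add, h, h']
    | @homogeneous j m =>
    -- For homogeneous a, l and m, both sides are the same tensor if k + i + j = n, and 0 otherwise.
    have h1 : MulOpposite.op (a : A) • (l : L) ∈ ℒ (k + i) :=
      SetLike.GradedSMul.smul_mem (A := opGrading 𝒜) (i := k) (ai := MulOpposite.op (a : A))
        a.2 l.2
    have h2 : (a : A) • (m : M) ∈ ℳ (k + j) := SetLike.GradedSMul.smul_mem a.2 m.2
    rw [tensorProjAux_of_mem n h1 m.2, tensorProjAux_of_mem n l.2 h2, BalTensor.smul_tmul]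
    congr 1
    exact propext ⟨fun h => by omega, fun h => by omega⟩)

variable {ℒ ℳ} in
lemma tensorProj_tmul_of_mem (n : ℕ) {i j : ℕ} {l : L} {m : M} (hl : l ∈ ℒ i) (hm : m ∈ ℳ j) :
    tensorProj 𝒜 ℒ ℳ n (BalTensor.tmul A l m) = if i + j = n then BalTensor.tmul A l m else 0 :=
  tensorProjAux_of_mem n hl hm

lemma tensorProj_tmul (n : ℕ) (l : L) (m : M) :
    tensorProj 𝒜 ℒ ℳ n (BalTensor.tmul A l m) = ∑ p ∈ Finset.HasAntidiagonal.antidiagonal n,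
      BalTensor.tmul A (gradedProj ℒ p.1 l) (gradedProj ℳ p.2 m) := rfl

lemma map_tensorProj {L' : Type x} [AddCommGroup L'] [Module Aᵐᵒᵖ L'] (ℒ' : ℕ → AddSubgroup L')
    [DirectSum.Decomposition ℒ'] [SetLike.GradedSMul (opGrading 𝒜) ℒ'] {M' : Type y}
    [AddCommGroup M'] [Module A M'] (ℳ' : ℕ → AddSubgroup M') [DirectSum.Decomposition ℳ']
    [SetLike.GradedSMul 𝒜 ℳ'] (φ : L →ₗ[Aᵐᵒᵖ] L') (hφ : ∀ i, ∀ z ∈ ℒ i, φ z ∈ ℒ' i)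
    (ψ : M →ₗ[A] M') (hψ : ∀ i, ∀ z ∈ ℳ i, ψ z ∈ ℳ' i) (n : ℕ) (z : BalTensor A L M) :
    tensorProj 𝒜 ℒ' ℳ' n (BalTensor.map φ ψ z) = BalTensor.map φ ψ (tensorProj 𝒜 ℒ ℳ n z) := by
  induction z using BalTensor.induction_on with
  | zero => simp
  | add a b ha hb => simp only [map_add, ha, hb]
  | tmul l m =>
    rw [BalTensor.map_tmul, tensorProj_tmul, tensorProj_tmul, map_sum]
    refine Finset.sum_congr rfl fun p _ => ?_
    have h1 := map_gradedProj ℒ ℒ' φ.toAddMonoidHom hφ p.1 l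
    have h2 := map_gradedProj ℳ ℳ' ψ.toAddMonoidHom hψ p.2 m
    rw [BalTensor.map_tmul]
    exact congrArg₂ (BalTensor.tmul A) h1.symm h2.symm

end GradedTensor

/-! ### Balancing `Tor` -/

section Balance

variable {A : Type u} [Ring A] (𝒜 : ℕ → AddSubgroup A)

/-- A resolution of the graded left `A`-module `M` by graded-free left `A`-modules, with bases in an
arbitrary universe. -/
structure FreeResolution (M : Type w) [AddCommGroup M] [Module A M] (ℳ : ℕ → AddSubgroup M) where
  /-- The basis of the module in homological degree `n`. -/
  gen : ℕ → Type x
  /-- The degrees of the basis elements. -/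
  deg : ∀ n, gen n → ℕ
  /-- The differentials. -/
  d : ∀ n, (gen (n + 1) →₀ A) →ₗ[A] (gen n →₀ A)
  /-- The augmentation. -/
  aug : (gen 0 →₀ A) →ₗ[A] M
  d_homog : ∀ n i, ∀ z ∈ freeHomog 𝒜 (deg (n + 1)) i, d n z ∈ freeHomog 𝒜 (deg n) i
  aug_homog : ∀ i, ∀ z ∈ freeHomog 𝒜 (deg 0) i, aug z ∈ ℳ i
  aug_surjective : Function.Surjective aug
  exact_zero : Function.Exact (d 0) aug
  exact_succ : ∀ n, Function.Exact (d (n + 1)) (d n)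

variable {𝒜} in
/-- Forgetting that the bases are in a given universe. -/
def GradedFreeResolution.toFreeResolution {M : Type w} [AddCommGroup M] [Module A M]
    {ℳ : ℕ → AddSubgroup M} (P : GradedFreeResolution 𝒜 M ℳ) : FreeResolution 𝒜 M ℳ :=
  { P with }

variable [GradedRing 𝒜] {L : Type v} [AddCommGroup L] [Module Aᵐᵒᵖ L] (ℒ : ℕ → AddSubgroup L)
  [DirectSum.Decomposition ℒ] [SetLike.GradedSMul (opGrading 𝒜) ℒ]
  {M : Type w} [AddCommGroup M] [Module A M] {ℳ : ℕ → AddSubgroup M}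
  (P : GradedFreeResolution 𝒜 M ℳ)

lemma tensorProj_mem_chainGrading (n i : ℕ) (z : P.Chain L n) :
    tensorProj 𝒜 ℒ (freeHomog 𝒜 (P.deg n)) i z ∈ P.chainGrading ℒ n i := by
  induction z using BalTensor.induction_on with
  | zero => rw [map_zero]; exact zero_mem _
  | add a b ha hb => rw [map_add]; exact add_mem ha hb
  | tmul l m =>
    rw [tensorProj_tmul]
    exact sum_mem fun p hp => AddSubgroup.subset_closure
      ⟨p.1, p.2, Finset.HasAntidiagonal.mem_antidiagonal.1 hp, _, gradedProj_mem _ _ _, _,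
        gradedProj_mem _ _ _, rfl⟩

lemma tensorProj_of_mem_chainGrading (n i : ℕ) (z : P.Chain L n) (hz : z ∈ P.chainGrading ℒ n i) :
    tensorProj 𝒜 ℒ (freeHomog 𝒜 (P.deg n)) i z = z := by
  induction hz using AddSubgroup.closure_induction with
  | mem z hz =>
    obtain ⟨a, b, hab, l, hl, p, hp, rfl⟩ := hz
    rw [tensorProj_tmul_of_mem 𝒜 i hl hp, if_pos hab]
  | zero => exact map_zero _
  | add a b _ _ ha hb => rw [map_add, ha, hb]
  | neg a _ ha => rw [map_neg, ha]

lemma tensorProj_diff (n i : ℕ) (z : P.Chain L (n + 1)) :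
    tensorProj 𝒜 ℒ (freeHomog 𝒜 (P.deg n)) i (P.diff L n z)
      = P.diff L n (tensorProj 𝒜 ℒ (freeHomog 𝒜 (P.deg (n + 1))) i z) :=
  map_tensorProj 𝒜 ℒ _ ℒ _ LinearMap.id (fun _ _ h => h) (P.d n) (P.d_homog n) i z

/-- Homogeneous components of cycles are cycles, because the differential has degree 0. This
replaces the subquotient by a statement about elements, suited to diagram chasing. -/
lemma torGrading_eq_bot_iff (n i : ℕ) :
    P.torGrading ℒ (n + 1) i = ⊥ ↔ ∀ z : P.Chain L (n + 1), P.diff L n z = 0 →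
      tensorProj 𝒜 ℒ (freeHomog 𝒜 (P.deg (n + 1))) i z ∈ (P.diff L (n + 1)).range := by
  have hmem : ∀ z : P.cycles L (n + 1),
      (QuotientAddGroup.mk' ((P.diff L (n + 1)).range.addSubgroupOf (P.cycles L (n + 1)))) z = 0
        ↔ (z : P.Chain L (n + 1)) ∈ (P.diff L (n + 1)).range := fun z =>
    (QuotientAddGroup.eq_zero_iff z).trans AddSubgroup.mem_addSubgroupOf
  rw [GradedFreeResolution.torGrading, AddSubgroup.map_eq_bot_iff, SetLike.le_def]
  constructor
  · intro h z hz
    have h1 : tensorProj 𝒜 ℒ (freeHomog 𝒜 (P.deg (n + 1))) i z ∈ P.cycles L (n + 1) := by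
      change P.diff L n _ = 0
      rw [← tensorProj_diff, hz, map_zero]
    exact (hmem ⟨_, h1⟩).1 (h (AddSubgroup.mem_addSubgroupOf.2
      (tensorProj_mem_chainGrading 𝒜 ℒ P (n + 1) i z)))
  · intro h z hz
    refine (hmem z).2 ?_
    rw [← tensorProj_of_mem_chainGrading 𝒜 ℒ P (n + 1) i z (AddSubgroup.mem_addSubgroupOf.1 hz)]
    exact h z z.2

lemma BalTensor.map_map {S : Type u} [Ring S] {L L' L'' W W' W'' : Type*} [AddCommGroup L]
    [Module Sᵐᵒᵖ L] [AddCommGroup L'] [Module Sᵐᵒᵖ L'] [AddCommGroup L''] [Module Sᵐᵒᵖ L'']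
    [AddCommGroup W] [Module S W] [AddCommGroup W'] [Module S W'] [AddCommGroup W''] [Module S W'']
    (φ : L →ₗ[Sᵐᵒᵖ] L') (φ' : L' →ₗ[Sᵐᵒᵖ] L'') (ψ : W →ₗ[S] W') (ψ' : W' →ₗ[S] W'')
    (z : BalTensor S L W) :
    BalTensor.map φ' ψ' (BalTensor.map φ ψ z) = BalTensor.map (φ' ∘ₗ φ) (ψ' ∘ₗ ψ) z := by
  induction z using BalTensor.induction_on with
  | zero => simp
  | add a b ha hb => simp only [map_add, ha, hb]
  | tmul l m => rfl

lemma BalTensor.map_comm {S : Type u} [Ring S] {L L' W W' : Type*} [AddCommGroup L]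
    [Module Sᵐᵒᵖ L] [AddCommGroup L'] [Module Sᵐᵒᵖ L'] [AddCommGroup W] [Module S W]
    [AddCommGroup W'] [Module S W'] (φ : L →ₗ[Sᵐᵒᵖ] L') (ψ : W →ₗ[S] W') (z : BalTensor S L W) :
    BalTensor.map φ LinearMap.id (BalTensor.map LinearMap.id ψ z)
      = BalTensor.map LinearMap.id ψ (BalTensor.map φ LinearMap.id z) := by
  rw [BalTensor.map_map, BalTensor.map_map]
  rfl

lemma BalTensor.map_zero_left {S : Type u} [Ring S] {L L' W W' : Type*} [AddCommGroup L]
    [Module Sᵐᵒᵖ L] [AddCommGroup L'] [Module Sᵐᵒᵖ L'] [AddCommGroup W] [Module S W]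
    [AddCommGroup W'] [Module S W'] (ψ : W →ₗ[S] W') (z : BalTensor S L W) :
    BalTensor.map (0 : L →ₗ[Sᵐᵒᵖ] L') ψ z = 0 := by
  induction z using BalTensor.induction_on with
  | zero => simp
  | add a b ha hb => simp only [map_add, ha, hb, add_zero]
  | tmul l m => simp [BalTensor.zero_tmul]

lemma BalTensor.map_zero_right {S : Type u} [Ring S] {L L' W W' : Type*} [AddCommGroup L]
    [Module Sᵐᵒᵖ L] [AddCommGroup L'] [Module Sᵐᵒᵖ L'] [AddCommGroup W] [Module S W]
    [AddCommGroup W'] [Module S W'] (φ : L →ₗ[Sᵐᵒᵖ] L') (z : BalTensor S L W) :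
    BalTensor.map φ (0 : W →ₗ[S] W') z = 0 := by
  induction z using BalTensor.induction_on with
  | zero => simp
  | add a b ha hb => simp only [map_add, ha, hb, add_zero]
  | tmul l m => simp [BalTensor.tmul_zero]

/-! ### Tensoring with free modules, and the double complex. -/

lemma exact_map_free_left {X : Type*} {W₁ W₂ W₃ : Type*} [AddCommGroup W₁] [Module A W₁]
    [AddCommGroup W₂] [Module A W₂] [AddCommGroup W₃] [Module A W₃] (φ : W₁ →ₗ[A] W₂)
    (ψ : W₂ →ₗ[A] W₃) (h : Function.Exact φ ψ) :
    Function.Exact (BalTensor.map (LinearMap.id : (X →₀ Aᵐᵒᵖ) →ₗ[Aᵐᵒᵖ] _) φ)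
      (BalTensor.map (LinearMap.id : (X →₀ Aᵐᵒᵖ) →ₗ[Aᵐᵒᵖ] _) ψ) := by
  intro z
  refine ⟨fun hz => freeTensor_exact φ ψ (fun w => (h w).1) z hz, ?_⟩
  rintro ⟨z, rfl⟩
  rw [BalTensor.map_map, h.linearMap_comp_eq_zero, BalTensor.map_zero_right]

/-- Free left modules have split relations, so the flatness criterion applies with ρ = id. -/
lemma exact_map_free_right {X : Type*} {B₁ B₂ B₃ : Type*} [AddCommGroup B₁] [Module Aᵐᵒᵖ B₁]
    [AddCommGroup B₂] [Module Aᵐᵒᵖ B₂] [AddCommGroup B₃] [Module Aᵐᵒᵖ B₃] (φ : B₁ →ₗ[Aᵐᵒᵖ] B₂)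
    (ψ : B₂ →ₗ[Aᵐᵒᵖ] B₃) (h : Function.Exact φ ψ) :
    Function.Exact (BalTensor.map φ (LinearMap.id : (X →₀ A) →ₗ[A] _))
      (BalTensor.map ψ (LinearMap.id : (X →₀ A) →ₗ[A] _)) := by
  intro z
  constructor
  · intro hz
    have := (hasSplitRelations_finsupp (S := A) X).exact φ ψ LinearMap.id (fun b => (h b).1) z hz
    have e := DFunLike.congr_fun (BalTensor.hom_ext (S := A)
      (f := BalTensor.map (LinearMap.id : B₂ →ₗ[Aᵐᵒᵖ] B₂) (LinearMap.id : (X →₀ A) →ₗ[A] _))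
      (g := AddMonoidHom.id _) fun m n => rfl) z
    rwa [e] at this
  · rintro ⟨z, rfl⟩
    rw [BalTensor.map_map, h.linearMap_comp_eq_zero, BalTensor.map_zero_left]

variable (ℳ) in
/-- `Tor` may be computed by resolving either of the two modules. -/
theorem torGrading_eq_bot_iff_right [DirectSum.Decomposition ℳ] [SetLike.GradedSMul 𝒜 ℳ]
    (Q : FreeResolution (opGrading 𝒜) L ℒ) (n i : ℕ) :
    P.torGrading ℒ (n + 1) i = ⊥ ↔ ∀ z : BalTensor A (Q.gen (n + 1) →₀ Aᵐᵒᵖ) M,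
      BalTensor.map (Q.d n) LinearMap.id z = 0 →
        tensorProj 𝒜 (freeHomog (opGrading 𝒜) (Q.deg (n + 1))) ℳ i z
          ∈ (BalTensor.map (Q.d (n + 1)) (LinearMap.id : M →ₗ[A] M)).range := by
  rw [torGrading_eq_bot_iff]
  -- The double complex Q_p ⊗_A P_q. Its rows and columns are exact since P_q and Q_p are free; it
  -- is augmented by L ⊗_A P on one side and Q ⊗_A M on the other.
  let C : ℕ → ℕ → Type _ := fun p q => BalTensor A (Q.gen p →₀ Aᵐᵒᵖ) (P.gen q →₀ A)
  let dh : ∀ p q, C (p + 1) q →+ C p q := fun p q => BalTensor.map (Q.d p) LinearMap.id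
  let dv : ∀ p q, C p (q + 1) →+ C p q := fun p q => BalTensor.map LinearMap.id (P.d q)
  let eh : ∀ q, C 0 q →+ P.Chain L q := fun q => BalTensor.map Q.aug LinearMap.id
  let ev : ∀ p, C p 0 →+ BalTensor A (Q.gen p →₀ Aᵐᵒᵖ) M := fun p =>
    BalTensor.map LinearMap.id P.aug
  let π : ℕ → ∀ p q, C p q →+ C p q := fun i p q =>
    tensorProj 𝒜 (freeHomog (opGrading 𝒜) (Q.deg p)) (freeHomog 𝒜 (P.deg q)) i
  let πX : ∀ q, P.Chain L q →+ P.Chain L q := fun q =>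
    tensorProj 𝒜 ℒ (freeHomog 𝒜 (P.deg q)) i
  let πY : ∀ p, BalTensor A (Q.gen p →₀ Aᵐᵒᵖ) M →+ BalTensor A (Q.gen p →₀ Aᵐᵒᵖ) M := fun p =>
    tensorProj 𝒜 (freeHomog (opGrading 𝒜) (Q.deg p)) ℳ i
  have eh_surj : ∀ q, Function.Surjective (eh q) := fun q =>
    BalTensor.map_surjective _ _ Q.aug_surjective Function.surjective_id
  have ev_surj : ∀ p, Function.Surjective (ev p) := fun p =>
    BalTensor.map_surjective _ _ Function.surjective_id P.aug_surjective
  have eh_exact : ∀ q, Function.Exact (dh 0 q) (eh q) := fun q =>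
    exact_map_free_right _ _ Q.exact_zero
  have ev_exact : ∀ p, Function.Exact (dv p 0) (ev p) := fun p =>
    exact_map_free_left _ _ P.exact_zero
  have dh_exact : ∀ p q, Function.Exact (dh (p + 1) q) (dh p q) := fun p q =>
    exact_map_free_right _ _ (Q.exact_succ p)
  have dv_exact : ∀ p q, Function.Exact (dv p (q + 1)) (dv p q) := fun p q =>
    exact_map_free_left _ _ (P.exact_succ q)
  have comm : ∀ p q z, dh p q (dv (p + 1) q z) = dv p q (dh p (q + 1) z) := fun p q z =>
    BalTensor.map_comm (Q.d p) (P.d q) z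
  have eh_dv : ∀ q z, eh q (dv 0 q z) = P.diff L q (eh (q + 1) z) := fun q z =>
    BalTensor.map_comm Q.aug (P.d q) z
  have ev_dh : ∀ p z, ev p (dh p 0 z)
      = BalTensor.map (Q.d p) (LinearMap.id : M →ₗ[A] M) (ev (p + 1) z) := fun p z =>
    (BalTensor.map_comm (Q.d p) P.aug z).symm
  have π_dh : ∀ p q z, π i p q (dh p q z) = dh p q (π i (p + 1) q z) := fun p q z =>
    map_tensorProj 𝒜 _ _ _ _ (Q.d p) (Q.d_homog p) LinearMap.id (fun _ _ h => h) i z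
  have π_dv : ∀ p q z, π i p q (dv p q z) = dv p q (π i p (q + 1) z) := fun p q z =>
    map_tensorProj 𝒜 _ _ _ _ LinearMap.id (fun _ _ h => h) (P.d q) (P.d_homog q) i z
  have π_eh : ∀ q z, πX q (eh q z) = eh q (π i 0 q z) := fun q z =>
    map_tensorProj 𝒜 _ _ _ _ Q.aug Q.aug_homog LinearMap.id (fun _ _ h => h) i z
  have π_ev : ∀ p z, πY p (ev p z) = ev p (π i p 0 z) := fun p z =>
    map_tensorProj 𝒜 _ _ _ _ LinearMap.id (fun _ _ h => h) P.aug P.aug_homog i z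
  constructor
  · intro h
    -- The same chase in the transposed double complex.
    exact staircase (C := fun p q => C q p) (fun p q => dv q p) (fun p q => dh q p)
      (fun p q z => (comm q p z).symm) (fun p => BalTensor.map (Q.d p) LinearMap.id) ev ev_dh
      (P.diff L) eh eh_dv ev_surj eh_surj ev_exact eh_exact (fun p q => dv_exact q p)
      (fun p q => dh_exact q p) (fun p q => π i q p) πY πX (fun p q => π_dv q p)
      (fun p q => π_dh q p) π_ev π_eh n h
  · intro h
    exact staircase dh dv comm (P.diff L) eh eh_dv
      (fun p => BalTensor.map (Q.d p) LinearMap.id) ev ev_dh eh_surj ev_surj eh_exact ev_exact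
      dh_exact dv_exact (π i) πX πY π_dh π_dv π_eh π_ev n h

end Balance

/-! ### Base change of complexes of free modules -/

section FreeBaseChange

variable {S : Type u} {T : Type v} [Ring S] [Ring T] (g : S →+* T)

/-- The base change along `g : S → T` of a linear map between free `S`-modules. -/
def freeBaseChange {X : Type x} {Y : Type y} (d : (X →₀ S) →ₗ[S] (Y →₀ S)) :
    (X →₀ T) →ₗ[T] (Y →₀ T) :=
  Finsupp.linearCombination T fun x => Finsupp.mapRange g (map_zero g) (d (Finsupp.single x 1))

lemma mapRange_smul_ringHom {X : Type x} (s : S) (z : X →₀ S) :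
    Finsupp.mapRange g (map_zero g) (s • z) = g s • Finsupp.mapRange g (map_zero g) z := by
  ext x
  simp

lemma freeBaseChange_mapRange {X : Type x} {Y : Type y} (d : (X →₀ S) →ₗ[S] (Y →₀ S))
    (z : X →₀ S) : freeBaseChange g d (Finsupp.mapRange g (map_zero g) z)
      = Finsupp.mapRange g (map_zero g) (d z) := by
  induction z using Finsupp.induction_linear with
  | zero => simp
  | add a b ha hb => simp only [Finsupp.mapRange_add (map_add g), map_add, ha, hb]
  | single x s =>
    have : Finsupp.single x s = s • Finsupp.single x (1 : S) := by simp
    rw [Finsupp.mapRange_single, freeBaseChange, Finsupp.linearCombination_single, this, map_smul,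
      mapRange_smul_ringHom]

/-- Needed to compare the two composites A → A' → k' and A → k → k'. -/
lemma freeBaseChange_freeBaseChange {U : Type w} [Ring U] (g' : T →+* U) {X : Type x} {Y : Type y}
    (d : (X →₀ S) →ₗ[S] (Y →₀ S)) :
    freeBaseChange g' (freeBaseChange g d) = freeBaseChange (g'.comp g) d := by
  refine Finsupp.lhom_ext' fun x => LinearMap.ext_ring ?_
  simp only [freeBaseChange, LinearMap.comp_apply, Finsupp.lsingle_apply,
    Finsupp.linearCombination_single, one_smul]
  ext y
  simp

lemma single_one_mem_freeHomog {𝒮 : ℕ → AddSubgroup S} [SetLike.GradedMonoid 𝒮] {X : Type x}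
    (deg : X → ℕ) (x : X) : Finsupp.single x (1 : S) ∈ freeHomog 𝒮 deg (deg x) := by
  refine mem_freeHomog.2 fun y => ?_
  by_cases h : x = y
  · subst h
    rw [if_pos le_rfl, Nat.sub_self, Finsupp.single_eq_same]
    exact SetLike.one_mem_graded 𝒮
  · rw [Finsupp.single_eq_of_ne' h]
    exact zero_mem _

lemma freeBaseChange_mem {𝒮 : ℕ → AddSubgroup S} {𝒯 : ℕ → AddSubgroup T} [GradedRing 𝒮]
    [GradedRing 𝒯] (hg : ∀ i, ∀ s ∈ 𝒮 i, g s ∈ 𝒯 i) {X : Type x} {Y : Type y} (deg : X → ℕ)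
    (deg' : Y → ℕ) (d : (X →₀ S) →ₗ[S] (Y →₀ S))
    (hd : ∀ i, ∀ z ∈ freeHomog 𝒮 deg i, d z ∈ freeHomog 𝒮 deg' i) (i : ℕ) (z : X →₀ T)
    (hz : z ∈ freeHomog 𝒯 deg i) : freeBaseChange g d z ∈ freeHomog 𝒯 deg' i := by
  refine linearCombination_mem 𝒯 deg (freeHomog 𝒯 deg') _ (fun x => ?_) i z hz
  have h1 : Finsupp.single x (1 : S) ∈ freeHomog 𝒮 deg (deg x) := single_one_mem_freeHomog deg x
  refine mem_freeHomog.2 fun y => ?_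
  have h2 := mem_freeHomog.1 (hd _ _ h1) y
  rw [Finsupp.mapRange_apply]
  split_ifs at h2 ⊢
  · exact hg _ _ h2
  · rw [AddSubgroup.mem_bot] at h2 ⊢
    rw [h2, map_zero]

/-- The projection of a free module onto the part spanned by the basis elements of degree `i`. -/
def degreePart (S : Type u) [Ring S] {X : Type x} (deg : X → ℕ) (i : ℕ) : (X →₀ S) →ₗ[S] (X →₀ S) :=
  Finsupp.linearCombination S fun x => if deg x = i then Finsupp.single x 1 else 0

lemma degreePart_single {X : Type x} (deg : X → ℕ) (i : ℕ) (y : X) (s : S) :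
    degreePart S deg i (Finsupp.single y s) = if deg y = i then Finsupp.single y s else 0 := by
  rw [degreePart, Finsupp.linearCombination_single]
  split_ifs <;> simp

lemma freeBaseChange_degreePart {X : Type x} (deg : X → ℕ) (i : ℕ) :
    freeBaseChange g (degreePart S deg i) = degreePart T deg i := by
  refine Finsupp.lhom_ext' fun x => LinearMap.ext_ring ?_
  simp only [freeBaseChange, LinearMap.comp_apply, Finsupp.lsingle_apply,
    Finsupp.linearCombination_single, one_smul, degreePart_single]
  split_ifs <;> simp

/-! ### Flat base change between free modules. -/

variable {k : Type*} [Ring k] {W : Type*} [AddCommGroup W] [Module k W]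

/-- Transport of `HasSplitRelations.exact` to a sequence identified with the tensored one; lifting
the cycle uses surjectivity in the middle, and recognizing it as a cycle uses injectivity at the
end. -/
lemma HasSplitRelations.exact_of_comparison (hW : HasSplitRelations k W)
    {B₁ B₂ B₃ C₁ C₂ C₃ : Type*} [AddCommGroup B₁] [Module kᵐᵒᵖ B₁]
    [AddCommGroup B₂] [Module kᵐᵒᵖ B₂] [AddCommGroup B₃] [Module kᵐᵒᵖ B₃]
    [AddCommGroup C₁] [AddCommGroup C₂] [AddCommGroup C₃]
    (φ : B₁ →ₗ[kᵐᵒᵖ] B₂) (ψ : B₂ →ₗ[kᵐᵒᵖ] B₃) (ρ : B₂ →ₗ[kᵐᵒᵖ] B₂)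
    (φ' : C₁ →+ C₂) (ψ' : C₂ →+ C₃) (ρ' : C₂ →+ C₂)
    (τ₁ : BalTensor k B₁ W →+ C₁) (τ₂ : BalTensor k B₂ W →+ C₂) (τ₃ : BalTensor k B₃ W →+ C₃)
    (hφ : ∀ z, τ₂ (BalTensor.map φ LinearMap.id z) = φ' (τ₁ z))
    (hψ : ∀ z, τ₃ (BalTensor.map ψ LinearMap.id z) = ψ' (τ₂ z))
    (hρ : ∀ z, τ₂ (BalTensor.map ρ LinearMap.id z) = ρ' (τ₂ z))
    (h₂ : Function.Surjective τ₂) (h₃ : Function.Injective τ₃)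
    (h : ∀ b, ψ b = 0 → ρ b ∈ LinearMap.range φ) (c : C₂) (hc : ψ' c = 0) : ρ' c ∈ φ'.range := by
  obtain ⟨z, rfl⟩ := h₂ c
  obtain ⟨y, hy⟩ := hW.exact φ ψ ρ h z (h₃ (by rw [hψ, hc, map_zero]))
  exact ⟨τ₁ y, by rw [← hφ, hy, hρ]⟩

variable [Module kᵐᵒᵖ S] (e : W → T) (τ : BalTensor k S W ≃+ T)

/-- If `T` is obtained from `S` by tensoring with `W`, then so are the free modules. -/
def freeComparison (X : Type x) : BalTensor k (X →₀ S) W ≃+ (X →₀ T) :=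
  (finsuppTensor X S W).trans (Finsupp.mapRange.addEquiv τ)

variable {g e τ}

/-- The factor e w stands on the left because S and T will be opposite rings, in which it means
multiplication on the right. The element w thus enters as a scalar of T, which T-linear maps
respect. -/
lemma freeComparison_tmul (hτ : ∀ s w, τ (BalTensor.tmul k s w) = e w * g s) {X : Type x}
    (z : X →₀ S) (w : W) : freeComparison τ X (BalTensor.tmul k z w)
      = e w • Finsupp.mapRange g (map_zero g) z := by
  induction z using Finsupp.induction_linear with
  | zero => simp [BalTensor.zero_tmul]
  | add a b ha hb =>
    rw [BalTensor.add_tmul, map_add, ha, hb, Finsupp.mapRange_add (map_add g), smul_add]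
  | single x s =>
    rw [freeComparison, AddEquiv.trans_apply, finsuppTensor_tmul_single]
    simp [hτ]

variable [IsScalarTower kᵐᵒᵖ S S]

lemma freeComparison_map (hτ : ∀ s w, τ (BalTensor.tmul k s w) = e w * g s) {X : Type x}
    {Y : Type y} (d : (X →₀ S) →ₗ[S] (Y →₀ S)) (z : BalTensor k (X →₀ S) W) :
    freeComparison τ Y (BalTensor.map (d.restrictScalars kᵐᵒᵖ) LinearMap.id z)
      = freeBaseChange g d (freeComparison τ X z) := by
  induction z using BalTensor.induction_on with
  | zero => simp
  | add a b ha hb => simp only [map_add, ha, hb]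
  | tmul z w =>
    rw [BalTensor.map_tmul, freeComparison_tmul hτ, freeComparison_tmul hτ, map_smul,
      freeBaseChange_mapRange]
    rfl

/-- Flatness in the form used below: ρ = id shows that a base-changed resolution is exact, and ρ =
`degreePart` transfers the vanishing of one graded component of homology. -/
lemma freeBaseChange_exact (hW : HasSplitRelations k W)
    (hτ : ∀ s w, τ (BalTensor.tmul k s w) = e w * g s) {X₁ X₂ X₃ : Type*}
    (φ : (X₁ →₀ S) →ₗ[S] (X₂ →₀ S)) (ψ : (X₂ →₀ S) →ₗ[S] (X₃ →₀ S))
    (ρ : (X₂ →₀ S) →ₗ[S] (X₂ →₀ S)) (h : ∀ z, ψ z = 0 → ρ z ∈ LinearMap.range φ) (z : X₂ →₀ T)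
    (hz : freeBaseChange g ψ z = 0) :
    freeBaseChange g ρ z ∈ LinearMap.range (freeBaseChange g φ) :=
  hW.exact_of_comparison (φ.restrictScalars kᵐᵒᵖ) (ψ.restrictScalars kᵐᵒᵖ)
    (ρ.restrictScalars kᵐᵒᵖ) (freeBaseChange g φ).toAddMonoidHom
    (freeBaseChange g ψ).toAddMonoidHom (freeBaseChange g ρ).toAddMonoidHom
    (freeComparison τ X₁).toAddMonoidHom (freeComparison τ X₂).toAddMonoidHom
    (freeComparison τ X₃).toAddMonoidHom (freeComparison_map hτ φ) (freeComparison_map hτ ψ)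
    (freeComparison_map hτ ρ) (freeComparison τ X₂).surjective (freeComparison τ X₃).injective h z hz

lemma freeBaseChange_comp_eq_zero {X₁ X₂ X₃ : Type*} (φ : (X₁ →₀ S) →ₗ[S] (X₂ →₀ S))
    (ψ : (X₂ →₀ S) →ₗ[S] (X₃ →₀ S)) (h : ∀ z, ψ (φ z) = 0) (z : X₁ →₀ T) :
    freeBaseChange g ψ (freeBaseChange g φ z) = 0 := by
  induction z using Finsupp.induction_linear with
  | zero => simp
  | add a b ha hb => rw [map_add, map_add, ha, hb, add_zero]
  | single x t =>
    have : Finsupp.single x t = t • Finsupp.mapRange g (map_zero g) (Finsupp.single x 1) := by simp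
    rw [this, map_smul, map_smul, freeBaseChange_mapRange, freeBaseChange_mapRange, h]
    simp

/-! ### Base change of graded-free resolutions. -/

variable {𝒮 : ℕ → AddSubgroup S} {𝒯 : ℕ → AddSubgroup T} [GradedRing 𝒮] [GradedRing 𝒯]
  {M : Type*} [AddCommGroup M] [Module S M] {ℳ : ℕ → AddSubgroup M} [Module kᵐᵒᵖ M]
  [IsScalarTower kᵐᵒᵖ S M] {M' : Type*} [AddCommGroup M'] [Module T M'] {ℳ' : ℕ → AddSubgroup M'}
  [SetLike.GradedSMul 𝒯 ℳ']

/-- The base change along `S → T` of a graded-free resolution of `M`, if `T` and `M'` are obtained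
from `S` and `M` by tensoring with the same flat module. -/
def FreeResolution.baseChange (Q : FreeResolution 𝒮 M ℳ) (hW : HasSplitRelations k W)
    (hτ : ∀ s w, τ (BalTensor.tmul k s w) = e w * g s) (hg : ∀ i, ∀ s ∈ 𝒮 i, g s ∈ 𝒯 i)
    (m : M →+ M') (hm : ∀ (s : S) x, m (s • x) = g s • m x) (hm' : ∀ i, ∀ x ∈ ℳ i, m x ∈ ℳ' i)
    (τM : BalTensor k M W ≃+ M') (hτM : ∀ x w, τM (BalTensor.tmul k x w) = e w • m x) :
    FreeResolution 𝒯 M' ℳ' := by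
  let aug : (Q.gen 0 →₀ T) →ₗ[T] M' :=
    Finsupp.linearCombination T fun x => m (Q.aug (Finsupp.single x 1))
  have haug : ∀ z, aug (Finsupp.mapRange g (map_zero g) z) = m (Q.aug z) := by
    intro z
    induction z using Finsupp.induction_linear with
    | zero => simp
    | add a b ha hb => simp only [Finsupp.mapRange_add (map_add g), map_add, ha, hb]
    | single x s =>
      have : Finsupp.single x s = s • Finsupp.single x (1 : S) := by simp
      rw [Finsupp.mapRange_single, this, map_smul, hm]
      exact Finsupp.linearCombination_single _ _ _
  -- Under the comparison isomorphisms the new augmentation is the old one tensored with W;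
  -- surjectivity and exactness in degree 0 follow from this.
  have haug' : ∀ z : BalTensor k (Q.gen 0 →₀ S) W,
      τM (BalTensor.map (Q.aug.restrictScalars kᵐᵒᵖ) LinearMap.id z)
        = aug (freeComparison τ (Q.gen 0) z) := by
    intro z
    induction z using BalTensor.induction_on with
    | zero => simp
    | add a b ha hb => simp only [map_add, ha, hb]
    | tmul z w =>
      rw [BalTensor.map_tmul, freeComparison_tmul hτ, map_smul, haug, hτM]
      rfl
  exact
    { gen := Q.gen
      deg := Q.deg
      d n := freeBaseChange g (Q.d n)
      aug := aug
      d_homog n := freeBaseChange_mem g hg _ _ _ (Q.d_homog n)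
      aug_homog i z hz := linearCombination_mem 𝒯 (Q.deg 0) ℳ' _
        (fun x => hm' _ _ (Q.aug_homog _ _ (single_one_mem_freeHomog (Q.deg 0) x))) i z hz
      aug_surjective := by
        intro y
        obtain ⟨z, rfl⟩ := τM.surjective y
        obtain ⟨z, rfl⟩ := BalTensor.map_surjective (Q.aug.restrictScalars kᵐᵒᵖ)
          (LinearMap.id : W →ₗ[k] W) Q.aug_surjective Function.surjective_id z
        exact ⟨_, (haug' z).symm⟩
      exact_zero := by
        intro z
        constructor
        · intro hz
          exact hW.exact_of_comparison ((Q.d 0).restrictScalars kᵐᵒᵖ)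
            (Q.aug.restrictScalars kᵐᵒᵖ) LinearMap.id (freeBaseChange g (Q.d 0)).toAddMonoidHom
            aug.toAddMonoidHom (AddMonoidHom.id _) (freeComparison τ _).toAddMonoidHom
            (freeComparison τ _).toAddMonoidHom τM.toAddMonoidHom (freeComparison_map hτ _)
            haug' (fun z => by
              have := DFunLike.congr_fun (BalTensor.hom_ext (S := k)
                (f := BalTensor.map (LinearMap.id : (Q.gen 0 →₀ S) →ₗ[kᵐᵒᵖ] _)
                  (LinearMap.id : W →ₗ[k] _))
                (g := AddMonoidHom.id _) fun m n => rfl) z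
              rw [this]
              rfl)
            (freeComparison τ _).surjective τM.injective (fun b => (Q.exact_zero b).1) z hz
        · rintro ⟨z, rfl⟩
          induction z using Finsupp.induction_linear with
          | zero => simp
          | add a b ha hb => rw [map_add, map_add, ha, hb, add_zero]
          | single x t =>
            have : Finsupp.single x t
                = t • Finsupp.mapRange g (map_zero g) (Finsupp.single x 1) := by simp
            rw [this, map_smul, map_smul, freeBaseChange_mapRange, haug,
              Q.exact_zero.apply_apply_eq_zero]
            simp
      exact_succ n := by
        intro z
        constructor
        · intro hz
          have h := freeBaseChange_exact hW hτ (Q.d (n + 1)) (Q.d n) LinearMap.id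
            (fun b => (Q.exact_succ n b).1) z hz
          have e : freeBaseChange g (LinearMap.id : (Q.gen (n + 1) →₀ S) →ₗ[S] _)
              = LinearMap.id := by
            refine Finsupp.lhom_ext' fun x => LinearMap.ext_ring ?_
            simp [freeBaseChange]
          rwa [e] at h
        · rintro ⟨z, rfl⟩
          exact freeBaseChange_comp_eq_zero _ _ (Q.exact_succ n).apply_apply_eq_zero z }

end FreeBaseChange

/-! ### `Tor` over an augmented graded ring -/

section AugmentedTor

instance (M : Type v) [AddCommGroup M] : DirectSum.Decomposition (conc M) :=
  (conc_isInternal M).chooseDecomposition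

lemma mem_conc_zero {M : Type v} [AddCommGroup M] (z : M) : z ∈ conc M 0 := by simp [conc]

variable {A : Type u} [Ring A] {k : Type v} [Ring k] (ε : A →+* k)

/-- The isomorphism between `(⨁ A) ⊗_A k` and `⨁ k`, for a free right `A`-module. -/
def augTensor (X : Type x) : BalTensor A (X →₀ Aᵐᵒᵖ) (Pull ε) ≃+ (X →₀ kᵐᵒᵖ) :=
  (freeTensor X (Pull ε)).trans
    (Finsupp.mapRange.addEquiv ((Pull.of ε).symm.trans MulOpposite.opAddEquiv))

variable {ε}

lemma augTensor_tmul_single {X : Type x} (x : X) (a : Aᵐᵒᵖ) (c : k) :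
    augTensor ε X (BalTensor.tmul A (Finsupp.single x a) (Pull.of ε c))
      = Finsupp.single x (MulOpposite.op c * ε.op a) := by
  rw [augTensor, AddEquiv.trans_apply, freeTensor_tmul_single, Pull.smul_of]
  simp

lemma augTensor_tmul {X : Type x} (z : X →₀ Aᵐᵒᵖ) (c : k) :
    augTensor ε X (BalTensor.tmul A z (Pull.of ε c))
      = MulOpposite.op c • Finsupp.mapRange ε.op (map_zero ε.op) z := by
  induction z using Finsupp.induction_linear with
  | zero => simp [BalTensor.zero_tmul]
  | add a b ha hb =>
    rw [BalTensor.add_tmul, map_add, ha, hb, Finsupp.mapRange_add (map_add ε.op), smul_add]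
  | single x s =>
    rw [augTensor_tmul_single, Finsupp.mapRange_single, Finsupp.smul_single, smul_eq_mul]

/-- So Q ⊗_A k is the base change of Q along ε, and both descents in the main argument are instances
of `freeBaseChange`. -/
lemma augTensor_map {X : Type x} {Y : Type y} (d : (X →₀ Aᵐᵒᵖ) →ₗ[Aᵐᵒᵖ] (Y →₀ Aᵐᵒᵖ))
    (z : BalTensor A (X →₀ Aᵐᵒᵖ) (Pull ε)) :
    augTensor ε Y (BalTensor.map d LinearMap.id z)
      = freeBaseChange ε.op d (augTensor ε X z) := by
  induction z using BalTensor.induction_on with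
  | zero => simp
  | add a b ha hb => simp only [map_add, ha, hb]
  | tmul z c =>
    obtain ⟨c, rfl⟩ := (Pull.of ε).surjective c
    rw [BalTensor.map_tmul, LinearMap.id_apply, augTensor_tmul, augTensor_tmul, map_smul,
      freeBaseChange_mapRange]

variable {𝒜 : ℕ → AddSubgroup A}

lemma conc_gradedSMul (hε : ∀ i ≠ 0, ∀ a ∈ 𝒜 i, ε a = 0) : SetLike.GradedSMul 𝒜 (conc (Pull ε)) where
  smul_mem {i j a m} ha hm := by
    by_cases hj : j = 0
    · by_cases hi : i = 0
      · subst hi hj; exact mem_conc_zero _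
      · obtain ⟨m, rfl⟩ := (Pull.of ε).surjective m
        rw [Pull.smul_of, hε i hi a ha, zero_mul, map_zero]
        exact zero_mem _
    · simp only [conc, if_neg hj, AddSubgroup.mem_bot] at hm
      rw [hm, smul_zero]
      exact zero_mem _

lemma conc_gradedSMul_op (hε : ∀ i ≠ 0, ∀ a ∈ 𝒜 i, ε a = 0) :
    SetLike.GradedSMul (opGrading 𝒜) (conc (Pull ε)) where
  smul_mem {i j a m} ha hm := by
    by_cases hj : j = 0
    · by_cases hi : i = 0
      · subst hi hj; exact mem_conc_zero _
      · obtain ⟨m, rfl⟩ := (Pull.of ε).surjective m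
        have h : a • Pull.of ε m = Pull.of ε (m * ε a.unop) := Pull.op_smul_of ε a.unop m
        rw [h, hε i hi a.unop ha, mul_zero, map_zero]
        exact zero_mem _
    · simp only [conc, if_neg hj, AddSubgroup.mem_bot] at hm
      rw [hm, smul_zero]
      exact zero_mem _

variable [GradedRing 𝒜]

/-- Since ε kills homogeneous elements of nonzero degree and k sits in degree 0, the grading of Q
⊗_A k only sees the degrees of the basis elements. -/
lemma augTensor_tensorProj (hε : ∀ i ≠ 0, ∀ a ∈ 𝒜 i, ε a = 0)
    [SetLike.GradedSMul 𝒜 (conc (Pull ε))] {X : Type x} (deg : X → ℕ) (i : ℕ)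
    (z : BalTensor A (X →₀ Aᵐᵒᵖ) (Pull ε)) :
    augTensor ε X (tensorProj 𝒜 (freeHomog (opGrading 𝒜) deg) (conc (Pull ε)) i z)
      = degreePart kᵐᵒᵖ deg i (augTensor ε X z) := by
  induction z using BalTensor.induction_on with
  | zero => simp
  | add a b ha hb => simp only [map_add, ha, hb]
  | tmul z c =>
    obtain ⟨c, rfl⟩ := (Pull.of ε).surjective c
    induction z using Finsupp.induction_linear with
    | zero => simp [BalTensor.zero_tmul]
    | add a b ha hb => simp only [BalTensor.add_tmul, map_add, ha, hb]
    | single x a =>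
    induction a using DirectSum.Decomposition.inductionOn (opGrading 𝒜) with
    | zero => simp [BalTensor.zero_tmul]
    | add a b ha hb => simp only [Finsupp.single_add, BalTensor.add_tmul, map_add, ha, hb]
    | @homogeneous j a =>
      have h1 : Finsupp.single x (a : Aᵐᵒᵖ) ∈ freeHomog (opGrading 𝒜) deg (j + deg x) := by
        have := SetLike.GradedSMul.smul_mem (A := opGrading 𝒜) a.2
          (single_one_mem_freeHomog (𝒮 := opGrading 𝒜) deg x)
        simpa using this
      rw [tensorProj_tmul_of_mem 𝒜 i h1 (mem_conc_zero (Pull.of ε c)), augTensor_tmul_single,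
        degreePart_single]
      -- If a has degree 0, the tensor has the degree of its basis element; otherwise it is itself 0
      -- and both sides vanish.
      by_cases hj : j = 0
      · subst hj
        rw [zero_add, add_zero]
        split_ifs
        · rw [augTensor_tmul_single]
        · rw [map_zero]
      · have h2 : ε.op (a : Aᵐᵒᵖ) = 0 := congrArg MulOpposite.op (hε j hj _ a.2)
        have h3 := augTensor_tmul_single x (a : Aᵐᵒᵖ) c (ε := ε)
        rw [h2, mul_zero, Finsupp.single_zero] at h3 ⊢
        simp only [ite_self]
        split_ifs
        · exact h3
        · rw [map_zero]

/-- The vanishing of a component of `Tor(L, k)` in terms of a resolution of `L` tensored with `k`. -/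
theorem torGrading_eq_bot_iff_degreePart (hε : ∀ i ≠ 0, ∀ a ∈ 𝒜 i, ε a = 0) {L : Type w}
    [AddCommGroup L] [Module Aᵐᵒᵖ L] {ℒ : ℕ → AddSubgroup L} [DirectSum.Decomposition ℒ]
    [SetLike.GradedSMul (opGrading 𝒜) ℒ] (P : GradedFreeResolution 𝒜 (Pull ε) (conc (Pull ε)))
    (Q : FreeResolution (opGrading 𝒜) L ℒ) (n i : ℕ) :
    P.torGrading ℒ (n + 1) i = ⊥ ↔ ∀ z : Q.gen (n + 1) →₀ kᵐᵒᵖ,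
      freeBaseChange ε.op (Q.d n) z = 0 → degreePart kᵐᵒᵖ (Q.deg (n + 1)) i z
        ∈ LinearMap.range (freeBaseChange ε.op (Q.d (n + 1))) := by
  have := conc_gradedSMul hε
  rw [torGrading_eq_bot_iff_right 𝒜 ℒ (conc (Pull ε)) P Q n i]
  constructor
  · intro h z hz
    obtain ⟨z, rfl⟩ := (augTensor ε _).surjective z
    obtain ⟨y, hy⟩ := h z ((augTensor ε _).injective (by rw [augTensor_map, hz, map_zero]))
    exact ⟨augTensor ε _ y, by rw [← augTensor_map, hy, augTensor_tensorProj hε]⟩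
  · intro h z hz
    obtain ⟨y, hy⟩ := h (augTensor ε _ z) (by rw [← augTensor_map, hz, map_zero])
    obtain ⟨y, rfl⟩ := (augTensor ε _).surjective y
    exact ⟨y, (augTensor ε _).injective (by rw [augTensor_map, hy, augTensor_tensorProj hε])⟩

end AugmentedTor

/-! ### Koszulity of `A'` -/

section Main

variable {k : Type u} {k' : Type v} [Ring k] [Ring k'] (f : k →+* k')
  {V : Type w} [AddCommGroup V] [Module k V] [Module kᵐᵒᵖ V] [Module k' V]
  [SMulCommClass k' kᵐᵒᵖ V] (hext : ∀ (a : k) (v : V), f a • v = a • v)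
  {N : ℕ} {R : AddSubgroup (TensorRing k V)}

lemma degZero_tensorBaseChange (t : TensorRing k V) :
    TensorRing.degZero (tensorBaseChange f hext t) = f (TensorRing.degZero t) := by
  induction t using TensorRing.induction with
  | scalar a => simp [tensorBaseChange_scalar]
  | ι v => simp [tensorBaseChange_ι]
  | add a b ha hb => simp only [map_add, ha, hb]
  | mul a b ha hb => simp only [map_mul, ha, hb]

/-- This compatibility makes k → k' semilinear over A → A', so that k'_{A'} is the base change of
k_A. -/
lemma aug_algMap (hR : IsHomogRel N R) (hR' : IsHomogRel N (relBaseChange f hext R))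
    (a : HomogAlg R) :
    HomogAlg.aug hR' (algMap f hext R a) = f (HomogAlg.aug hR a) := by
  obtain ⟨t, rfl⟩ := HomogAlg.mk_surjective R a
  exact degZero_tensorBaseChange f hext t

lemma algMap_mem (i : ℕ) (a : HomogAlg R) (ha : a ∈ HomogAlg.grading R i) :
    algMap f hext R a ∈ HomogAlg.grading (relBaseChange f hext R) i := by
  obtain ⟨t, ht, rfl⟩ := ha
  exact ⟨_, tensorBaseChange_mem f hext i t ht, rfl⟩

/-- The isomorphism `k ⊗_k k' ≃ k'`. -/
def scalarTensor {M : Type*} [AddCommGroup M] [Module kᵐᵒᵖ M] (σ : M ≃+ k)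
    (hσ : ∀ (s : k) x, σ (MulOpposite.op s • x) = σ x * s) {M' : Type*} [AddCommGroup M']
    (σ' : M' ≃+ k') : BalTensor k M (Pull f) ≃+ M' := by
  let θ : BalTensor k M (Pull f) →+ k' :=
    BalTensor.lift ((AddMonoidHom.mul (R := k')).comp (f.toAddMonoidHom.comp σ.toAddMonoidHom))
      (fun x s (c : k') => by
        change f (σ (MulOpposite.op s • x)) * c = f (σ x) * (f s * c)
        rw [hσ, map_mul, mul_assoc])
  refine AddEquiv.mk' ⟨fun z => σ'.symm (θ z),
    fun c => BalTensor.tmul k (σ.symm 1) (Pull.of f (σ' c)), fun z => ?_, fun c => ?_⟩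
    (map_add (σ'.symm.toAddMonoidHom.comp θ))
  · simp only [AddEquiv.apply_symm_apply]
    induction z using BalTensor.induction_on with
    | zero => rw [map_zero, map_zero, BalTensor.tmul_zero]
    | add a b ha hb => rw [map_add, map_add, BalTensor.tmul_add, ha, hb]
    | tmul x c =>
      obtain ⟨c, rfl⟩ := (Pull.of f).surjective c
      change BalTensor.tmul k (σ.symm 1) (Pull.of f (f (σ x) * c)) = _
      rw [← Pull.smul_of, ← BalTensor.smul_tmul]
      congr 1
      apply σ.injective
      rw [hσ, AddEquiv.apply_symm_apply, one_mul]
  · rw [AddEquiv.symm_apply_eq]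
    change f (σ (σ.symm 1)) * σ' c = σ' c
    rw [AddEquiv.apply_symm_apply, map_one, one_mul]

/-- The isomorphism `A ⊗_k k' ≃ A'`, between opposite rings. -/
def algTensorOp [Module kᵐᵒᵖ (HomogAlg R)ᵐᵒᵖ] (hs : ∀ (s : k) (a : HomogAlg R),
      MulOpposite.op s • MulOpposite.op a
        = MulOpposite.op (a * HomogAlg.mk R (TensorRing.scalar k V s)))
    (hb : Function.Bijective (algComparison f hext R)) :
    BalTensor k (HomogAlg R)ᵐᵒᵖ (Pull f) ≃+ (HomogAlg (relBaseChange f hext R))ᵐᵒᵖ := by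
  -- Both α and β are the identity of A; they pass between two presentations of the right k-module
  -- A.
  let α : Pull ((HomogAlg.mk R).comp (TensorRing.scalar k V)) →ₗ[kᵐᵒᵖ] (HomogAlg R)ᵐᵒᵖ :=
    { toFun := fun a => MulOpposite.op ((Pull.of _).symm a)
      map_add' := fun a b => rfl
      map_smul' := fun s a => (hs s.unop ((Pull.of _).symm a)).symm }
  let β : (HomogAlg R)ᵐᵒᵖ →ₗ[kᵐᵒᵖ] Pull ((HomogAlg.mk R).comp (TensorRing.scalar k V)) :=
    { toFun := fun a => Pull.of _ a.unop
      map_add' := fun a b => rfl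
      map_smul' := fun s a => congrArg MulOpposite.unop (hs s.unop a.unop) }
  let γ : BalTensor k (HomogAlg R)ᵐᵒᵖ (Pull f) ≃+ AlgTensor f R :=
    AddEquiv.mk' ⟨BalTensor.map β LinearMap.id, BalTensor.map α LinearMap.id,
      fun z => DFunLike.congr_fun (BalTensor.hom_ext
        (f := (BalTensor.map α LinearMap.id).comp (BalTensor.map β LinearMap.id))
        (g := AddMonoidHom.id _) fun _ _ => rfl) z,
      fun z => DFunLike.congr_fun (BalTensor.hom_ext
        (f := (BalTensor.map β LinearMap.id).comp (BalTensor.map α LinearMap.id))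
        (g := AddMonoidHom.id _) fun _ _ => rfl) z⟩
      (map_add (BalTensor.map β LinearMap.id))
  exact (γ.trans (AddEquiv.ofBijective _ hb)).trans MulOpposite.opAddEquiv

lemma algTensorOp_tmul [Module kᵐᵒᵖ (HomogAlg R)ᵐᵒᵖ] (hs : ∀ (s : k) (a : HomogAlg R),
      MulOpposite.op s • MulOpposite.op a
        = MulOpposite.op (a * HomogAlg.mk R (TensorRing.scalar k V s)))
    (hb : Function.Bijective (algComparison f hext R)) (a : (HomogAlg R)ᵐᵒᵖ) (c : Pull f) :
    algTensorOp f hext hs hb (BalTensor.tmul k a c)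
      = MulOpposite.op (algScalar f hext R ((Pull.of f).symm c)) * (algMap f hext R).op a := rfl

/-- A resolution Q of k_A yields the resolution Q' = Q ⊗_k k' of k'_{A'}, and Q' ⊗_{A'} k' = (Q ⊗_A
k) ⊗_k k'. Flatness of k' over k is used for each of the two steps. Basis degrees do not change, so
the jump map is the same for A and A'. -/
theorem isKoszul_relBaseChange (hk : IsVonNeumannRegular k) (hR : IsHomogRel N R)
    (hR' : IsHomogRel N (relBaseChange f hext R))
    (hb : Function.Bijective (algComparison f hext R)) (hA : IsKoszul hR) : IsKoszul hR' := by
  let _ := HomogAlg.gradedRing hR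
  let _ := HomogAlg.gradedRing hR'
  have hε := HomogAlg.aug_of_mem hR
  have hε' := HomogAlg.aug_of_mem hR'
  have := conc_gradedSMul_op hε
  have := conc_gradedSMul_op hε'
  -- The ring k acts on the right of A and of k_A through k → A; these are the right k-modules to be
  -- tensored with k'.
  let s : kᵐᵒᵖ →+* (HomogAlg R)ᵐᵒᵖ := ((HomogAlg.mk R).comp (TensorRing.scalar k V)).op
  let _ : Module kᵐᵒᵖ (HomogAlg R)ᵐᵒᵖ := Module.compHom _ s
  let _ : Module kᵐᵒᵖ (Pull (HomogAlg.aug hR)) := Module.compHom _ s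
  have : IsScalarTower kᵐᵒᵖ (HomogAlg R)ᵐᵒᵖ (HomogAlg R)ᵐᵒᵖ :=
    ⟨fun a b c => mul_assoc (s a) b c⟩
  have : IsScalarTower kᵐᵒᵖ (HomogAlg R)ᵐᵒᵖ (Pull (HomogAlg.aug hR)) :=
    ⟨fun a b c => mul_smul (s a) b c⟩
  have hW := hk.hasSplitRelations (Pull f)
  let Q := (standardResolution (opGrading (HomogAlg.grading R))
    (conc (Pull (HomogAlg.aug hR)))).toFreeResolution
  let σ := (Pull.of (HomogAlg.aug hR)).symm
  let σ' := (Pull.of (HomogAlg.aug hR')).symm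
  have hσ : ∀ (a : k) x, σ (MulOpposite.op a • x) = σ x * a := fun a x => by
    change σ x * HomogAlg.aug hR (HomogAlg.mk R (TensorRing.scalar k V a)) = _
    rw [HomogAlg.aug_mk, TensorRing.degZero_scalar]
  let m : Pull (HomogAlg.aug hR) →+ Pull (HomogAlg.aug hR') :=
    ((Pull.of _).toAddMonoidHom.comp f.toAddMonoidHom).comp σ.toAddMonoidHom
  have hm : ∀ (a : (HomogAlg R)ᵐᵒᵖ) x, m (a • x) = (algMap f hext R).op a • m x := fun a x => by
    change Pull.of _ (f (σ x * HomogAlg.aug hR a.unop))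
      = Pull.of _ (f (σ x) * HomogAlg.aug hR' (algMap f hext R a.unop))
    rw [aug_algMap f hext hR hR', map_mul]
  have hm' : ∀ i, ∀ x ∈ conc _ i, m x ∈ conc _ i := fun i x hx => by
    by_cases hi : i = 0
    · subst hi
      exact mem_conc_zero _
    · simp only [conc, if_neg hi, AddSubgroup.mem_bot] at hx
      rw [hx, map_zero]
      exact zero_mem _
  have hσm : ∀ x c, scalarTensor f σ hσ σ' (BalTensor.tmul k x c)
      = MulOpposite.op (algScalar f hext R ((Pull.of f).symm c)) • m x := fun x c => by
    change σ'.symm (f (σ x) * (Pull.of f).symm c)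
      = σ'.symm (f (σ x) * HomogAlg.aug hR' (HomogAlg.mk _ (TensorRing.scalar k' _ _)))
    rw [HomogAlg.aug_mk, TensorRing.degZero_scalar]
  let Q' : FreeResolution (opGrading (HomogAlg.grading (relBaseChange f hext R)))
      (Pull (HomogAlg.aug hR')) (conc (Pull (HomogAlg.aug hR'))) :=
    Q.baseChange (g := (algMap f hext R).op) (τ := algTensorOp f hext (fun s a => rfl) hb)
      (e := fun c => MulOpposite.op (algScalar f hext R ((Pull.of f).symm c))) hW
      (algTensorOp_tmul f hext _ hb)
      (fun i a ha => algMap_mem f hext i a.unop ha)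
      m hm hm' (scalarTensor f σ hσ σ') hσm
  -- The square formed by A → A' → k' and A → k → k' commutes, hence Q' ⊗_{A'} k' = (Q ⊗_A k) ⊗_k
  -- k'.
  have hQ' : ∀ n, freeBaseChange (HomogAlg.aug hR').op (Q'.d n)
      = freeBaseChange f.op (freeBaseChange (HomogAlg.aug hR).op (Q.d n)) := by
    intro n
    have e : (HomogAlg.aug hR').op.comp (algMap f hext R).op
        = f.op.comp (HomogAlg.aug hR).op :=
      RingHom.ext fun a => congrArg MulOpposite.op (aug_algMap f hext hR hR' a.unop)
    rw [freeBaseChange_freeBaseChange, ← e]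
    exact freeBaseChange_freeBaseChange _ _ _
  intro n hn i hi
  obtain ⟨n, rfl⟩ : ∃ m, n = m + 1 := ⟨n - 1, by omega⟩
  have h := (torGrading_eq_bot_iff_degreePart hε (augResolution hR) Q n i).1 (hA _ hn i hi)
  rw [torGrading_eq_bot_iff_degreePart hε' (augResolution hR') Q' n i]
  intro z hz
  rw [hQ'] at hz ⊢
  -- The second use of flatness, now for the complex Q ⊗_A k over k, with k ⊗_k k' = k' as
  -- comparison and ρ the projection onto degree i.
  have h1 := freeBaseChange_exact (g := f.op) (W := Pull f)
    (τ := scalarTensor f (M := kᵐᵒᵖ) MulOpposite.opAddEquiv.symm (fun a x => rfl)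
      MulOpposite.opAddEquiv.symm)
    (e := fun c => MulOpposite.op ((Pull.of f).symm c)) hW (fun a c => rfl)
    _ _ (degreePart kᵐᵒᵖ (Q.deg (n + 1)) i) h z hz
  rwa [freeBaseChange_degreePart] at h1

end Main

end NKoszul

end

open NKoszul in
theorem proposition2p8 {k : Type*} {k' : Type*} [Ring k] [Ring k'] (f : k →+* k')
    (hk : IsVonNeumannRegular k) (hk' : IsVonNeumannRegular k')
    {V : Type*} [AddCommGroup V] [Module k V] [Module kᵐᵒᵖ V] [SMulCommClass k kᵐᵒᵖ V]
    [Module k' V] [SMulCommClass k' kᵐᵒᵖ V] (hext : ∀ (a : k) (v : V), f a • v = a • v)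
    (N : ℕ) (R : AddSubgroup (TensorRing k V)) (hR : IsHomogRel N R)
    (hRleft : ∀ (c : k'), ∀ r ∈ R, leftAct f hext c r ∈ R)
    (hA : IsKoszul hR) :
    (∃ hR' : IsHomogRel N (relBaseChange f hext R), IsKoszul hR') ∧
    Function.Bijective (algComparison f hext R) ∧
    (∀ n, (AlgTensor.grading f R n).map (algComparison f hext R)
      = HomogAlg.grading (relBaseChange f hext R) n) ∧
    (∀ n, ∀ t ∈ TensorRing.tpow k V (n + 1), ∀ c d : k',
      algComparison f hext R (AlgTensor.mk f (HomogAlg.mk R (leftAct f hext c t)) d)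
        = HomogAlg.mk _ (TensorRing.scalar k' _ c)
          * algComparison f hext R (AlgTensor.mk f (HomogAlg.mk R t) d)) := by
  have hb : Function.Bijective (algComparison f hext R) :=
    ⟨algComparison_injective f hext hR hRleft, algComparison_surjective f hext R⟩
  have hR' := isHomogRel_relBaseChange f hext hR hRleft
  exact ⟨⟨hR', isKoszul_relBaseChange f hext hk hR hR' hb hA⟩, hb,
    map_grading_algComparison f hext R, algComparison_leftAct f hext R⟩
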